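/- **Lattice.** Let $G=(V,E)$ be the adjacency graph of the spheres of the face-centred cubic packing. Nodes are written in coordinates $(x,y,z)\in\mathbb Z^3$, and the twelve neighbours of $v$ are the nodes $v+\mathrm X$, where $\mathrm X$ is one of $\mathrm{UNE}=(0,0,1)$, $\mathrm{UW}=(1,-1,1)$, $\mathrm{USE}=(0,-1,1)$, $\mathrm N=(0,1,0)$, $\mathrm{NW}=(1,0,0)$, $\mathrm{SW}=(1,-1,0)$, $\mathrm S=-\mathrm N$, $\mathrm{SE}=-\mathrm{NW}$, $\mathrm{NE}=-\mathrm{SW}$, $\mathrm{DSW}=-\mathrm{UNE}$, $\mathrm{DE}=-\mathrm{UW}$, $\mathrm{DNW}=-\mathrm{USE}$. A *column* is a maximal set of consecutive tiled nodes in direction N/S. **Model.** A configuration consists of a finite set $\mathcal T\subset V$ of tiled nodes and the position $p\in V$ of a single agent, which is a deterministic finite automaton and carries at most one tile. It is *connected* if $G|_{\mathcal T}$ is connected, or if $G|_{\mathcal T\cup\{p\}}$ is connected and the agent carries a tile. In each step the agent observes which of $p$ and its twelve neighbours are tiled, and then, depending on this and on its state, changes its state and performs one action: it moves to a neighbour of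 $p$, or places its tile at $p$ (admissible if $p\notin\mathcal T$ and it carries a tile), or picks up the tile at $p$ (admissible if $p\in\mathcal T$ and it carries none). *Shifting* the tile from $v$ to $w$ means placing the carried tile at $w$, returning to $v$ and picking up the tile there. If several directions are listed, the first applicable one is used. For a tiled node $v$ let $N_{\mathcal T}(v)$ be the set of its tiled neighbours. The node $v$ is *removable* if $G|_{N_{\mathcal T}(v)}$ is connected (the empty graph counts as connected). If $v$ is not removable, a node $w\ne v$ with $G|_{N_{\mathcal T}(v)\cup\{w\}}$ connected is a *bridge node* of $v$. **Algorithm BuildIcicle** (it does not halt). It starts in the search phase. *Search phase.* Move to a tile at UW, USE, UNE, NW, SW or N as long as there is one. When there is none, the agent *leaves the search phase* at its current node $v$. *Decision at $v$.* If $v$ is removable, run BuildPar. Otherwise apply the first applicable case and then return to the search phase. - (a) If $v+\mathrm{SE}$ is a bridge node of $v$: shift the tile from $v$ to $v+\mathrm{SE}$ and move to $v+\mathrm S$. - (b) If $v+\mathrm{DE}$ is a bridge node of $v$ and $v$ has a tiled neighbour that is at neither DSW nor SE: shift the tile from $v$ to $v+\mathrm{DE}$. Then, if $v+\mathrm S$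 is empty and $v+\mathrm{SE}$, $v+\mathrm{NE}$ are tiled, move to $v+\mathrm{SE}$ and go S through that column until it ends or there is a tile at UW, USE or SW; otherwise move to the first tile at $v+\mathrm S$, $v+\mathrm{SE}$, $v+\mathrm{NE}$. - (c) If the tiled neighbours of $v$ are exactly those at DSW and SE: move SE and observe $w=v+\mathrm{SE}+\mathrm{DSW}$. If $w$ is empty, shift the tile from $v$ to $w$ and move to $v+\mathrm{SE}$. If $w$ is tiled, move back to $v$ and run BuildPar. - (d) If the tiled neighbours of $v$ are exactly those at DNW, S and NE: move S until a node $w$ is entered that has a tile at UW, USE, SW, DSW, SE or DE, or at which the column ends. If $w$ has a tile at UW, USE or SW, stop this case. Otherwise let $v_k,\dots,v_0=v$ be the nodes of the column from south to north, starting with $v_k=w$ if $w+\mathrm{DE}$ is empty and with $v_k=w+\mathrm N$ if it is tiled. For $i=k,\dots,0$ in this order shift the tile from $v_i$ to $v_i+\mathrm{DE}$, moving NE and DNW from $v_i$ to $v_{i-1}+\mathrm{DE}$ in between. Finally move to $v+\mathrm{NE}$. - (e) If the tiled neighbours of $v$ are exactly those at DNW and S: proceed as in (d) but disregard tiles at DSW,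 with two changes. If the column ends without a tile at UW, USE, SW, SE or DE having been met, run Project on the column. If tiles were shifted, then, instead of the final move to $v+\mathrm{NE}$, move S on empty nodes until there is a tile at S or SE, and enter it. *BuildPar.* Starting at $v$, traverse the columns of the current fragment from west to east. Each column is traversed from N to S; let $c$ be the first column. At each tiled node $p$ of the traversal the following is tested in the given order. 1. If there is a tile at UW, USE or UNE, move to it and return to the search phase. 2. If $p\in c$ and $p+\mathrm{SW}$ is tiled, move there and return to the search phase. 3. If $p+\mathrm{NE}$ is tiled and $p+\mathrm{SE}$ is empty, place the tile at $p+\mathrm{SE}$. 4. If $p+\mathrm N$, $p+\mathrm{SE}$ are tiled and $p+\mathrm{NE}$ is empty, place the tile at $p+\mathrm{NE}$. 5. Otherwise move S. At the empty node $q$ south of the column: if $q+\mathrm N$, $q+\mathrm{NE}$, $q+\mathrm{SE}$ are tiled, place the tile at $q$. Otherwise, if $q+\mathrm{NE}$ is empty, the traversal is complete: move N and run Project. Otherwise enter the next column by moving NE and N, and traverse it in direction N. If during this traversal a tiled node with a tile at NW and none at SW is met, move N to the end of the column, move S to the first node with a tile at NW, and return to the search phase. Otherwise, at the empty node $u$ north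 of the column, place the tile at $u$ if $u+\mathrm S$ and $u+\mathrm{SE}$ are tiled; if not, move S and traverse the column from N to S as above. Whenever BuildPar has placed a tile, the agent returns through tiled nodes to $v$ (the northernmost node of $c$), picks up the tile at $v$, moves to the first tile at S, SE or NE of $v$, and returns to the search phase. *Project.* If the column in which Project starts (the easternmost one of the fragment) has more than one tile: for each column from east to west, and in each column from N to S, shift the tile from each node to the first empty node in direction DSW of it; after the last tile of a column, move NW to the next column. If that column has a single tile, each tile of the row is shifted in the same way from east to west, but instead of moving NW the agent moves SW and DNW, to the node DSW of the next tile of the row. After the last tile, move DSW and return to the search phase. **Icicle.** Let $x_0$ be the minimum $x$-coordinate in the initial set $\mathcal T^0$. For a set $\mathcal T$ of tiled nodes let $y_{\min},y_{\max}$ be the extreme $y$-coordinates in $\mathcal T$, $h=y_{\max}-y_{\min}+1$ and $xy(v)=(x(v)-x_0)\,h+y(v)-y_{\min}$. A *fragment* of $\mathcal T$ is the node set of a connected component of the subgraph of $G$ induced by the tiled nodes with one fixed $z$-coordinate. The set $\mathcal T$ is an *icicle* if it has a fragment $F$ such that - no node of $F$ has a tile at UW, USE or UNE (*platform*); - for each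 $v\in\mathcal T$ there is $w\in F$ with $xy(w)=xy(v)$ (*covering*); - for all $v\in F$ and all integers $0\le i\le xy(v)$ there is $w\in F$ with $xy(w)=i$ (*aligned parallelogram*); - $v+\mathrm{UNE}\in\mathcal T$ for each $v\in\mathcal T\setminus F$. **Theorem.** Let $C^0=(\mathcal T^0,p^0)$ be a connected configuration with $p^0\in\mathcal T^0$, in which the agent carries a tile, and let $C^0,C^1,C^2,\dots$ be the sequence of configurations produced by executing BuildIcicle on $C^0$ step by step. Then every $C^t$ is connected and every action performed is admissible; the agent leaves the search phase infinitely often; and there is a step $t_0$ such that the tiled nodes form an icicle in every configuration $C^t$, $t\ge t_0$, in which the agent leaves the search phase. -/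

import Mathlib

namespace Hybrid3D

/-- Nodes of the face-centred cubic lattice, in the coordinates `(x, y, z)` that grow from `SE` to
`NW`, from `S` to `N`, and from `DSW` to `UNE`, respectively. -/
abbrev Node : Type := ℤ × ℤ × ℤ

/-- The twelve compass directions: three upwards, six in the plane, three downwards. -/
inductive Dir : Type
  | UNE | UW | USE
  | N | NW | SW | S | SE | NE
  | DSW | DE | DNW
  deriving DecidableEq

instance : Fintype Dir where
  elems := {.UNE, .UW, .USE, .N, .NW, .SW, .S, .SE, .NE, .DSW, .DE, .DNW}
  complete := by intro d; cases d <;> simp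

/-- The coordinate change caused by one step in a compass direction. Under the linear map
`(x, y, z) ↦ x • (1, 0, 1) + y • (1, 1, 0) + z • (1, 0, -1)`, which maps `ℤ³` bijectively to the
vectors of `ℤ³` with even coordinate sum (the face-centred cubic lattice), the twelve values are
mapped exactly to the twelve minimal vectors `± eᵢ ± eⱼ` with `i ≠ j`. -/
def Dir.vec : Dir → Node
  | .UNE => (0, 0, 1)
  | .UW => (1, -1, 1)
  | .USE => (0, -1, 1)
  | .N => (0, 1, 0)
  | .NW => (1, 0, 0)
  | .SW => (1, -1, 0)
  | .S => (0, -1, 0)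
  | .SE => (-1, 0, 0)
  | .NE => (-1, 1, 0)
  | .DSW => (0, 0, -1)
  | .DE => (-1, 1, -1)
  | .DNW => (0, 1, -1)

/-- Every direction has an opposite direction. -/
theorem Dir.exists_opposite (d : Dir) : ∃ e : Dir, e.vec = -d.vec := by
  cases d
  · exact ⟨.DSW, rfl⟩
  · exact ⟨.DE, rfl⟩
  · exact ⟨.DNW, rfl⟩
  · exact ⟨.S, rfl⟩
  · exact ⟨.SE, rfl⟩
  · exact ⟨.NE, rfl⟩
  · exact ⟨.N, rfl⟩
  · exact ⟨.NW, rfl⟩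
  · exact ⟨.SW, rfl⟩
  · exact ⟨.UNE, rfl⟩
  · exact ⟨.UW, rfl⟩
  · exact ⟨.USE, rfl⟩

/-- The adjacency graph `G` of the spheres of the face-centred cubic packing. -/
def fcc : SimpleGraph Node where
  Adj u v := ∃ d : Dir, v = u + d.vec
  symm := ⟨by
    rintro u v ⟨d, rfl⟩
    obtain ⟨e, he⟩ := d.exists_opposite
    exact ⟨e, by rw [he, add_neg_cancel_right]⟩⟩
  loopless := ⟨by
    rintro u ⟨d, hd⟩
    have h : d.vec = 0 := by simpa using hd
    revert h
    cases d <;> simp [Dir.vec]⟩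

instance : DecidableRel fcc.Adj := fun u v =>
  inferInstanceAs (Decidable (∃ d : Dir, v = u + d.vec))

/-! ### The agent: a finite automaton performing Look-Compute-Move cycles -/

/-- What the agent observes at its position `p`: whether `p` is tiled, and the set of directions in
which the neighbour of `p` is tiled. -/
structure Look : Type where
  here : Bool
  nbr : Finset Dir

/-- An action of the agent: a move to an adjacent node, placing a tile, or picking up a tile. -/
inductive AgentAction : Type
  | move (d : Dir)
  | place
  | pick

/-- The subgraph of `G` induced by the nodes `v + X`, `X ∈ A`, is connected. (No node at all
counts as connected.) -/
def LocallyConnected (A : Finset Dir) : Prop :=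
  ((fcc.comap Dir.vec).induce {d : Dir | d ∈ A}).Preconnected

instance (A : Finset Dir) : Decidable (LocallyConnected A) :=
  inferInstanceAs (Decidable ((fcc.comap Dir.vec).induce {d : Dir | d ∈ A}).Preconnected)

/-- A node whose tiled neighbours are in the directions `A` is removable. -/
def Removable (A : Finset Dir) : Prop := LocallyConnected A

instance (A : Finset Dir) : Decidable (Removable A) :=
  inferInstanceAs (Decidable (LocallyConnected A))

/-- The neighbour in direction `d` is a bridge node of a node whose tiled neighbours are in the
directions `A`. -/
def IsBridge (A : Finset Dir) (d : Dir) : Prop :=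
  ¬ LocallyConnected A ∧ LocallyConnected (insert d A)

instance (A : Finset Dir) (d : Dir) : Decidable (IsBridge A d) :=
  inferInstanceAs (Decidable (_ ∧ _))

/-- The states of the agent. The Boolean argument of `par`, `parSE…`, `parNE…`, `back` tells
whether the agent is still in the first column of `BuildPar`. The Boolean argument of the states
`col…` is `true` in the last case of the case distinction (tiled neighbours `DNW`, `S` only) and
`false` in the one before it (tiled neighbours `DNW`, `S`, `NE` only). -/
inductive State : Type
  /-- Search phase. -/
  | search
  /-- `BuildPar`: traversal of a column in direction `S`. -/
  | par (first : Bool)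
  /-- `BuildPar`: place a tile at the current node, the `SE` neighbour of the column. -/
  | parSEPlace (first : Bool)
  | parSEReturn (first : Bool)
  /-- `BuildPar`: place a tile at the current node, the `NE` neighbour of the column. -/
  | parNEPlace (first : Bool)
  | parNEReturn (first : Bool)
  /-- `BuildPar`: a tile was placed just below a column. -/
  | parBelowReturn
  /-- `BuildPar`: entering the next column, and its traversal in direction `N`. -/
  | parEnter
  | parNorth
  /-- `BuildPar`: a more northern column was found; go `N` to the end of the current column, and
  then back `S` to the first node with a tile at `NW`. -/
  | parFoundUp
  | parFoundDown
  /-- A tile was placed by `BuildPar`: return to the node at which `BuildPar` was entered. -/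
  | back (first : Bool)
  | backRow
  | leave
  /-- `Project` is entered. -/
  | project
  /-- `Project`, parallelogram of height one. -/
  | lineDown
  | lineUp
  | lineNext
  | lineDescend
  /-- `Project`, all other parallelograms. -/
  | projTop
  | projDown
  | projUp
  | projNext
  /-- Tile shift to `SE`. -/
  | sePlace
  | seReturn
  | sePick
  | seLeave
  /-- Tile shift to `DE`. -/
  | dePlace
  | deReturn
  | dePick
  | deLeave
  | deWalk
  /-- Tile shift to `SE + DSW`. -/
  | lowObserve
  | lowPlace
  | lowReturn
  | lowReturn'
  | lowPick
  | lowLeave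
  /-- Shifting several tiles of a column to `DE`. -/
  | colWalk (last : Bool)
  | colStart (last : Bool)
  | colPlace (last : Bool)
  | colReturn (last : Bool)
  | colPick (last : Bool)
  | colNext (last : Bool)
  | colDescend (last : Bool)
  | colLeave
  deriving DecidableEq, Fintype

open Dir AgentAction

/-- Move `S` through a column in `BuildPar`, looking for violating nodes. -/
def parStep (first : Bool) (o : Look) : AgentAction × State :=
  if o.here then
    if UW ∈ o.nbr then (move UW, .search)
    else if USE ∈ o.nbr then (move USE, .search)
    else if UNE ∈ o.nbr then (move UNE, .search)
    else if first ∧ SW ∈ o.nbr then (move SW, .search)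
    else if NE ∈ o.nbr ∧ SE ∉ o.nbr then (move SE, .parSEPlace first)
    else if N ∈ o.nbr ∧ SE ∈ o.nbr ∧ NE ∉ o.nbr then (move NE, .parNEPlace first)
    else (move S, .par first)
  else
    if N ∈ o.nbr ∧ NE ∈ o.nbr ∧ SE ∈ o.nbr then (place, .parBelowReturn)
    else if NE ∈ o.nbr then (move NE, .parEnter)
    else (move N, .project)

/-- `Project`: move down to the first empty node, and place the tile there. -/
def projDownStep (o : Look) : AgentAction × State :=
  if o.here then (move DSW, .projDown) else (place, .projUp)

/-- `Project`: move to the northernmost node of the column, and then down. -/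
def projTopStep (o : Look) : AgentAction × State :=
  if N ∈ o.nbr then (move N, .projTop) else projDownStep o

/-- The same as `projDownStep`, for a parallelogram of height one. -/
def lineDownStep (o : Look) : AgentAction × State :=
  if o.here then (move DSW, .lineDown) else (place, .lineUp)

/-- The search phase cannot be continued from the current node. -/
def SearchDone (o : Look) : Prop :=
  UW ∉ o.nbr ∧ USE ∉ o.nbr ∧ UNE ∉ o.nbr ∧ NW ∉ o.nbr ∧ SW ∉ o.nbr ∧ N ∉ o.nbr

/-- What the agent does at the node at which it leaves the search phase. -/
def decideStep (o : Look) : AgentAction × State :=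
  if Removable o.nbr then parStep true o
  else if IsBridge o.nbr SE then (move SE, .sePlace)
  else if IsBridge o.nbr DE ∧ ¬ o.nbr ⊆ {DSW, SE} then (move DE, .dePlace)
  else if o.nbr = {DSW, SE} then (move SE, .lowObserve)
  else if o.nbr = {DNW, S, NE} then (move S, .colWalk false)
  else if o.nbr = {DNW, S} then (move S, .colWalk true)
  -- the remaining case does not occur
  else (move S, .search)

/-- One step of the search phase. -/
def searchStep (o : Look) : AgentAction × State :=
  if UW ∈ o.nbr then (move UW, .search)
  else if USE ∈ o.nbr then (move USE, .search)
  else if UNE ∈ o.nbr then (move UNE, .search)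
  else if NW ∈ o.nbr then (move NW, .search)
  else if SW ∈ o.nbr then (move SW, .search)
  else if N ∈ o.nbr then (move N, .search)
  else decideStep o

/-- Move to the first tile at `S`, `SE` or `NE`, and transition to the search phase. -/
def leaveStep (o : Look) : AgentAction × State :=
  if S ∈ o.nbr then (move S, .search)
  else if SE ∈ o.nbr then (move SE, .search)
  else (move NE, .search)

/-- Go `S`, after a more northern column was found, to the first node with a tile at `NW`. -/
def foundDownStep (o : Look) : AgentAction × State :=
  if NW ∈ o.nbr then searchStep o else (move S, .parFoundDown)

/-- Go `N` to the end of the column, after a more northern column was found. -/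
def foundUpStep (o : Look) : AgentAction × State :=
  if N ∈ o.nbr then (move N, .parFoundUp) else foundDownStep o

/-- Return along the common southernmost row to the first column, and there `N` to its northernmost
node, and pick up the tile. -/
def backRowStep (o : Look) : AgentAction × State :=
  if NW ∈ o.nbr then (move NW, .backRow)
  else if SW ∈ o.nbr then (move SW, .backRow)
  else if N ∈ o.nbr then (move N, .backRow)
  else (pick, .leave)

/-- On empty nodes, move `S` until there is a tile at `S` or `SE`, and enter it. -/
def colLeaveStep (o : Look) : AgentAction × State :=
  if S ∈ o.nbr then (move S, .search)
  else if SE ∈ o.nbr then (move SE, .search)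
  else (move S, .colLeave)

/-- Move `S` through the column in the last two cases. A tile at `DSW` is disregarded in the last
case. -/
def colWalkStep (last : Bool) (o : Look) : AgentAction × State :=
  if UW ∈ o.nbr ∨ USE ∈ o.nbr ∨ SW ∈ o.nbr then searchStep o
  else if SE ∈ o.nbr ∨ DE ∈ o.nbr ∨ (last = false ∧ DSW ∈ o.nbr) then
    if DE ∈ o.nbr then (move N, .colStart last) else (move DE, .colPlace last)
  else if S ∈ o.nbr then (move S, .colWalk last)
  else if last then projTopStep o
  else (move DE, .colPlace last)

/-- The transition function of the algorithm `BuildIcicle`. -/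
def transition (q : State) (o : Look) : AgentAction × State :=
  match q with
  | .search => searchStep o
  | .par first => parStep first o
  | .parSEPlace first => (place, .parSEReturn first)
  | .parSEReturn first => (move NW, .back first)
  | .parNEPlace first => (place, .parNEReturn first)
  | .parNEReturn first => (move SW, .back first)
  | .parBelowReturn => (move N, .backRow)
  | .parEnter => (move N, .parNorth)
  | .parNorth =>
    if o.here then
      if SW ∉ o.nbr ∧ NW ∈ o.nbr then foundUpStep o else (move N, .parNorth)
    else if S ∈ o.nbr ∧ SE ∈ o.nbr then (place, .back false)
    else (move S, .par false)
  | .parFoundUp => foundUpStep o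
  | .parFoundDown => foundDownStep o
  | .back true => if N ∈ o.nbr then (move N, .back true) else (pick, .leave)
  | .back false =>
    if SW ∈ o.nbr then (move SW, .back false)
    else if S ∈ o.nbr then (move S, .back false)
    else backRowStep o
  | .backRow => backRowStep o
  | .leave => leaveStep o
  | .project => if N ∉ o.nbr ∧ S ∉ o.nbr then lineDownStep o else projTopStep o
  | .lineDown => lineDownStep o
  | .lineUp => if UNE ∈ o.nbr then (move UNE, .lineUp) else (pick, .lineNext)
  | .lineNext => if NW ∈ o.nbr then (move SW, .lineDescend) else (move DSW, .search)
  | .lineDescend => (move DNW, .lineDown)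
  | .projTop => projTopStep o
  | .projDown => projDownStep o
  | .projUp => if UNE ∈ o.nbr then (move UNE, .projUp) else (pick, .projNext)
  | .projNext =>
    if S ∈ o.nbr then (move S, .projDown)
    else if NW ∈ o.nbr then (move NW, .projTop)
    else (move DSW, .search)
  | .sePlace => (place, .seReturn)
  | .seReturn => (move NW, .sePick)
  | .sePick => (pick, .seLeave)
  | .seLeave => (move S, .search)
  | .dePlace => (place, .deReturn)
  | .deReturn => (move UW, .dePick)
  | .dePick => (pick, .deLeave)
  | .deLeave =>
    if S ∉ o.nbr ∧ SE ∈ o.nbr ∧ NE ∈ o.nbr then (move SE, .deWalk) else leaveStep o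
  | .deWalk =>
    if S ∈ o.nbr ∧ UW ∉ o.nbr ∧ USE ∉ o.nbr ∧ SW ∉ o.nbr then (move S, .deWalk) else searchStep o
  | .lowObserve => if DSW ∈ o.nbr then (move NW, .par true) else (move DSW, .lowPlace)
  | .lowPlace => (place, .lowReturn)
  | .lowReturn => (move UNE, .lowReturn')
  | .lowReturn' => (move NW, .lowPick)
  | .lowPick => (pick, .lowLeave)
  | .lowLeave => (move SE, .search)
  | .colWalk last => colWalkStep last o
  | .colStart last => (move DE, .colPlace last)
  | .colPlace last => (place, .colReturn last)
  | .colReturn last => (move UW, .colPick last)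
  | .colPick last => (pick, .colNext last)
  | .colNext last =>
    if N ∈ o.nbr then (move NE, .colDescend last)
    else if last then colLeaveStep o
    else (move NE, .search)
  | .colDescend last => (move DNW, .colPlace last)
  | .colLeave => colLeaveStep o

/-! ### Configurations and executions -/

/-- A configuration: the finite set of tiled nodes and the position of the agent, together with
whether the agent carries a tile, and its state. -/
structure Config : Type where
  tiles : Finset Node
  pos : Node
  carries : Bool
  state : State

namespace Config

/-- The look phase. -/
def look (C : Config) : Look where
  here := decide (C.pos ∈ C.tiles)
  nbr := Finset.univ.filter fun d : Dir => C.pos + d.vec ∈ C.tiles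

/-- The action that the agent performs in the configuration. -/
def action (C : Config) : AgentAction := (transition C.state C.look).1

/-- Whether the model admits an action: a tile can only be placed at an empty node by an agent that
carries a tile, and only be picked up from a tiled node by an agent that carries none. -/
def Admits (C : Config) : AgentAction → Prop
  | .move _ => True
  | .place => C.pos ∉ C.tiles ∧ C.carries = true
  | .pick => C.pos ∈ C.tiles ∧ C.carries = false

/-- The effect of an action. -/
def perform (C : Config) : AgentAction → Config
  | .move d => { C with pos := C.pos + d.vec }
  | .place => { C with tiles := insert C.pos C.tiles, carries := false }
  | .pick => { C with tiles := C.tiles.erase C.pos, carries := true }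

/-- One Look-Compute-Move cycle. -/
def step (C : Config) : Config :=
  { C.perform C.action with state := (transition C.state C.look).2 }

/-- `G` restricted to the tiled nodes is connected, or `G` restricted to the tiled nodes and the
agent's position is connected and the agent carries a tile. -/
def IsConnected (C : Config) : Prop :=
  (fcc.induce (C.tiles : Set Node)).Connected ∨
    ((fcc.induce ((C.tiles : Set Node) ∪ {C.pos})).Connected ∧ C.carries = true)

/-- The agent leaves the search phase in this configuration. -/
def LeavesSearch (C : Config) : Prop :=
  C.state = .search ∧ SearchDone C.look

end Config

/-- The initial configuration: the agent carries a tile and starts in the search phase. -/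
def initial (T : Finset Node) (p : Node) : Config where
  tiles := T
  pos := p
  carries := true
  state := .search

/-- The configuration that results from executing `BuildIcicle` for `t` steps. -/
def execution (T : Finset Node) (p : Node) (t : ℕ) : Config :=
  Config.step^[t] (initial T p)

/-! ### Icicles -/

/-- The minimum `x`-coordinate in a nonempty finite set of nodes. -/
noncomputable def xMin (T : Finset Node) : ℤ := sInf ((fun v : Node => v.1) '' (T : Set Node))

/-- The minimum `y`-coordinate in a nonempty finite set of nodes. -/
noncomputable def yMin (T : Finset Node) : ℤ := sInf ((fun v : Node => v.2.1) '' (T : Set Node))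

/-- The maximum `y`-coordinate in a nonempty finite set of nodes. -/
noncomputable def yMax (T : Finset Node) : ℤ := sSup ((fun v : Node => v.2.1) '' (T : Set Node))

/-- The height of the bounding cylinder. -/
noncomputable def height (T : Finset Node) : ℤ := yMax T - yMin T + 1

/-- The `xy`-coordinate of a node with respect to the set `T` of tiled nodes, where `x`-coordinates
are normalized such that `x₀` becomes zero. -/
noncomputable def xy (x₀ : ℤ) (T : Finset Node) (v : Node) : ℤ :=
  (v.1 - x₀) * height T + (v.2.1 - yMin T)

/-- `F` is a fragment: the set of nodes of a connected component of the subgraph of `G` induced by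
the tiled nodes of some layer. -/
def IsFragment (T : Finset Node) (F : Set Node) : Prop :=
  ∃ (i : ℤ) (c : (fcc.induce {v : Node | v ∈ T ∧ v.2.2 = i}).ConnectedComponent),
    F = Subtype.val '' c.supp

/-- `F` is a platform: it has no tile at `UW`, `USE` or `UNE`. -/
def IsPlatform (T : Finset Node) (F : Set Node) : Prop :=
  ∀ v ∈ F, v + Dir.vec UW ∉ T ∧ v + Dir.vec USE ∉ T ∧ v + Dir.vec UNE ∉ T

/-- `F` is covering: it covers the `xy`-coordinates of all tiled nodes. -/
def IsCovering (x₀ : ℤ) (T : Finset Node) (F : Set Node) : Prop :=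
  ∀ v ∈ T, ∃ w ∈ F, xy x₀ T w = xy x₀ T v

/-- `F` is an aligned parallelogram. -/
def IsAlignedParallelogram (x₀ : ℤ) (T : Finset Node) (F : Set Node) : Prop :=
  ∀ v ∈ F, ∀ i : ℤ, 0 ≤ i → i ≤ xy x₀ T v → ∃ w ∈ F, xy x₀ T w = i

/-- The tiled nodes form an icicle. -/
def IsIcicle (x₀ : ℤ) (T : Finset Node) : Prop :=
  ∃ F : Set Node, IsFragment T F ∧ IsPlatform T F ∧ IsCovering x₀ T F ∧
    IsAlignedParallelogram x₀ T F ∧ ∀ v ∈ T, v ∉ F → v + Dir.vec UNE ∈ T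

end Hybrid3D

/-!
The execution is cut into phases. A phase starts with the agent on a tile, carrying a tile, and
about to act as in the search phase. `AtSearch.exists_iterate` shows that it ends in such a
situation again, that everything stays connected and admissible until then, and that it had one of
three results (`Outcome`):

* the tiles are unchanged, and the agent has moved to a tile next to the fragment it was in, larger
  in the lexicographic order by `(z, x, y)` (`Climbs`);
* the tiles are still in the same strip `x ≥ x₀`, `y₀ ≤ y ≤ y₁`, still attain `x = x₀`, and the sum
  of their positions in the lexicographic order by `(x, y)` has decreased (`Drop`); this is the
  result of all tile shifts outside of `Project`, and of every tile placed by `BuildPar`, as all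
  these move tiles to a smaller `x`, or to a smaller `y` with the same `x`;
* the fragment of the agent was a platform and a parallelogram, and has been projected: each of its
  tiles has moved to the first empty node in direction `DSW`, and the agent is `DSW` of the former
  fragment (`Projects`).

To see this, one follows the automaton through its states (`Top`, `Walk`, `ParStart`, `Region`,
`Seen` and `Plat` record what the agent has seen on the way). Connectivity is preserved by a shift
because the new node, possibly with a few others, joins the neighbours of the old one; that the case
distinction of the algorithm is complete is read off `locallyConnected_iff`. When a platform is
projected, the nodes `DSW` of it are tiled afterwards; these are joined like the nodes of the
platform, and the other tiles next to the platform are among them or adjacent to them.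

The rest of the argument only uses the three results. A projection does not change the
`(x, y)`-coordinates, hence the sum is constant under the first and the third result, and the second
one occurs only finitely often (`exists_run`). As the search cannot ascend forever, there are
infinitely many projections. Call a fragment that is a platform a peak. A projection replaces the
peak of the agent by the fragment that the agent is in afterwards, and creates no other peak, as a
tile that has moved by more than one layer has a tile at `UNE` (`peaks_projected_subset`). So the
number of peaks is finally constant, and from then on the agent is always in a peak, which it leaves
only by projecting it, and which then extends the projected one (`Run.AtPeak.next`). Its level
tends to minus infinity. A tile that does not hang from the agent's peak in direction `DSW` is never
moved, but a connected set with a fixed number of tiles cannot span arbitrarily many layers; hence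
finally all tiles hang from the agent's peak (`Run.exists_hangs`). This peak is going to be
projected next, therefore it is a parallelogram, and the tiles form an icicle
(`isIcicle_of_hangs`).
-/

namespace Hybrid3D

open Dir AgentAction

/-! ### Connectivity in the lattice -/

/-- The coordinates of the neighbour in direction `d` are checked by `omega`. -/
theorem adj_of {x y z x' y' z' : ℤ} (d : Dir)
    (hx : x' = x + d.vec.1 := by simp only [Dir.vec] <;> omega)
    (hy : y' = y + d.vec.2.1 := by simp only [Dir.vec] <;> omega)
    (hz : z' = z + d.vec.2.2 := by simp only [Dir.vec] <;> omega) :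
    fcc.Adj (x, y, z) (x', y', z') := by
  subst hx hy hz
  exact ⟨d, rfl⟩

/-- `u` and `v` are the ends of a walk all of whose edges join nodes of `A`. If `u ≠ v`, then both
belong to `A`; every node, in `A` or not, is joined to itself. -/
def Joined (A : Set Node) (u v : Node) : Prop :=
  Relation.ReflTransGen (fun a b => a ∈ A ∧ b ∈ A ∧ fcc.Adj a b) u v

/-- `A` is nonempty and the subgraph of `G` that it induces is connected. -/
def Conn (A : Set Node) : Prop := A.Nonempty ∧ ∀ u ∈ A, ∀ v ∈ A, Joined A u v

namespace Joined

variable {A B : Set Node} {u v w : Node}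

theorem refl (A : Set Node) (u : Node) : Joined A u u := Relation.ReflTransGen.refl

theorem trans (h : Joined A u v) (h' : Joined A v w) : Joined A u w :=
  Relation.ReflTransGen.trans h h'

theorem symm (h : Joined A u v) : Joined A v u := by
  induction h with
  | refl => exact refl _ _
  | tail _ hbc ih => exact trans (.single ⟨hbc.2.1, hbc.1, hbc.2.2.symm⟩) ih

theorem of_adj (hu : u ∈ A) (hv : v ∈ A) (h : fcc.Adj u v) : Joined A u v :=
  .single ⟨hu, hv, h⟩

theorem mono (h : Joined A u v) (hAB : A ⊆ B) : Joined B u v :=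
  Relation.ReflTransGen.mono (fun _ _ h => ⟨hAB h.1, hAB h.2.1, h.2.2⟩) _ _ h

theorem mem (h : Joined A u v) (hu : u ∈ A) : v ∈ A := by
  cases h with
  | refl => exact hu
  | tail _ h => exact h.2.1

theorem map {f : Node → Node} (hf : ∀ a ∈ A, ∀ b ∈ A, fcc.Adj a b → Joined B (f a) (f b))
    (h : Joined A u v) : Joined B (f u) (f v) := by
  induction h with
  | refl => exact refl _ _
  | tail _ hbc ih => exact trans ih (hf _ hbc.1 _ hbc.2.1 hbc.2.2)

/-- A set that a walk in `A` cannot leave contains the whole walk. -/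
theorem mem_of_closed {P : Set Node} (hP : ∀ a ∈ P, ∀ b ∈ A, fcc.Adj a b → b ∈ P)
    (h : Joined A u v) (hu : u ∈ P) : v ∈ P := by
  induction h with
  | refl => exact hu
  | tail _ hbc ih => exact hP _ ih _ hbc.2.1 hbc.2.2

end Joined

theorem reachable_induce_iff {A : Set Node} (u v : A) :
    (fcc.induce A).Reachable u v ↔ Joined A u v := by
  constructor
  · rintro ⟨p⟩
    induction p with
    | nil => exact .refl _ _
    | cons h _ ih => exact (Joined.of_adj (Subtype.mem _) (Subtype.mem _) h).trans ih
  · obtain ⟨v, hv⟩ := v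
    intro h
    change Joined A u v at h
    induction h with
    | refl => rfl
    | tail _ hbc ih =>
      exact (ih hbc.1).trans (SimpleGraph.Adj.reachable (G := fcc.induce A)
        (u := ⟨_, hbc.1⟩) (v := ⟨_, hv⟩) hbc.2.2)

theorem connected_induce_iff {A : Set Node} : (fcc.induce A).Connected ↔ Conn A := by
  rw [SimpleGraph.connected_iff, Conn, and_comm, Set.nonempty_coe_sort]
  refine and_congr_right fun _ => ⟨fun h u hu v hv => ?_, fun h u v => ?_⟩
  · exact (reachable_induce_iff ⟨u, hu⟩ ⟨v, hv⟩).1 (h _ _)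
  · exact (reachable_induce_iff u v).2 (h _ u.2 _ v.2)

namespace Conn

variable {A B : Set Node}

theorem joined (h : Conn A) {u v : Node} (hu : u ∈ A) (hv : v ∈ A) : Joined A u v := h.2 u hu v hv

/-- A map that sends adjacent nodes to joined nodes, and that reaches all of `B`, transports
connectivity. -/
theorem map (h : Conn A) (f : Node → Node)
    (hf : ∀ a ∈ A, ∀ b ∈ A, fcc.Adj a b → Joined B (f a) (f b))
    (hs : ∀ b ∈ B, ∃ a ∈ A, Joined B (f a) b) (hB : B.Nonempty) : Conn B := by
  refine ⟨hB, fun u hu v hv => ?_⟩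
  obtain ⟨a, ha, hau⟩ := hs u hu
  obtain ⟨b, hb, hbv⟩ := hs v hv
  exact hau.symm.trans (((h.joined ha hb).map hf).trans hbv)

theorem insert (h : Conn A) {a w : Node} (ha : a ∈ A) (haw : fcc.Adj a w) :
    Conn (insert w A) := by
  have hj : Joined (Insert.insert w A) a w := .of_adj (by simp [ha]) (by simp) haw
  refine h.map id (fun u hu v hv huv => .of_adj (by simp [hu]) (by simp [hv]) huv) ?_ ⟨w, by simp⟩
  rintro b (rfl | hb)
  · exact ⟨a, ha, hj⟩
  · exact ⟨b, hb, .refl _ _⟩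

/-- A node `v` may be replaced by a node `w` to which all neighbours of `v` are joined. -/
theorem swap (h : Conn A) {v w : Node} (hB : ∀ u, u ∈ B ↔ u = w ∨ u ∈ A ∧ u ≠ v)
    (hn : ∀ d : Dir, v + d.vec ∈ A → Joined B w (v + d.vec)) (hv : v ∈ A) : Conn B := by
  classical
  have hw : w ∈ B := (hB w).2 (.inl rfl)
  refine h.map (fun u => if u = v then w else u) ?_ ?_ ⟨w, hw⟩
  · intro a ha b hb hab
    by_cases h1 : a = v <;> by_cases h2 : b = v
    · simp [h1, h2, Joined.refl]
    · obtain ⟨d, rfl⟩ := hab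
      subst h1
      simpa [h2] using hn d hb
    · obtain ⟨d, rfl⟩ := hab.symm
      subst h2
      simpa [h1] using (hn d ha).symm
    · simpa [h1, h2] using Joined.of_adj ((hB a).2 (.inr ⟨ha, h1⟩)) ((hB b).2 (.inr ⟨hb, h2⟩)) hab
  · intro b hb
    rcases (hB b).1 hb with rfl | ⟨hb, hbv⟩
    · exact ⟨v, hv, by simp [Joined.refl]⟩
    · exact ⟨b, hb, by simp [hbv, Joined.refl]⟩

/-- The `z`-coordinates in a connected set differ by at most its cardinality. -/
theorem z_span {T : Finset Node} (h : Conn (T : Set Node)) {u v : Node} (hu : u ∈ T) (hv : v ∈ T) :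
    u.2.2 ≤ v.2.2 + T.card := by
  classical
  have hr := (reachable_induce_iff (A := (T : Set Node)) ⟨v, hv⟩ ⟨u, hu⟩).2
    (h.joined (u := v) (v := u) hv hu)
  obtain ⟨p, hp⟩ := hr.exists_isPath
  have hlen : ∀ (a b : (T : Set Node)) (q : (fcc.induce (T : Set Node)).Walk a b),
      b.1.2.2 ≤ a.1.2.2 + q.length := by
    intro a b q
    induction q with
    | nil => simp
    | @cons a c b hac _ ih =>
      obtain ⟨d, hd⟩ := (show fcc.Adj a.1 c.1 from hac)
      have : c.1.2.2 ≤ a.1.2.2 + 1 := by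
        have h1 : c.1.2.2 = a.1.2.2 + d.vec.2.2 := by
          have := congrArg (fun w : Node => w.2.2) hd
          simpa using this
        rw [h1]
        cases d <;> simp [Dir.vec]
      simp only [SimpleGraph.Walk.length_cons]
      push_cast
      omega
  have h1 := hlen _ _ p
  have h2 := hp.length_lt
  have h3 : Fintype.card (T : Set Node) = T.card := by simp
  rw [h3] at h2
  simp only at h1
  omega

end Conn

/-! ### Executing the automaton -/

/-- What an agent at `p` observes. -/
def lookAt (T : Finset Node) (p : Node) : Look where
  here := decide (p ∈ T)
  nbr := Finset.univ.filter fun d : Dir => p + d.vec ∈ T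

section Look

variable {T : Finset Node} {p : Node} {x y z : ℤ}

theorem mem_nbr {d : Dir} : d ∈ (lookAt T p).nbr ↔ p + d.vec ∈ T := by simp [lookAt]

@[simp] theorem here_lookAt : (lookAt T p).here = decide (p ∈ T) := rfl

@[simp] theorem UNE_mem : UNE ∈ (lookAt T (x, y, z)).nbr ↔ (x, y, z + 1) ∈ T := by
  simp [mem_nbr, Dir.vec]

@[simp] theorem UW_mem : UW ∈ (lookAt T (x, y, z)).nbr ↔ (x + 1, y - 1, z + 1) ∈ T := by
  simp [mem_nbr, Dir.vec, ← sub_eq_add_neg]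

@[simp] theorem USE_mem : USE ∈ (lookAt T (x, y, z)).nbr ↔ (x, y - 1, z + 1) ∈ T := by
  simp [mem_nbr, Dir.vec, ← sub_eq_add_neg]

@[simp] theorem N_mem : N ∈ (lookAt T (x, y, z)).nbr ↔ (x, y + 1, z) ∈ T := by
  simp [mem_nbr, Dir.vec]

@[simp] theorem NW_mem : NW ∈ (lookAt T (x, y, z)).nbr ↔ (x + 1, y, z) ∈ T := by
  simp [mem_nbr, Dir.vec]

@[simp] theorem SW_mem : SW ∈ (lookAt T (x, y, z)).nbr ↔ (x + 1, y - 1, z) ∈ T := by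
  simp [mem_nbr, Dir.vec, ← sub_eq_add_neg]

@[simp] theorem S_mem : S ∈ (lookAt T (x, y, z)).nbr ↔ (x, y - 1, z) ∈ T := by
  simp [mem_nbr, Dir.vec, ← sub_eq_add_neg]

@[simp] theorem SE_mem : SE ∈ (lookAt T (x, y, z)).nbr ↔ (x - 1, y, z) ∈ T := by
  simp [mem_nbr, Dir.vec, ← sub_eq_add_neg]

@[simp] theorem NE_mem : NE ∈ (lookAt T (x, y, z)).nbr ↔ (x - 1, y + 1, z) ∈ T := by
  simp [mem_nbr, Dir.vec, ← sub_eq_add_neg]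

@[simp] theorem DSW_mem : DSW ∈ (lookAt T (x, y, z)).nbr ↔ (x, y, z - 1) ∈ T := by
  simp [mem_nbr, Dir.vec, ← sub_eq_add_neg]

@[simp] theorem DE_mem : DE ∈ (lookAt T (x, y, z)).nbr ↔ (x - 1, y + 1, z - 1) ∈ T := by
  simp [mem_nbr, Dir.vec, ← sub_eq_add_neg]

@[simp] theorem DNW_mem : DNW ∈ (lookAt T (x, y, z)).nbr ↔ (x, y + 1, z - 1) ∈ T := by
  simp [mem_nbr, Dir.vec, ← sub_eq_add_neg]

end Look

/-- The configuration is connected, its action is admissible, and if the agent is in the search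
phase, then the tiled nodes are still those of `T₀`. -/
def Good (T₀ : Finset Node) (C : Config) : Prop :=
  C.IsConnected ∧ C.Admits C.action ∧ (C.state = .search → C.tiles = T₀)

/-- The execution from `C` reaches a configuration that satisfies `Q`, and all configurations
before are good. -/
inductive Ends (T₀ : Finset Node) (Q : Config → Prop) : Config → Prop
  | done {C : Config} (h : Q C) : Ends T₀ Q C
  | step {C : Config} (h : Good T₀ C) (h' : Ends T₀ Q C.step) : Ends T₀ Q C

theorem isConnected_of_tiles {T : Finset Node} {p : Node} {b : Bool} {q : State}
    (h : Conn (T : Set Node)) : (Config.mk T p b q).IsConnected :=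
  .inl (connected_induce_iff.2 h)

theorem isConnected_of_insert {T : Finset Node} {p : Node} {q : State}
    (h : Conn (insert p (T : Set Node))) : (Config.mk T p true q).IsConnected := by
  refine .inr ⟨connected_induce_iff.2 ?_, rfl⟩
  rwa [Set.union_singleton]

namespace Ends

variable {T₀ T : Finset Node} {Q : Config → Prop} {p p' : Node} {b : Bool} {q q' : State}

theorem move {d : Dir} (ht : transition q (lookAt T p) = (.move d, q'))
    (hc : (Config.mk T p b q).IsConnected) (h : Ends T₀ Q ⟨T, p', b, q'⟩)
    (hp : p + d.vec = p' := by
      simp only [Dir.vec, Prod.mk_add_mk, Prod.mk.injEq]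
      refine ⟨?_, ?_, ?_⟩ <;> first | trivial | omega)
    (hq : q = .search → T = T₀ := by nofun) : Ends T₀ Q ⟨T, p, b, q⟩ := by
  have ht' : transition q (Config.mk T p b q).look = (.move d, q') := ht
  refine .step ⟨hc, ?_, hq⟩ ?_
  · simp [Config.action, ht', Config.Admits]
  · simpa [Config.step, Config.action, ht', Config.perform, hp] using h

theorem place (ht : transition q (lookAt T p) = (.place, q')) (hp : p ∉ T)
    (hc : Conn (insert p (T : Set Node))) (h : Ends T₀ Q ⟨insert p T, p, false, q'⟩)
    (hq : q = .search → T = T₀ := by nofun) : Ends T₀ Q ⟨T, p, true, q⟩ := by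
  have ht' : transition q (Config.mk T p true q).look = (.place, q') := ht
  refine .step ⟨isConnected_of_insert hc, ?_, hq⟩ ?_
  · simp [Config.action, ht', Config.Admits, hp]
  · simpa [Config.step, Config.action, ht', Config.perform] using h

theorem pick (ht : transition q (lookAt T p) = (.pick, q')) (hp : p ∈ T)
    (hc : Conn (T : Set Node)) (h : Ends T₀ Q ⟨T.erase p, p, true, q'⟩)
    (hq : q = .search → T = T₀ := by nofun) : Ends T₀ Q ⟨T, p, false, q⟩ := by
  have ht' : transition q (Config.mk T p false q).look = (.pick, q') := ht
  refine .step ⟨isConnected_of_tiles hc, ?_, hq⟩ ?_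
  · simp [Config.action, ht', Config.Admits, hp]
  · simpa [Config.step, Config.action, ht', Config.perform] using h

theorem exists_iterate {C : Config} (h : Ends T₀ Q C) :
    ∃ n : ℕ, Q (Config.step^[n] C) ∧ ∀ i < n, Good T₀ (Config.step^[i] C) := by
  induction h with
  | done h => exact ⟨0, h, by simp⟩
  | step h _ ih =>
    obtain ⟨n, hn, hi⟩ := ih
    refine ⟨n + 1, hn, fun i hin => ?_⟩
    cases i with
    | zero => exact h
    | succ i => exact hi i (by omega)

end Ends

/-! ### Fragments, shifts and projections -/

/-- `P` is a nonempty set of tiles of one layer that is connected and has no further tile of that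
layer adjacent to it. -/
structure IsFrag (T P : Finset Node) : Prop where
  nonempty : P.Nonempty
  subset : P ⊆ T
  level : ∀ a ∈ P, ∀ b ∈ P, a.2.2 = b.2.2
  closed : ∀ a ∈ P, ∀ b ∈ T, fcc.Adj a b → b.2.2 = a.2.2 → b ∈ P
  joined : ∀ a ∈ P, ∀ b ∈ P, Joined P a b

/-- `P` consists of full columns `b ≤ y ≤ t` at `xe ≤ x < X`, and of the column `b ≤ y ≤ t₀`, which
may be shorter, at `x = X`. -/
def IsParallelogram (P : Finset Node) : Prop :=
  ∃ xe X b t₀ t Z : ℤ, xe ≤ X ∧ b ≤ t₀ ∧ t₀ ≤ t ∧ (xe = X → t = t₀) ∧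
    ∀ x y z, (x, y, z) ∈ P ↔ z = Z ∧ b ≤ y ∧ (x = X ∧ y ≤ t₀ ∨ xe ≤ x ∧ x < X ∧ y ≤ t)

/-- A bound on all coordinates, by which the agent's walks through tiles end. -/
theorem exists_bound (T : Finset Node) : ∃ M : ℤ, ∀ x y z, (x, y, z) ∈ T →
    -M ≤ x ∧ x ≤ M ∧ -M ≤ y ∧ y ≤ M ∧ -M ≤ z ∧ z ≤ M := by
  refine ⟨∑ v ∈ T, (|v.1| + |v.2.1| + |v.2.2|), fun x y z h => ?_⟩
  have h1 : |x| + |y| + |z| ≤ ∑ v ∈ T, (|v.1| + |v.2.1| + |v.2.2|) :=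
    Finset.single_le_sum (f := fun v : Node => |v.1| + |v.2.1| + |v.2.2|)
      (fun v _ => by positivity) h
  have := abs_nonneg x
  have := abs_nonneg y
  have := abs_nonneg z
  have := neg_abs_le x
  have := neg_abs_le y
  have := neg_abs_le z
  have := le_abs_self x
  have := le_abs_self y
  have := le_abs_self z
  refine ⟨?_, ?_, ?_, ?_, ?_, ?_⟩ <;> linarith

theorem exists_empty_below (T : Finset Node) (p : Node) :
    ∃ n : ℕ, (p.1, p.2.1, p.2.2 - ((n : ℤ) + 1)) ∉ T := by
  obtain ⟨M, hM⟩ := exists_bound T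
  refine ⟨(p.2.2 + M).toNat, fun h => ?_⟩
  have := hM _ _ _ h
  omega

/-- The number of steps in direction `DSW` from `p` to the first empty node. -/
def depth (T : Finset Node) (p : Node) : ℤ := (Nat.find (exists_empty_below T p) : ℤ) + 1

/-- The first empty node in direction `DSW` of `p`. -/
def low (T : Finset Node) (p : Node) : Node := (p.1, p.2.1, p.2.2 - depth T p)

theorem depth_pos (T : Finset Node) (p : Node) : 1 ≤ depth T p := by unfold depth; omega

theorem low_notMem (T : Finset Node) (p : Node) : low T p ∉ T :=
  Nat.find_spec (exists_empty_below T p)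

theorem mem_of_lt_depth (T : Finset Node) {p : Node} {i : ℤ} (h1 : 1 ≤ i) (h2 : i < depth T p) :
    (p.1, p.2.1, p.2.2 - i) ∈ T := by
  have := Nat.find_min (exists_empty_below T p) (m := (i - 1).toNat) (by unfold depth at h2; omega)
  rw [not_not] at this
  convert this using 3
  omega

/-- The tiled nodes after each tile of `P` has been shifted to the first empty node in direction
`DSW`. -/
def projected (T P : Finset Node) : Finset Node := (T \ P) ∪ P.image (low T)

theorem mem_projected {T P : Finset Node} {w : Node} :
    w ∈ projected T P ↔ (w ∈ T ∧ w ∉ P) ∨ ∃ p ∈ P, low T p = w := by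
  simp [projected]

/-- All tiles lie in the strip `x ≥ x₀`, `y₀ ≤ y ≤ y₁`, and the bound on `x` is attained. -/
def InBox (x₀ y₀ y₁ : ℤ) (T : Finset Node) : Prop :=
  (∀ v ∈ T, x₀ ≤ v.1 ∧ y₀ ≤ v.2.1 ∧ v.2.1 ≤ y₁) ∧ ∃ v ∈ T, v.1 = x₀

/-- A potential that orders the positions of a tile in the strip lexicographically by `(x, y)`. -/
def potential (x₀ y₀ y₁ : ℤ) (T : Finset Node) : ℤ :=
  ∑ v ∈ T, ((v.1 - x₀) * (y₁ - y₀ + 1) + (v.2.1 - y₀))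

theorem potential_nonneg {x₀ y₀ y₁ : ℤ} {T : Finset Node} (h : InBox x₀ y₀ y₁ T) :
    0 ≤ potential x₀ y₀ y₁ T := by
  refine Finset.sum_nonneg fun v hv => ?_
  obtain ⟨h1, h2, h3⟩ := h.1 v hv
  have := mul_nonneg (sub_nonneg.2 h1) (by omega : 0 ≤ y₁ - y₀ + 1)
  omega

/-- Passing from `T` to `T'` respects every strip, and decreases the potential. -/
def Drop (T T' : Finset Node) : Prop :=
  ∀ x₀ y₀ y₁ : ℤ, InBox x₀ y₀ y₁ T →
    InBox x₀ y₀ y₁ T' ∧ potential x₀ y₀ y₁ T' < potential x₀ y₀ y₁ T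

theorem Drop.trans {T T' T'' : Finset Node} (h : Drop T T') (h' : Drop T' T'') : Drop T T'' :=
  fun x₀ y₀ y₁ hb =>
    let h1 := h x₀ y₀ y₁ hb
    let h2 := h' x₀ y₀ y₁ h1.1
    ⟨h2.1, h2.2.trans h1.2⟩

/-- Shifting a single tile from `(x, y, z)` to `(x', y', z')`. -/
theorem drop_shift {T : Finset Node} {x y z x' y' z' : ℤ} (hv : (x, y, z) ∈ T)
    (hw : (x', y', z') ∉ T) (hlt : x' < x ∨ x' = x ∧ y' < y) (ha : ∃ a ∈ T, a.1 ≤ x')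
    (hb : ∃ a ∈ T, a.2.1 ≤ y') (hc : ∃ a ∈ T, y' ≤ a.2.1) :
    Drop T (insert (x', y', z') (T.erase (x, y, z))) := by
  intro x₀ y₀ y₁ hbox
  obtain ⟨a, haT, ha⟩ := ha
  obtain ⟨b, hbT, hb⟩ := hb
  obtain ⟨c, hcT, hc⟩ := hc
  have ha' := hbox.1 a haT
  have hb' := hbox.1 b hbT
  have hc' := hbox.1 c hcT
  have hv' := hbox.1 _ hv
  simp only at hv'
  refine ⟨⟨?_, ?_⟩, ?_⟩
  · intro u hu
    rcases Finset.mem_insert.1 hu with rfl | hu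
    · refine ⟨?_, ?_, ?_⟩ <;> simp only <;> omega
    · exact hbox.1 u (Finset.mem_of_mem_erase hu)
  · obtain ⟨u, huT, hu⟩ := hbox.2
    by_cases h : u = (x, y, z)
    · subst h
      refine ⟨_, Finset.mem_insert_self _ _, ?_⟩
      simp only at hu ⊢
      omega
    · exact ⟨u, by simp [h, huT], hu⟩
  · unfold potential
    rw [Finset.sum_insert (by simp [hw]), ← Finset.add_sum_erase T _ hv]
    refine add_lt_add_of_lt_of_le ?_ le_rfl
    simp only
    rcases hlt with h | ⟨rfl, h⟩
    · have h2 : (x' - x₀ + 1) * (y₁ - y₀ + 1) ≤ (x - x₀) * (y₁ - y₀ + 1) :=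
        mul_le_mul_of_nonneg_right (by omega) (by omega)
      have h3 : (x' - x₀ + 1) * (y₁ - y₀ + 1) = (x' - x₀) * (y₁ - y₀ + 1) + (y₁ - y₀ + 1) := by ring
      omega
    · omega

/-! ### What a phase achieves -/

/-- The tiles of the layer with `z`-coordinate `z`. -/
def layer (T : Finset Node) (z : ℤ) : Set Node := {u | u ∈ T ∧ u.2.2 = z}

/-- The lexicographic order by `(z, x, y)`, in which the search phase ascends. -/
def LexLt (u v : Node) : Prop :=
  u.2.2 < v.2.2 ∨ u.2.2 = v.2.2 ∧ (u.1 < v.1 ∨ u.1 = v.1 ∧ u.2.1 < v.2.1)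

/-- The agent has left `v` for a lexicographically larger tile `p` which is adjacent to the fragment
of `v`. -/
def Climbs (T : Finset Node) (v p : Node) : Prop :=
  LexLt v p ∧ ∃ r, Joined (layer T v.2.2) v r ∧ fcc.Adj r p

/-- The fragment of `v` is a parallelogram and a platform, and has been projected; the agent is now
at a node `DSW` of it. -/
def Projects (T : Finset Node) (v : Node) (T' : Finset Node) (p : Node) : Prop :=
  ∃ P : Finset Node, v ∈ P ∧ IsFrag T P ∧ IsPlatform T (P : Set Node) ∧ IsParallelogram P ∧
    T' = projected T P ∧ ∃ u ∈ P, p = u + DSW.vec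

/-- The agent carries a tile, stands on a tile, and is about to perform a step as in the search
phase. -/
structure AtSearch (C : Config) : Prop where
  pos_mem : C.pos ∈ C.tiles
  carries : C.carries = true
  conn : Conn (C.tiles : Set Node)
  trans : transition C.state C.look = searchStep C.look

/-- The three possible results of a phase that started with the tiles `T` and the agent at `v`. -/
def Outcome (T : Finset Node) (v : Node) (C : Config) : Prop :=
  AtSearch C ∧ (C.tiles = T ∧ C.state = .search ∧ Climbs T v C.pos ∨ Drop T C.tiles ∨
    C.state = .search ∧ Projects T v C.tiles C.pos)

theorem Ends.of_climbs {T₀ T : Finset Node} {v p : Node} (h : Climbs T v p) (hp : p ∈ T)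
    (hT : Conn (T : Set Node)) : Ends T₀ (Outcome T v) ⟨T, p, true, .search⟩ :=
  .done ⟨⟨hp, rfl, hT, rfl⟩, .inl ⟨rfl, rfl, h⟩⟩

theorem Ends.of_drop {T₀ T T' : Finset Node} {v p : Node} (h : Drop T T') (hp : p ∈ T')
    (hT : Conn (T' : Set Node)) : Ends T₀ (Outcome T v) ⟨T', p, true, .search⟩ :=
  .done ⟨⟨hp, rfl, hT, rfl⟩, .inr (.inl h)⟩

/-- A step of the search phase that is not its last one. -/
theorem Ends.searchStep {T₀ T : Finset Node} {v : Node} {x y z : ℤ} {q : State}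
    (hq : q = .search → T = T₀) (hT : Conn (T : Set Node))
    (ht : transition q (lookAt T (x, y, z)) = searchStep (lookAt T (x, y, z)))
    (hs : ¬ SearchDone (lookAt T (x, y, z)))
    (hup : ∀ p ∈ T, (p = (x + 1, y - 1, z + 1) ∨ p = (x, y - 1, z + 1) ∨ p = (x, y, z + 1) ∨
      p = (x + 1, y, z) ∨ p = (x + 1, y - 1, z) ∨
      p = (x, y + 1, z) ∧ (x + 1, y - 1, z + 1) ∉ T ∧ (x, y - 1, z + 1) ∉ T ∧ (x + 1, y, z) ∉ T ∧
        (x + 1, y - 1, z) ∉ T) → fcc.Adj (x, y, z) p → Climbs T v p) :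
    Ends T₀ (Outcome T v) ⟨T, (x, y, z), true, q⟩ := by
  by_cases h1 : (x + 1, y - 1, z + 1) ∈ T
  · exact .move (d := UW) (by rw [ht]; simp [Hybrid3D.searchStep, h1]) (isConnected_of_tiles hT)
      (.of_climbs (hup _ h1 (by simp) (adj_of UW)) h1 hT) (hq := hq)
  by_cases h2 : (x, y - 1, z + 1) ∈ T
  · exact .move (d := USE) (by rw [ht]; simp [Hybrid3D.searchStep, h1, h2])
      (isConnected_of_tiles hT) (.of_climbs (hup _ h2 (by simp) (adj_of USE)) h2 hT) (hq := hq)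
  by_cases h3 : (x, y, z + 1) ∈ T
  · exact .move (d := UNE) (by rw [ht]; simp [Hybrid3D.searchStep, h1, h2, h3])
      (isConnected_of_tiles hT) (.of_climbs (hup _ h3 (by simp) (adj_of UNE)) h3 hT) (hq := hq)
  by_cases h4 : (x + 1, y, z) ∈ T
  · exact .move (d := NW) (by rw [ht]; simp [Hybrid3D.searchStep, h1, h2, h3, h4])
      (isConnected_of_tiles hT) (.of_climbs (hup _ h4 (by simp) (adj_of NW)) h4 hT) (hq := hq)
  by_cases h5 : (x + 1, y - 1, z) ∈ T
  · exact .move (d := SW) (by rw [ht]; simp [Hybrid3D.searchStep, h1, h2, h3, h4, h5])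
      (isConnected_of_tiles hT) (.of_climbs (hup _ h5 (by simp) (adj_of SW)) h5 hT) (hq := hq)
  by_cases h6 : (x, y + 1, z) ∈ T
  · exact .move (d := N) (by rw [ht]; simp [Hybrid3D.searchStep, h1, h2, h3, h4, h5, h6])
      (isConnected_of_tiles hT)
      (.of_climbs (hup _ h6 (by simp [h1, h2, h4, h5]) (adj_of N)) h6 hT) (hq := hq)
  · exact absurd (by simp [SearchDone, h1, h2, h3, h4, h5, h6]) hs

/-! ### Local connectivity -/

/-- The directions in which an agent that leaves the search phase may still see tiles. -/
def lowDirs : Finset Dir := {S, SE, NE, DSW, DE, DNW}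

namespace LocallyConnected

variable {A : Finset Dir}

/-- The neighbours of `v` in the directions of a locally connected set are joined in every set that
contains them. -/
theorem joined (h : LocallyConnected A) {v : Node} {B : Set Node}
    (hB : ∀ d ∈ A, v + d.vec ∈ B) {d e : Dir} (hd : d ∈ A) (he : e ∈ A) :
    Joined B (v + d.vec) (v + e.vec) := by
  obtain ⟨p⟩ := h ⟨d, hd⟩ ⟨e, he⟩
  have key : ∀ (a b : {d : Dir | d ∈ A})
      (_ : ((fcc.comap Dir.vec).induce {d : Dir | d ∈ A}).Walk a b),
      Joined B (v + a.1.vec) (v + b.1.vec) := by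
    intro a b q
    induction q with
    | nil => exact .refl _ _
    | @cons a c b hac _ ih =>
      obtain ⟨f, hf⟩ := (show fcc.Adj a.1.vec c.1.vec from hac)
      exact (Joined.of_adj (hB _ a.2) (hB _ c.2) ⟨f, by rw [hf, add_assoc]⟩).trans ih
  exact key _ _ p

/-- A property that adjacent members of a locally connected set share is shared by all members. -/
theorem const (h : LocallyConnected A) (f : Dir → Prop)
    (hf : ∀ d ∈ A, ∀ e ∈ A, fcc.Adj d.vec e.vec → f d → f e) {d e : Dir} (hd : d ∈ A)
    (he : e ∈ A) (h' : f d) : f e := by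
  obtain ⟨p⟩ := h ⟨d, hd⟩ ⟨e, he⟩
  have key : ∀ (a b : {d : Dir | d ∈ A})
      (_ : ((fcc.comap Dir.vec).induce {d : Dir | d ∈ A}).Walk a b), f a.1 → f b.1 := by
    intro a b q
    induction q with
    | nil => exact id
    | @cons a c b hac _ ih => exact fun ha => ih (hf _ a.2 _ c.2 hac ha)
  exact key _ _ p h'

/-- A set all of whose members are adjacent to a member `c`, or to a neighbour of `c` in the set,
is locally connected. -/
theorem of_hub {c : Dir} (hc : c ∈ A)
    (h : ∀ d ∈ A, d = c ∨ fcc.Adj d.vec c.vec ∨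
      ∃ e ∈ A, fcc.Adj d.vec e.vec ∧ fcc.Adj e.vec c.vec) : LocallyConnected A := by
  have key : ∀ d : {d : Dir | d ∈ A},
      ((fcc.comap Dir.vec).induce {d : Dir | d ∈ A}).Reachable d ⟨c, hc⟩ := by
    rintro ⟨d, hd⟩
    rcases h d hd with rfl | h | ⟨e, he, h1, h2⟩
    · rfl
    · exact SimpleGraph.Adj.reachable (G := (fcc.comap Dir.vec).induce {d : Dir | d ∈ A}) h
    · exact (SimpleGraph.Adj.reachable (G := (fcc.comap Dir.vec).induce {d : Dir | d ∈ A})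
        (u := ⟨d, hd⟩) (v := ⟨e, he⟩) h1).trans
        (SimpleGraph.Adj.reachable (G := (fcc.comap Dir.vec).induce {d : Dir | d ∈ A}) h2)
  exact fun d e => (key d).trans (key e).symm

end LocallyConnected

/-- Local connectivity for tiles below or to the east: `DE` is adjacent to everything but `S`; and
without `DE`, the only edge between `{S, SE, NE}` and `{DSW, DNW}` is the one from `S` to `DSW`. -/
theorem locallyConnected_iff {A : Finset Dir} (hA : A ⊆ lowDirs) :
    LocallyConnected A ↔
      (DE ∈ A → ¬ (S ∈ A ∧ SE ∉ A ∧ DSW ∉ A)) ∧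
      (DE ∉ A → ¬ (S ∈ A ∧ NE ∈ A ∧ SE ∉ A) ∧
        ((DSW ∉ A ∧ DNW ∉ A) ∨ (S ∉ A ∧ SE ∉ A ∧ NE ∉ A) ∨ (S ∈ A ∧ DSW ∈ A))) := by
  have hA' : ∀ d ∈ A, d = S ∨ d = SE ∨ d = NE ∨ d = DSW ∨ d = DE ∨ d = DNW := by
    intro d hd
    simpa [lowDirs] using hA hd
  constructor
  · intro h
    refine ⟨fun hde ⟨hs, hse, hw⟩ => ?_, fun hde => ⟨fun ⟨hs, hne, hse⟩ => ?_, ?_⟩⟩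
    · have := h.const (· = S) (fun d hd e he hadj hds => ?_) hs hde rfl
      · simp at this
      · subst hds
        rcases hA' e he with rfl | rfl | rfl | rfl | rfl | rfl <;> first | rfl | contradiction
    · have := h.const (· = NE) (fun d hd e he hadj hds => ?_) hne hs rfl
      · simp at this
      · subst hds
        rcases hA' e he with rfl | rfl | rfl | rfl | rfl | rfl <;> first | rfl | contradiction
    · by_contra hcon
      have hup : ∃ d ∈ A, d = S ∨ d = SE ∨ d = NE := by
        by_contra! hn
        exact hcon (.inr (.inl ⟨fun h => (hn _ h).1 rfl, fun h => (hn _ h).2.1 rfl,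
          fun h => (hn _ h).2.2 rfl⟩))
      have hlo : ∃ d ∈ A, ¬ (d = S ∨ d = SE ∨ d = NE) := by
        by_contra! hn
        exact hcon (.inl ⟨fun h => by simpa using hn _ h, fun h => by simpa using hn _ h⟩)
      obtain ⟨d, hd, hdu⟩ := hup
      obtain ⟨e, he, hel⟩ := hlo
      refine hel (h.const (fun d => d = S ∨ d = SE ∨ d = NE) ?_ hd he hdu)
      intro d hd e he hadj hds
      have hsw : ¬ (S ∈ A ∧ DSW ∈ A) := fun h => hcon (.inr (.inr h))
      rcases hds with rfl | rfl | rfl <;>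
      rcases hA' e he with rfl | rfl | rfl | rfl | rfl | rfl <;> tauto
  · rintro ⟨h1, h2⟩
    by_cases hde : DE ∈ A
    · refine .of_hub hde fun d hd => ?_
      rcases hA' d hd with rfl | rfl | rfl | rfl | rfl | rfl
      · by_cases hse : SE ∈ A
        · exact .inr (.inr ⟨SE, hse, by decide⟩)
        · exact .inr (.inr ⟨DSW, by tauto, by decide⟩)
      all_goals first | exact .inl rfl | exact .inr (.inl (by decide))
    · obtain ⟨h3, h4⟩ := h2 hde
      rcases h4 with ⟨h4, h5⟩ | ⟨h4, h5, h6⟩ | ⟨h4, h5⟩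
      · by_cases hse : SE ∈ A
        · refine .of_hub hse fun d hd => ?_
          rcases hA' d hd with rfl | rfl | rfl | rfl | rfl | rfl <;>
            first | contradiction | exact .inl rfl | exact .inr (.inl (by decide))
        · intro ⟨d, hd⟩ ⟨e, he⟩
          have hd' : d ∈ A := hd
          have he' : e ∈ A := he
          have : d = e := by
            rcases hA' d hd with rfl | rfl | rfl | rfl | rfl | rfl <;>
            rcases hA' e he with rfl | rfl | rfl | rfl | rfl | rfl <;> tauto
          subst this
          rfl
      · by_cases hw : DSW ∈ A
        · refine .of_hub hw fun d hd => ?_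
          rcases hA' d hd with rfl | rfl | rfl | rfl | rfl | rfl <;>
            first | contradiction | exact .inl rfl | exact .inr (.inl (by decide))
        · intro ⟨d, hd⟩ ⟨e, he⟩
          have hd' : d ∈ A := hd
          have he' : e ∈ A := he
          have : d = e := by
            rcases hA' d hd with rfl | rfl | rfl | rfl | rfl | rfl <;>
            rcases hA' e he with rfl | rfl | rfl | rfl | rfl | rfl <;> tauto
          subst this
          rfl
      · refine .of_hub h4 fun d hd => ?_
        rcases hA' d hd with rfl | rfl | rfl | rfl | rfl | rfl
        · exact .inl rfl
        · exact .inr (.inl (by decide))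
        · exact .inr (.inr ⟨SE, by tauto, by decide⟩)
        · exact .inr (.inl (by decide))
        · contradiction
        · exact .inr (.inr ⟨DSW, h5, by decide⟩)

theorem eq_iff_of_subset_lowDirs {A : Finset Dir} (hA : A ⊆ lowDirs) (B : Finset Dir)
    (hB : B ⊆ lowDirs) : A = B ↔ (S ∈ A ↔ S ∈ B) ∧ (SE ∈ A ↔ SE ∈ B) ∧ (NE ∈ A ↔ NE ∈ B) ∧
      (DSW ∈ A ↔ DSW ∈ B) ∧ (DE ∈ A ↔ DE ∈ B) ∧ (DNW ∈ A ↔ DNW ∈ B) := by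
  constructor
  · rintro rfl
    simp
  · rintro ⟨h1, h2, h3, h4, h5, h6⟩
    have key : ∀ d ∈ lowDirs, (d ∈ A ↔ d ∈ B) := by
      intro d hd
      simp only [lowDirs, Finset.mem_insert, Finset.mem_singleton] at hd
      rcases hd with rfl | rfl | rfl | rfl | rfl | rfl <;> assumption
    ext d
    by_cases hd : d ∈ lowDirs
    · exact key d hd
    · exact ⟨fun h => absurd (hA h) hd, fun h => absurd (hB h) hd⟩

/-- If `SE` is a bridge, then a tile at `S` is available, and a tile with the `x`-coordinate of the
bridge exists. -/
theorem IsBridge.of_SE {A : Finset Dir} (hA : A ⊆ lowDirs) (h : IsBridge A SE) :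
    S ∈ A ∧ SE ∉ A ∧ (NE ∈ A ∨ DE ∈ A) := by
  obtain ⟨h1, h2⟩ := h
  rw [locallyConnected_iff hA] at h1
  rw [locallyConnected_iff (Finset.insert_subset (by decide) hA)] at h2
  simp only [Finset.mem_insert, reduceCtorEq, false_or, true_or, not_true] at h2
  tauto

theorem subset_pair_iff {A : Finset Dir} (hA : A ⊆ lowDirs) :
    A ⊆ {DSW, SE} ↔ S ∉ A ∧ NE ∉ A ∧ DE ∉ A ∧ DNW ∉ A := by
  constructor
  · intro h
    refine ⟨?_, ?_, ?_, ?_⟩ <;> exact fun h' => by simpa using h h'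
  · rintro ⟨h1, h2, h3, h4⟩ d hd
    have := hA hd
    simp only [lowDirs, Finset.mem_insert, Finset.mem_singleton] at this
    rcases this with rfl | rfl | rfl | rfl | rfl | rfl <;> simp_all

/-- If the tile is shifted to the bridge `DE`, then tiles with the `x`-coordinate of the bridge and
with its `y`-coordinate exist. -/
theorem IsBridge.of_DE {A : Finset Dir} (hA : A ⊆ lowDirs) (h : IsBridge A DE)
    (h' : ¬ A ⊆ {DSW, SE}) : DE ∉ A ∧ (SE ∈ A ∨ NE ∈ A) ∧ (NE ∈ A ∨ DNW ∈ A) := by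
  obtain ⟨h1, h2⟩ := h
  rw [subset_pair_iff hA] at h'
  rw [locallyConnected_iff hA] at h1
  rw [locallyConnected_iff (Finset.insert_subset (by decide) hA)] at h2
  simp only [Finset.mem_insert, reduceCtorEq, false_or, true_or, not_true] at h2
  tauto

/-- The cases in which neither `SE` nor `DE` helps. -/
theorem eq_of_not_bridge {A : Finset Dir} (hA : A ⊆ lowDirs) (h : ¬ LocallyConnected A)
    (h1 : ¬ IsBridge A SE) (h2 : ¬ (IsBridge A DE ∧ ¬ A ⊆ {DSW, SE})) :
    A = {DSW, SE} ∨ A = {DNW, S, NE} ∨ A = {DNW, S} := by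
  rw [eq_iff_of_subset_lowDirs hA _ (by decide), eq_iff_of_subset_lowDirs hA _ (by decide),
    eq_iff_of_subset_lowDirs hA _ (by decide)]
  rw [subset_pair_iff hA, IsBridge, locallyConnected_iff hA,
    locallyConnected_iff (Finset.insert_subset (by decide) hA)] at h2
  rw [IsBridge, locallyConnected_iff hA,
    locallyConnected_iff (Finset.insert_subset (by decide) hA)] at h1
  rw [locallyConnected_iff hA] at h
  simp only [Finset.mem_insert, Finset.mem_singleton, reduceCtorEq, false_or, or_false, true_or,
    or_true, not_true, iff_false, iff_true, not_false_eq_true, true_and, and_true, false_and,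
    and_false, true_implies, false_implies, not_and] at h h1 h2 ⊢
  by_cases a1 : S ∈ A <;> by_cases a2 : SE ∈ A <;> by_cases a3 : NE ∈ A <;>
    by_cases a4 : DSW ∈ A <;> by_cases a5 : DE ∈ A <;> by_cases a6 : DNW ∈ A <;>
    simp_all

/-! ### Shifting a single tile -/

theorem Dir.vec_ne_zero (d : Dir) : d.vec ≠ 0 := by cases d <;> simp [Dir.vec]

/-- The agent may leave the search phase at the tile `(x, y, z)`. -/
structure Top (T : Finset Node) (x y z : ℤ) : Prop where
  conn : Conn (T : Set Node)
  mem : (x, y, z) ∈ T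
  uw : (x + 1, y - 1, z + 1) ∉ T
  use : (x, y - 1, z + 1) ∉ T
  une : (x, y, z + 1) ∉ T
  nw : (x + 1, y, z) ∉ T
  sw : (x + 1, y - 1, z) ∉ T
  n : (x, y + 1, z) ∉ T

section

variable {T T₀ : Finset Node} {x y z : ℤ} {q : State}

theorem Top.nbr_subset (h : Top T x y z) : (lookAt T (x, y, z)).nbr ⊆ lowDirs := by
  intro d hd
  have := h.uw
  have := h.use
  have := h.une
  have := h.nw
  have := h.sw
  have := h.n
  cases d <;> first | decide | simp_all

/-- A tile may be shifted from `v` to `w` if all other neighbours of `v` are joined to `w`. -/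
theorem conn_shift {v w : Node} (hT : Conn (T : Set Node)) (hv : v ∈ T)
    (h : ∀ d : Dir, v + d.vec ∈ T → Joined (insert w (T.erase v) : Finset Node) w (v + d.vec)) :
    Conn ((insert w (T.erase v) : Finset Node) : Set Node) := by
  refine hT.swap (v := v) (w := w) (fun u => ?_) h hv
  simp only [Finset.mem_coe, Finset.mem_insert, Finset.mem_erase]
  tauto

/-- Shifting a tile to a bridge preserves connectivity. -/
theorem conn_shift_bridge {v : Node} {d : Dir} (hT : Conn (T : Set Node)) (hv : v ∈ T)
    (h : LocallyConnected (insert d (lookAt T v).nbr)) :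
    Conn ((insert (v + d.vec) (T.erase v) : Finset Node) : Set Node) := by
  refine conn_shift hT hv fun e he => ?_
  refine h.joined (fun f hf => ?_) (Finset.mem_insert_self _ _)
    (Finset.mem_insert_of_mem (mem_nbr.2 he))
  rcases Finset.mem_insert.1 hf with rfl | hf
  · simp
  · simp [mem_nbr.1 hf, f.vec_ne_zero]

theorem conn_insert {v w : Node} (hT : Conn (T : Set Node)) (hv : v ∈ T) (h : fcc.Adj v w) :
    Conn ((insert w T : Finset Node) : Set Node) := by
  rw [Finset.coe_insert]
  exact hT.insert hv h

theorem ends_shift_SE (ht : Top T x y z)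
    (hq : transition q (lookAt T (x, y, z)) = (move SE, .sePlace))
    (h : IsBridge (lookAt T (x, y, z)).nbr SE) :
    Ends T (Outcome T (x, y, z)) ⟨T, (x, y, z), true, q⟩ := by
  obtain ⟨hS, hSE, hE⟩ := h.of_SE ht.nbr_subset
  simp only [S_mem, SE_mem, NE_mem, DE_mem] at hS hSE hE
  have hins := conn_insert (w := (x - 1, y, z)) ht.conn ht.mem (adj_of SE)
  have hins' := hins
  rw [Finset.coe_insert] at hins'
  have he : (insert (x - 1, y, z) T).erase (x, y, z) = insert (x - 1, y, z) (T.erase (x, y, z)) :=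
    Finset.erase_insert_of_ne (by simp)
  have hc : Conn ((insert (x - 1, y, z) (T.erase (x, y, z)) : Finset Node) : Set Node) := by
    have := conn_shift_bridge ht.conn ht.mem h.2
    simpa [Dir.vec, ← sub_eq_add_neg] using this
  refine .move hq (isConnected_of_tiles ht.conn) (hq := fun _ => rfl) (p' := (x - 1, y, z)) ?_
  refine .place (q' := .seReturn) rfl hSE hins' ?_
  refine .move (q' := .sePick) (d := NW) rfl (isConnected_of_tiles hins) (p' := (x, y, z)) ?_
  refine .pick (q' := .seLeave) rfl (by simp [ht.mem]) hins ?_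
  rw [he]
  refine .move (q' := .search) (d := S) rfl (isConnected_of_tiles hc) (p' := (x, y - 1, z)) ?_
  refine .of_drop (drop_shift ht.mem hSE (by omega) ?_ ⟨_, ht.mem, le_rfl⟩ ⟨_, ht.mem, le_rfl⟩)
    (by simp [hS]) hc
  rcases hE with hE | hE <;> exact ⟨_, hE, le_rfl⟩

/-- The agent goes `S` through a column, and stops at a node from which it continues the search. -/
theorem ends_deWalk {T' : Finset Node} {v : Node} (hd : Drop T T') (hc : Conn (T' : Set Node))
    (hp : (x, y, z) ∈ T') : Ends T₀ (Outcome T v) ⟨T', (x, y, z), true, .deWalk⟩ := by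
  obtain ⟨M, hM⟩ := exists_bound T'
  induction hn : (y + M).toNat using Nat.strong_induction_on generalizing y with
  | _ n ih =>
    by_cases h : (x, y - 1, z) ∈ T' ∧ (x + 1, y - 1, z + 1) ∉ T' ∧ (x, y - 1, z + 1) ∉ T' ∧
        (x + 1, y - 1, z) ∉ T'
    · have h1 := hM _ _ _ h.1
      refine .move (q' := .deWalk) (d := S) ?_ (isConnected_of_tiles hc) (p' := (x, y - 1, z))
        (ih _ (by omega) h.1 rfl)
      simp [transition, h]
    · refine .done ⟨⟨hp, rfl, hc, ?_⟩, .inr (.inl hd)⟩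
      change transition .deWalk (lookAt T' (x, y, z)) = Hybrid3D.searchStep (lookAt T' (x, y, z))
      simp only [transition, S_mem, UW_mem, USE_mem, SW_mem]
      rw [if_neg h]

theorem ends_shift_DE (ht : Top T x y z)
    (hq : transition q (lookAt T (x, y, z)) = (move DE, .dePlace))
    (h : IsBridge (lookAt T (x, y, z)).nbr DE)
    (h' : ¬ (lookAt T (x, y, z)).nbr ⊆ {DSW, SE}) :
    Ends T (Outcome T (x, y, z)) ⟨T, (x, y, z), true, q⟩ := by
  obtain ⟨hDE, hE, hN⟩ := h.of_DE ht.nbr_subset h'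
  simp only [SE_mem, NE_mem, DE_mem, DNW_mem] at hDE hE hN
  have hins := conn_insert (w := (x - 1, y + 1, z - 1)) ht.conn ht.mem (adj_of DE)
  have hins' := hins
  rw [Finset.coe_insert] at hins'
  have he : (insert (x - 1, y + 1, z - 1) T).erase (x, y, z) =
      insert (x - 1, y + 1, z - 1) (T.erase (x, y, z)) := Finset.erase_insert_of_ne (by simp)
  have hc : Conn ((insert (x - 1, y + 1, z - 1) (T.erase (x, y, z)) : Finset Node) :
      Set Node) := by
    have := conn_shift_bridge ht.conn ht.mem h.2
    simpa [Dir.vec, ← sub_eq_add_neg] using this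
  refine .move hq (isConnected_of_tiles ht.conn) (hq := fun _ => rfl)
    (p' := (x - 1, y + 1, z - 1)) ?_
  refine .place (q' := .deReturn) rfl hDE hins' ?_
  refine .move (q' := .dePick) (d := UW) rfl (isConnected_of_tiles hins) (p' := (x, y, z)) ?_
  refine .pick (q' := .deLeave) rfl (by simp [ht.mem]) hins ?_
  rw [he]
  have hd : Drop T (insert (x - 1, y + 1, z - 1) (T.erase (x, y, z))) := by
    refine drop_shift ht.mem hDE (by omega) ?_ ⟨_, ht.mem, by simp⟩ ?_
    · rcases hE with hE | hE <;> exact ⟨_, hE, le_rfl⟩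
    · rcases hN with hN | hN <;> exact ⟨_, hN, le_rfl⟩
  have hS : (x, y - 1, z) ∈ insert (x - 1, y + 1, z - 1) (T.erase (x, y, z)) ↔
      (x, y - 1, z) ∈ T := by
    simp only [Finset.mem_insert, Finset.mem_erase, Prod.mk.injEq, ne_eq]
    constructor
    · rintro (h | h)
      · omega
      · exact h.2
    · exact fun h => .inr ⟨by omega, h⟩
  have hSE : (x - 1, y, z) ∈ insert (x - 1, y + 1, z - 1) (T.erase (x, y, z)) ↔
      (x - 1, y, z) ∈ T := by simp
  have hNE : (x - 1, y + 1, z) ∈ insert (x - 1, y + 1, z - 1) (T.erase (x, y, z)) ↔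
      (x - 1, y + 1, z) ∈ T := by
    simp only [Finset.mem_insert, Finset.mem_erase, Prod.mk.injEq, ne_eq]
    constructor
    · rintro (h | h)
      · omega
      · exact h.2
    · exact fun h => .inr ⟨by omega, h⟩
  generalize insert (x - 1, y + 1, z - 1) (T.erase (x, y, z)) = T' at *
  by_cases h1 : (x, y - 1, z) ∈ T
  · refine .move (q' := .search) (d := S) ?_ (isConnected_of_tiles hc) (p' := (x, y - 1, z))
      (.of_drop hd (hS.2 h1) hc)
    simp [transition, leaveStep, hS, h1]
  by_cases h2 : (x - 1, y, z) ∈ T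
  · by_cases h3 : (x - 1, y + 1, z) ∈ T
    · refine .move (q' := .deWalk) (d := SE) ?_ (isConnected_of_tiles hc) (p' := (x - 1, y, z))
        (ends_deWalk hd hc (hSE.2 h2))
      simp [transition, hS, h1, hSE, h2, hNE, h3]
    · refine .move (q' := .search) (d := SE) ?_ (isConnected_of_tiles hc) (p' := (x - 1, y, z))
        (.of_drop hd (hSE.2 h2) hc)
      simp [transition, leaveStep, hS, h1, hSE, h2, hNE, h3]
  · have h3 : (x - 1, y + 1, z) ∈ T := hE.resolve_left h2
    refine .move (q' := .search) (d := NE) ?_ (isConnected_of_tiles hc)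
      (p' := (x - 1, y + 1, z)) (.of_drop hd (hNE.2 h3) hc)
    simp [transition, leaveStep, hS, h1, hSE, h2]

/-- A node with tiles at `DSW` and `SE` only: the tile is shifted to the common neighbour
`SE + DSW`, unless that is tiled. -/
theorem ends_shift_low (ht : Top T x y z)
    (hq : transition q (lookAt T (x, y, z)) = (move SE, .lowObserve))
    (h : (lookAt T (x, y, z)).nbr = {DSW, SE})
    (hpar : (x - 1, y, z - 1) ∈ T →
      Ends T (Outcome T (x, y, z)) ⟨T, (x, y, z), true, .par true⟩) :
    Ends T (Outcome T (x, y, z)) ⟨T, (x, y, z), true, q⟩ := by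
  have hSE : (x - 1, y, z) ∈ T := by rw [← SE_mem, h]; decide
  have hDSW : (x, y, z - 1) ∈ T := by rw [← DSW_mem, h]; decide
  refine .move hq (isConnected_of_tiles ht.conn) (hq := fun _ => rfl) (p' := (x - 1, y, z)) ?_
  by_cases hw : (x - 1, y, z - 1) ∈ T
  · refine .move (q' := .par true) (d := NW) ?_ (isConnected_of_tiles ht.conn) (p' := (x, y, z))
      (hpar hw)
    simp [transition, hw]
  have hins := conn_insert (w := (x - 1, y, z - 1)) ht.conn hSE (adj_of DSW)
  have hins' := hins
  rw [Finset.coe_insert] at hins'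
  have he : (insert (x - 1, y, z - 1) T).erase (x, y, z) =
      insert (x - 1, y, z - 1) (T.erase (x, y, z)) := Finset.erase_insert_of_ne (by simp)
  have hc : Conn ((insert (x - 1, y, z - 1) (T.erase (x, y, z)) : Finset Node) :
      Set Node) := by
    refine conn_shift ht.conn ht.mem fun d hd => ?_
    have hd' := mem_nbr.2 hd
    rw [h] at hd'
    simp only [Finset.mem_insert, Finset.mem_singleton] at hd'
    rcases hd' with rfl | rfl
    · refine .of_adj (by simp) (by simp [Dir.vec] at hd ⊢; simp [hd]) ?_
      exact adj_of NW
    · refine .of_adj (by simp) (by simp [Dir.vec] at hd ⊢; simp [hd]) ?_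
      exact adj_of UNE
  refine .move (q' := .lowPlace) (d := DSW) (by simp [transition, hw])
    (isConnected_of_tiles ht.conn) (p' := (x - 1, y, z - 1)) ?_
  refine .place (q' := .lowReturn) rfl hw hins' ?_
  refine .move (q' := .lowReturn') (d := UNE) rfl (isConnected_of_tiles hins)
    (p' := (x - 1, y, z)) ?_
  refine .move (q' := .lowPick) (d := NW) rfl (isConnected_of_tiles hins) (p' := (x, y, z)) ?_
  refine .pick (q' := .lowLeave) rfl (by simp [ht.mem]) hins ?_
  rw [he]
  refine .move (q' := .search) (d := SE) rfl (isConnected_of_tiles hc) (p' := (x - 1, y, z)) ?_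
  exact .of_drop (drop_shift ht.mem hw (by omega) ⟨_, hSE, le_rfl⟩ ⟨_, ht.mem, le_rfl⟩
    ⟨_, ht.mem, le_rfl⟩) (by simp [hSE]) hc

end

/-! ### Shifting the tiles of a column to `DE` -/

section

variable {T T₀ : Finset Node} {x y z t : ℤ} {q : State} {Q : Config → Prop} {last : Bool}

/-- The tiles at `y, …, t` of a column are shifted to `DE` from south to north. While the column is
severed, the agent itself connects its two parts, so the connectivity of the tiles together with
the agent is maintained. -/
theorem ends_colPlace (hyt : y ≤ t)
    (hcol : ∀ y', y ≤ y' → y' ≤ t → (x, y', z) ∈ T)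
    (hemp : ∀ y', y ≤ y' → y' ≤ t → (x - 1, y' + 1, z - 1) ∉ T)
    (htop : (x, t + 1, z) ∉ T) (hdnw : (x, t + 1, z - 1) ∈ T) (hx : ∃ a ∈ T, a.1 ≤ x - 1)
    (hc : Conn ((insert (x - 1, y + 1, z - 1) T : Finset Node) : Set Node))
    (hcur : ∀ d : Dir, d ≠ N → (x, y, z) + d.vec ∈ T →
      Joined (insert (x - 1, y + 1, z - 1) (T.erase (x, y, z)) : Finset Node)
        (x - 1, y + 1, z - 1) ((x, y, z) + d.vec))
    (hnb : ∀ y', y < y' → y' ≤ t → ∀ d : Dir, (x, y', z) + d.vec ∈ T →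
      d = N ∨ d = S ∨ d = DSW ∨ d = DNW ∨ d = NE)
    (hend : ∀ T' : Finset Node, Drop T T' → Conn (T' : Set Node) →
      (∀ u ∈ T, (∀ y', y ≤ y' → y' ≤ t → u ≠ (x, y', z)) → u ∈ T') → (x, t + 1, z) ∉ T' →
      Ends T₀ Q ⟨T', (x, t, z), true, .colNext last⟩) :
    Ends T₀ Q ⟨T, (x - 1, y + 1, z - 1), true, .colPlace last⟩ := by
  induction hn : (t - y).toNat generalizing T y with
  | zero =>
    obtain rfl : y = t := by omega
    have hv := hcol y le_rfl le_rfl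
    have hw := hemp y le_rfl le_rfl
    have he : (insert (x - 1, y + 1, z - 1) T).erase (x, y, z) =
        insert (x - 1, y + 1, z - 1) (T.erase (x, y, z)) := Finset.erase_insert_of_ne (by simp)
    refine .place (q' := .colReturn last) rfl hw (by rwa [← Finset.coe_insert]) ?_
    refine .move (q' := .colPick last) (d := UW) rfl (isConnected_of_tiles hc)
      (p' := (x, y, z)) ?_
    refine .pick (q' := .colNext last) rfl (by simp [hv]) hc ?_
    rw [he]
    refine hend _ (drop_shift hv hw (by omega) hx ⟨_, hv, by simp⟩ ⟨_, hdnw, le_rfl⟩) ?_ ?_ ?_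
    · refine hc.swap (v := (x, y, z)) (w := (x - 1, y + 1, z - 1)) (fun u => ?_) (fun d hd => ?_)
        (by simp [hv])
      · simp only [Finset.coe_insert, Set.mem_insert_iff, Finset.mem_coe, Finset.mem_erase]
        by_cases h : u = (x - 1, y + 1, z - 1)
        · simp [h]
        · tauto
      · simp only [Finset.coe_insert, Set.mem_insert_iff, Finset.mem_coe] at hd
        rcases hd with hd | hd
        · rw [hd]
          exact .refl _ _
        · refine hcur d ?_ hd
          rintro rfl
          exact htop (by simpa [Dir.vec] using hd)
    · intro u hu hu'
      simp [hu, hu' y le_rfl le_rfl]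
    · simp only [Finset.mem_insert, Finset.mem_erase, Prod.mk.injEq, not_or]
      exact ⟨by omega, fun h => htop h.2⟩
  | succ n ih =>
    have hv := hcol y le_rfl hyt
    have hw := hemp y le_rfl hyt
    have hv' := hcol (y + 1) (by omega) (by omega)
    have he : (insert (x - 1, y + 1, z - 1) T).erase (x, y, z) =
        insert (x - 1, y + 1, z - 1) (T.erase (x, y, z)) := Finset.erase_insert_of_ne (by simp)
    refine .place (q' := .colReturn last) rfl hw (by rwa [← Finset.coe_insert]) ?_
    refine .move (q' := .colPick last) (d := UW) rfl (isConnected_of_tiles hc)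
      (p' := (x, y, z)) ?_
    refine .pick (q' := .colNext last) rfl (by simp [hv]) hc ?_
    rw [he]
    have hmem : ∀ u, u ∈ insert (x - 1, y + 1, z - 1) (T.erase (x, y, z)) ↔
        u = (x - 1, y + 1, z - 1) ∨ u ∈ T ∧ u ≠ (x, y, z) := by
      intro u
      rw [Finset.mem_insert, Finset.mem_erase]
      tauto
    have hdrop := drop_shift hv hw (by omega) hx ⟨_, hv, by simp⟩ ⟨_, hv', le_rfl⟩
    -- the carrying agent may stand at `a` if `a` is adjacent to the rest of the column and to the
    -- placed tile
    have hagent : ∀ a : Node, fcc.Adj a (x, y + 1, z) → fcc.Adj a (x - 1, y + 1, z - 1) →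
        Conn (insert a
          ((insert (x - 1, y + 1, z - 1) (T.erase (x, y, z)) : Finset Node) : Set Node)) := by
      intro a ha1 ha2
      have haw : Joined (insert a
          ((insert (x - 1, y + 1, z - 1) (T.erase (x, y, z)) : Finset Node) : Set Node)) a
          (x - 1, y + 1, z - 1) := .of_adj (by simp) (by simp) ha2
      refine hc.swap (v := (x, y, z)) (w := a) (fun u => ?_) (fun d hd => ?_) (by simp [hv])
      · simp only [Finset.coe_insert, Set.mem_insert_iff, Finset.mem_coe, Finset.mem_erase]
        by_cases h : u = (x - 1, y + 1, z - 1)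
        · simp [h]
        · tauto
      · simp only [Finset.coe_insert, Set.mem_insert_iff, Finset.mem_coe] at hd
        rcases hd with hd | hd
        · rw [hd]
          exact haw
        · by_cases hdN : d = N
          · subst hdN
            have : (x, y, z) + N.vec = (x, y + 1, z) := by simp [Dir.vec]
            rw [this]
            exact .of_adj (by simp) (by simp [hv']) ha1
          · exact haw.trans ((hcur d hdN hd).mono (by simp))
    have hconn := hagent (x, y, z) (adj_of N) (adj_of DE)
    generalize hT' : insert (x - 1, y + 1, z - 1) (T.erase (x, y, z)) = T' at *
    refine .move (q' := .colDescend last) (d := NE) ?_ (isConnected_of_insert hconn)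
      (p' := (x - 1, y + 1, z)) ?_
    · simp [transition, (hmem _).2 (.inr ⟨hv', by simp⟩)]
    refine .move (q' := .colPlace last) (d := DNW) rfl
      (isConnected_of_insert (hagent (x - 1, y + 1, z) (adj_of NW) (adj_of DSW)))
      (p' := (x - 1, y + 1 + 1, z - 1)) ?_
    refine ih (y := y + 1) (by omega) ?_ ?_ ?_ ?_ ?_ ?_ ?_ ?_ ?_ (by omega)
    · intro y' h1 h2
      refine (hmem _).2 (.inr ⟨hcol y' (by omega) h2, ?_⟩)
      simp only [Prod.mk.injEq, ne_eq]
      omega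
    · intro y' h1 h2 h3
      rcases (hmem _).1 h3 with h | h
      · simp only [Prod.mk.injEq] at h
        omega
      · exact hemp y' (by omega) h2 h.1
    · intro h3
      rcases (hmem _).1 h3 with h | h
      · simp only [Prod.mk.injEq] at h
        omega
      · exact htop h.1
    · exact (hmem _).2 (.inr ⟨hdnw, by simp⟩)
    · exact ⟨_, (hmem _).2 (.inl rfl), le_rfl⟩
    · rw [Finset.coe_insert]
      exact hagent _ (adj_of UW) (adj_of S)
    · intro d hdN hd
      have hin : (x, y + 1, z) + d.vec ∈
          ((insert (x - 1, y + 1 + 1, z - 1) (T'.erase (x, y + 1, z)) : Finset Node) :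
            Set Node) := by
        simp [hd, d.vec_ne_zero]
      refine .of_adj (by simp) hin ?_
      rcases (hmem _).1 hd with h | h
      · rw [h]
        exact adj_of S
      · rcases hnb (y + 1) (by omega) (by omega) d h.1 with rfl | rfl | rfl | rfl | rfl
        · exact absurd rfl hdN
        · exact absurd (by simp [Dir.vec]) h.2
        · exact adj_of SW
        · exact adj_of NW
        · exact adj_of UNE
    · intro y' h1 h2 d hd
      rcases (hmem _).1 hd with h | h
      · simp only [Prod.ext_iff, Prod.fst_add, Prod.snd_add] at h
        cases d <;> simp only [Dir.vec] at h <;> omega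
      · exact hnb y' (by omega) h2 d h.1
    · intro T'' hd hc' hsub
      refine hend T'' (hdrop.trans hd) hc' fun u hu hu' => ?_
      refine hsub u ((hmem _).2 (.inr ⟨hu, hu' y le_rfl hyt⟩)) fun y' h1 h2 => ?_
      exact hu' y' (by omega) h2

/-- After the tiles of a column have been shifted, the agent goes `S` until it meets a tile. -/
theorem ends_colLeave {T' : Finset Node} {v : Node} (hd : Drop T T') (hc : Conn (T' : Set Node))
    (hq : transition q (lookAt T' (x, y, z)) = colLeaveStep (lookAt T' (x, y, z)))
    (hns : q ≠ .search) {yb : ℤ} (hyb : yb ≤ y)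
    (hb : (x, yb - 1, z) ∈ T' ∨ (x - 1, yb, z) ∈ T') :
    Ends T₀ (Outcome T v) ⟨T', (x, y, z), true, q⟩ := by
  induction hn : (y - yb).toNat generalizing y q with
  | zero =>
    obtain rfl : y = yb := by omega
    by_cases h1 : (x, y - 1, z) ∈ T'
    · exact .move (q' := .search) (d := S) (by rw [hq]; simp [colLeaveStep, h1])
        (isConnected_of_tiles hc) (p' := (x, y - 1, z)) (.of_drop hd h1 hc)
        (hq := fun h => absurd h hns)
    · have h2 := hb.resolve_left h1
      exact .move (q' := .search) (d := SE) (by rw [hq]; simp [colLeaveStep, h1, h2])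
        (isConnected_of_tiles hc) (p' := (x - 1, y, z)) (.of_drop hd h2 hc)
        (hq := fun h => absurd h hns)
  | succ n ih =>
    by_cases h1 : (x, y - 1, z) ∈ T'
    · exact .move (q' := .search) (d := S) (by rw [hq]; simp [colLeaveStep, h1])
        (isConnected_of_tiles hc) (p' := (x, y - 1, z)) (.of_drop hd h1 hc)
        (hq := fun h => absurd h hns)
    by_cases h2 : (x - 1, y, z) ∈ T'
    · exact .move (q' := .search) (d := SE) (by rw [hq]; simp [colLeaveStep, h1, h2])
        (isConnected_of_tiles hc) (p' := (x - 1, y, z)) (.of_drop hd h2 hc)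
        (hq := fun h => absurd h hns)
    · exact .move (q' := .colLeave) (d := S) (by rw [hq]; simp [colLeaveStep, h1, h2])
        (isConnected_of_tiles hc) (p' := (x, y - 1, z))
        (ih (q := .colLeave) rfl (by nofun) (by omega) (by omega)) (hq := fun h => absurd h hns)

/-- The tiles around the column from `(x, t, z)` down to `(x, y, z)`, as far as they are known when
the agent enters `(x, y, z)` on its way `S`: the northernmost node has tiles at `DNW` and `S` only,
or at `DNW`, `S` and `NE` only, and the walk has not been stopped in between. -/
structure Walk (T : Finset Node) (x y z t : ℤ) (last : Bool) : Prop where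
  top : Top T x t z
  lt : y < t
  col : ∀ y', y ≤ y' → y' ≤ t → (x, y', z) ∈ T
  dnw : (x, t + 1, z - 1) ∈ T
  ne : (x - 1, t + 1, z) ∈ T ↔ last = false
  uw : ∀ y', y < y' → y' ≤ t → (x + 1, y' - 1, z + 1) ∉ T
  use : ∀ y', y < y' → y' ≤ t → (x, y' - 1, z + 1) ∉ T
  sw : ∀ y', y < y' → y' ≤ t → (x + 1, y' - 1, z) ∉ T
  se : ∀ y', y < y' → y' ≤ t → (x - 1, y', z) ∉ T
  de : ∀ y', y < y' → y' ≤ t → (x - 1, y' + 1, z - 1) ∉ T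

theorem Walk.une (h : Walk T x y z t last) {y' : ℤ} (h1 : y ≤ y') (h2 : y' ≤ t) :
    (x, y', z + 1) ∉ T := by
  rcases h2.eq_or_lt with rfl | h2
  · exact h.top.une
  · have := h.use (y' + 1) (by omega) (by omega)
    rwa [add_sub_cancel_right] at this

theorem Walk.nw (h : Walk T x y z t last) {y' : ℤ} (h1 : y ≤ y') (h2 : y' ≤ t) :
    (x + 1, y', z) ∉ T := by
  rcases h2.eq_or_lt with rfl | h2
  · exact h.top.nw
  · have := h.sw (y' + 1) (by omega) (by omega)
    rwa [add_sub_cancel_right] at this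

theorem Walk.nbr (h : Walk T x y z t last) {y' : ℤ} (h1 : y < y') (h2 : y' ≤ t) {d : Dir}
    (hd : (x, y', z) + d.vec ∈ T) :
    d = N ∨ d = S ∨ d = DSW ∨ d = DNW ∨ d = NE := by
  have a1 := h.uw y' h1 h2
  have a2 := h.use y' h1 h2
  have a3 := h.sw y' h1 h2
  have a4 := h.se y' h1 h2
  have a5 := h.de y' h1 h2
  have a6 := h.une h1.le h2
  have a7 := h.nw h1.le h2
  rw [← mem_nbr] at hd
  cases d <;> simp_all

theorem Walk.joined (h : Walk T x y z t last) {y' : ℤ} (h1 : y ≤ y') (h2 : y' ≤ t) :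
    Joined (layer T z) (x, t, z) (x, y', z) := by
  induction hn : (t - y').toNat generalizing y' with
  | zero =>
    obtain rfl : y' = t := by omega
    exact .refl _ _
  | succ n ih =>
    exact (ih (y' := y' + 1) (by omega) (by omega) (by omega)).trans
      (.of_adj ⟨h.col _ (by omega) (by omega), rfl⟩ ⟨h.col _ h1 h2, rfl⟩ (adj_of S))

/-- What happens after the shift of the tiles at `ys, …, t`. -/
theorem Walk.ends_colNext (h : Walk T x y z t last) {ys : ℤ} (h2 : ys ≤ t)
    (hb : last = true → (x, ys - 1, z) ∈ T ∨ (x - 1, ys, z) ∈ T)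
    {T' : Finset Node} (hd : Drop T T') (hc : Conn (T' : Set Node))
    (hsub : ∀ u ∈ T, (∀ y', ys ≤ y' → y' ≤ t → u ≠ (x, y', z)) → u ∈ T')
    (htop : (x, t + 1, z) ∉ T') :
    Ends T₀ (Outcome T (x, t, z)) ⟨T', (x, t, z), true, .colNext last⟩ := by
  cases last with
  | false =>
    have hne := h.ne.2 rfl
    refine .move (q' := .search) (d := NE) (by simp [transition, htop]) (isConnected_of_tiles hc)
      (p' := (x - 1, t + 1, z)) (.of_drop hd (hsub _ hne ?_) hc)
    intro y' _ _
    simp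
  | true =>
    refine ends_colLeave hd hc (by simp [transition, htop]) (by nofun) h2 ?_
    rcases hb rfl with hb | hb
    · refine .inl (hsub _ hb fun y' h1 _ => ?_)
      simp only [Prod.mk.injEq, ne_eq]
      omega
    · exact .inr (hsub _ hb fun y' _ _ => by simp)

/-- The shift starts at `(x, y, z)`, whose neighbour at `DE` is empty. A tile at `S` is connected to
`DE` via `SE` or `DSW`. -/
theorem Walk.ends_shift_here (h : Walk T x y z t last) (hT : Conn (T : Set Node))
    (huw : (x + 1, y - 1, z + 1) ∉ T) (huse : (x, y - 1, z + 1) ∉ T) (hsw : (x + 1, y - 1, z) ∉ T)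
    (hde : (x - 1, y + 1, z - 1) ∉ T) (hse : (x - 1, y, z) ∈ T ∨ last = false)
    (hs : (x, y - 1, z) ∈ T → (x - 1, y, z) ∈ T ∨ (x, y, z - 1) ∈ T)
    (hq : transition q (lookAt T (x, y, z)) = (move DE, .colPlace last)) (hns : q ≠ .search) :
    Ends T₀ (Outcome T (x, t, z)) ⟨T, (x, y, z), true, q⟩ := by
  have hv := h.col y le_rfl h.lt.le
  refine .move hq (isConnected_of_tiles hT) (p' := (x - 1, y + 1, z - 1)) ?_
    (hq := fun h => absurd h hns)
  refine ends_colPlace (y := y) (t := t) h.lt.le h.col ?_ h.top.n h.dnw ?_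
    (conn_insert hT hv (adj_of DE)) ?_ (fun y' h1 h2 d hd => h.nbr h1 h2 hd) ?_
  · intro y' h1 h2
    rcases h1.eq_or_lt with rfl | h1
    · exact hde
    · exact h.de y' h1 h2
  · rcases hse with hse | hse
    · exact ⟨_, hse, le_rfl⟩
    · exact ⟨_, h.ne.2 hse, le_rfl⟩
  · intro d hdN hd
    have a1 := h.une le_rfl h.lt.le
    have a2 := h.nw le_rfl h.lt.le
    have a3 : (x - 1, y + 1, z) ∉ T := h.se (y + 1) (by omega) (by have := h.lt; omega)
    have hin : ∀ u ∈ T, u ≠ (x, y, z) → u ∈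
        ((insert (x - 1, y + 1, z - 1) (T.erase (x, y, z)) : Finset Node) : Set Node) := by
      intro u hu hu'
      simp [hu, hu']
    have hd' := mem_nbr.2 hd
    have hdin := hin _ hd (by simp [d.vec_ne_zero])
    have hjSE : ∀ _ : (x - 1, y, z) ∈ T, Joined
        ((insert (x - 1, y + 1, z - 1) (T.erase (x, y, z)) : Finset Node) : Set Node)
        (x - 1, y + 1, z - 1) (x - 1, y, z) := fun hse =>
      .of_adj (by simp) (hin _ hse (by simp)) (adj_of USE)
    have hjDSW : ∀ _ : (x, y, z - 1) ∈ T, Joined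
        ((insert (x - 1, y + 1, z - 1) (T.erase (x, y, z)) : Finset Node) : Set Node)
        (x - 1, y + 1, z - 1) (x, y, z - 1) := fun hse =>
      .of_adj (by simp) (hin _ hse (by simp)) (adj_of SW)
    cases d with
    | UNE | UW | USE | NW | SW | NE | DE => simp_all
    | N => exact absurd rfl hdN
    | S =>
      have hd2 := hd'
      rw [S_mem] at hd2
      rcases hs hd2 with h5 | h5
      · exact (hjSE h5).trans (.of_adj (hin _ h5 (by simp)) hdin (adj_of SW))
      · exact (hjDSW h5).trans (.of_adj (hin _ h5 (by simp)) hdin (adj_of USE))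
    | SE => exact .of_adj (by simp) hdin (adj_of USE)
    | DSW => exact .of_adj (by simp) hdin (adj_of SW)
    | DNW => exact .of_adj (by simp) hdin (adj_of NW)
  · intro T' hd hc hsub htop
    refine h.ends_colNext h.lt.le (fun hl => .inr (hse.resolve_right ?_)) hd hc hsub htop
    simp [hl]

/-- The shift starts one node north of `(x, y, z)`, whose neighbour at `DE` is tiled. -/
theorem Walk.ends_shift_above (h : Walk T x y z t last) (hT : Conn (T : Set Node))
    (hde : (x - 1, y + 1, z - 1) ∈ T)
    (hq : transition q (lookAt T (x, y, z)) = (move N, .colStart last)) (hns : q ≠ .search) :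
    Ends T₀ (Outcome T (x, t, z)) ⟨T, (x, y, z), true, q⟩ := by
  have hlt := h.lt
  have hv := h.col y le_rfl h.lt.le
  have hv' := h.col (y + 1) (by omega) (by omega)
  refine .move hq (isConnected_of_tiles hT) (p' := (x, y + 1, z)) ?_
    (hq := fun h => absurd h hns)
  refine .move (d := DE) (q' := .colPlace last) rfl (isConnected_of_tiles hT)
    (p' := (x - 1, y + 1 + 1, z - 1)) ?_
  refine ends_colPlace (y := y + 1) (t := t) (by omega) (fun y' h1 h2 => h.col y' (by omega) h2)
    (fun y' h1 h2 => h.de y' (by omega) h2) h.top.n h.dnw ⟨_, hde, le_rfl⟩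
    (conn_insert hT hv' (adj_of DE)) ?_ (fun y' h1 h2 d hd => h.nbr (by omega) h2 hd) ?_
  · intro d hdN hd
    have hin : ∀ u ∈ T, u ≠ (x, y + 1, z) → u ∈
        ((insert (x - 1, y + 1 + 1, z - 1) (T.erase (x, y + 1, z)) : Finset Node) :
          Set Node) := by
      intro u hu hu'
      simp [hu, hu']
    have hdin := hin _ hd (by simp [d.vec_ne_zero])
    rcases h.nbr (y' := y + 1) (by omega) (by omega) hd with rfl | rfl | rfl | rfl | rfl
    · exact absurd rfl hdN
    · have hm := hin _ hde (by simp)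
      refine Joined.trans (.of_adj (by simp) hm (adj_of S)) (.of_adj hm hdin ?_)
      exact adj_of UW
    · exact .of_adj (by simp) hdin (adj_of SW)
    · exact .of_adj (by simp) hdin (adj_of NW)
    · exact .of_adj (by simp) hdin (adj_of UNE)
  · intro T' hd hc hsub htop
    refine h.ends_colNext (by omega) (fun _ => .inl ?_) hd hc hsub htop
    rwa [add_sub_cancel_right]

/-- The walk through the column. In the last case, if the column ends without any other tile having
been met, it is projected. -/
theorem Walk.ends_colWalk (h : Walk T x y z t last)
    (hproj : ∀ y q, Walk T x y z t true → q ≠ .search → (x, y - 1, z) ∉ T →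
      (x + 1, y - 1, z + 1) ∉ T → (x, y - 1, z + 1) ∉ T → (x + 1, y - 1, z) ∉ T →
      (x - 1, y, z) ∉ T → transition q (lookAt T (x, y, z)) = projTopStep (lookAt T (x, y, z)) →
      Ends T₀ (Outcome T (x, t, z)) ⟨T, (x, y, z), true, q⟩) :
    Ends T₀ (Outcome T (x, t, z)) ⟨T, (x, y, z), true, .colWalk last⟩ := by
  have hT := h.top.conn
  obtain ⟨M, hM⟩ := exists_bound T
  induction hn : (y + M).toNat using Nat.strong_induction_on generalizing y with
  | _ n ih =>
    have hlt := h.lt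
    by_cases h1 : (x + 1, y - 1, z + 1) ∈ T ∨ (x, y - 1, z + 1) ∈ T ∨ (x + 1, y - 1, z) ∈ T
    · refine Ends.searchStep (by nofun) hT ?_ ?_ ?_
      · simp only [transition, colWalkStep, UW_mem, USE_mem, SW_mem]
        rw [if_pos h1]
      · simp only [SearchDone, UW_mem, USE_mem, SW_mem]
        tauto
      · intro p _ hp hadj
        refine ⟨?_, _, h.joined le_rfl h.lt.le, hadj⟩
        rcases hp with rfl | rfl | rfl | rfl | rfl | hp
        · exact .inl (by simp)
        · exact .inl (by simp)
        · exact .inl (by simp)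
        · exact .inr ⟨by simp, .inl (by simp)⟩
        · exact .inr ⟨by simp, .inl (by simp)⟩
        · tauto
    have h1' : (x + 1, y - 1, z + 1) ∉ T ∧ (x, y - 1, z + 1) ∉ T ∧ (x + 1, y - 1, z) ∉ T := by
      tauto
    by_cases h2 : (x - 1, y, z) ∈ T ∨ (x - 1, y + 1, z - 1) ∈ T ∨
        last = false ∧ (x, y, z - 1) ∈ T
    · have ht : transition (.colWalk last) (lookAt T (x, y, z)) =
          if (x - 1, y + 1, z - 1) ∈ T then (move N, .colStart last)
          else (move DE, .colPlace last) := by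
        simp only [transition, colWalkStep, UW_mem, USE_mem, SW_mem, SE_mem, DE_mem, DSW_mem]
        rw [if_neg h1, if_pos h2]
      by_cases h3 : (x - 1, y + 1, z - 1) ∈ T
      · exact h.ends_shift_above hT h3 (by rw [ht, if_pos h3]) (by nofun)
      · refine h.ends_shift_here hT h1'.1 h1'.2.1 h1'.2.2 h3 ?_ ?_ (by rw [ht, if_neg h3])
          (by nofun)
        · tauto
        · tauto
    have h2' : (x - 1, y, z) ∉ T ∧ (x - 1, y + 1, z - 1) ∉ T := by tauto
    have ht : transition (.colWalk last) (lookAt T (x, y, z)) =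
        if (x, y - 1, z) ∈ T then (move S, .colWalk last)
        else if last = true then projTopStep (lookAt T (x, y, z))
        else (move DE, .colPlace last) := by
      simp only [transition, colWalkStep, UW_mem, USE_mem, SW_mem, SE_mem, DE_mem, DSW_mem, S_mem]
      rw [if_neg h1, if_neg h2]
    by_cases h3 : (x, y - 1, z) ∈ T
    · have hb := hM _ _ _ h3
      refine .move (d := S) (q' := .colWalk last) (by rw [ht, if_pos h3]) (isConnected_of_tiles hT)
        (p' := (x, y - 1, z)) (ih _ (by omega) ?_ rfl)
      refine ⟨h.top, by omega, ?_, h.dnw, h.ne, ?_, ?_, ?_, ?_, ?_⟩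
      · intro y' a1 a2
        rcases a1.eq_or_lt with rfl | a1
        · exact h3
        · exact h.col y' (by omega) a2
      all_goals
        intro y' a1 a2
        obtain rfl | a1 : y' = y ∨ y < y' := by omega
      · exact h1'.1
      · exact h.uw y' a1 a2
      · exact h1'.2.1
      · exact h.use y' a1 a2
      · exact h1'.2.2
      · exact h.sw y' a1 a2
      · exact h2'.1
      · exact h.se y' a1 a2
      · exact h2'.2
      · exact h.de y' a1 a2
    · cases last with
      | false =>
        exact h.ends_shift_here hT h1'.1 h1'.2.1 h1'.2.2 h2'.2 (.inr rfl)
          (fun h => absurd h h3) (by rw [ht, if_neg h3]; simp) (by nofun)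
      | true =>
        exact hproj y _ h (by nofun) h3 h1'.1 h1'.2.1 h1'.2.2 h2'.1
          (by rw [ht, if_neg h3]; simp)

/-- The cases with tiles at `DNW` and `S`, and possibly `NE`. -/
theorem Top.ends_column (h : Top T x y z)
    (hn : (lookAt T (x, y, z)).nbr = if last then {DNW, S} else {DNW, S, NE})
    (hq : transition q (lookAt T (x, y, z)) = (move S, .colWalk last))
    (hproj : ∀ y' q, Walk T x y' z y true → q ≠ .search → (x, y' - 1, z) ∉ T →
      (x + 1, y' - 1, z + 1) ∉ T → (x, y' - 1, z + 1) ∉ T → (x + 1, y' - 1, z) ∉ T →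
      (x - 1, y', z) ∉ T → transition q (lookAt T (x, y', z)) = projTopStep (lookAt T (x, y', z)) →
      Ends T (Outcome T (x, y, z)) ⟨T, (x, y', z), true, q⟩) :
    Ends T (Outcome T (x, y, z)) ⟨T, (x, y, z), true, q⟩ := by
  have hS : (x, y - 1, z) ∈ T := by rw [← S_mem, hn]; cases last <;> decide
  refine .move hq (isConnected_of_tiles h.conn) (hq := fun _ => rfl) (p' := (x, y - 1, z)) ?_
  refine Walk.ends_colWalk ⟨h, by omega, ?_, ?_, ?_, ?_, ?_, ?_, ?_, ?_⟩ hproj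
  · intro y' h1 h2
    obtain rfl | rfl : y' = y ∨ y' = y - 1 := by omega
    · exact h.mem
    · exact hS
  · rw [← DNW_mem, hn]; cases last <;> decide
  · rw [← NE_mem, hn]; cases last <;> decide
  all_goals
    intro y' h1 h2
    obtain rfl : y' = y := by omega
  · exact h.uw
  · exact h.use
  · exact h.sw
  · rw [← SE_mem, hn]; cases last <;> decide
  · rw [← DE_mem, hn]; cases last <;> decide

end

/-! ### Projecting a fragment -/

/-- Membership of `(x, y)` in the parallelogram with full columns at `xe ≤ x < X` and a possibly
shorter column at `x = X`. -/
def InPar (xe X b t₀ t x y : ℤ) : Prop := b ≤ y ∧ (x = X ∧ y ≤ t₀ ∨ xe ≤ x ∧ x < X ∧ y ≤ t)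

instance (xe X b t₀ t x y : ℤ) : Decidable (InPar xe X b t₀ t x y) :=
  inferInstanceAs (Decidable (_ ∧ _))

theorem joined_column {B : Set Node} {x y₁ y₂ Z : ℤ} (h : y₁ ≤ y₂)
    (hB : ∀ y, y₁ ≤ y → y ≤ y₂ → (x, y, Z) ∈ B) : Joined B (x, y₁, Z) (x, y₂, Z) := by
  induction hn : (y₂ - y₁).toNat generalizing y₂ with
  | zero =>
    obtain rfl : y₁ = y₂ := by omega
    exact .refl _ _
  | succ n ih =>
    exact (ih (y₂ := y₂ - 1) (by omega) (fun y h1 h2 => hB y h1 (by omega)) (by omega)).trans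
      (.of_adj (hB _ (by omega) (by omega)) (hB _ h le_rfl) (adj_of N))

theorem InPar.joined {B : Set Node} {xe X b t₀ t Z x y : ℤ} (hP : InPar xe X b t₀ t x y)
    (hB : ∀ x y, InPar xe X b t₀ t x y → (x, y, Z) ∈ B) (hxe : xe ≤ X) (hb : b ≤ t₀)
    (ht : t₀ ≤ t) : Joined B (X, b, Z) (x, y, Z) := by
  have hrow : ∀ x', xe ≤ x' → x' ≤ X → (x', b, Z) ∈ B := by
    intro x' h1 h2
    refine hB _ _ ?_
    unfold InPar
    omega
  have h1 : ∀ x', xe ≤ x' → x' ≤ X → Joined B (X, b, Z) (x', b, Z) := by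
    intro x' h1 h2
    induction hn : (X - x').toNat generalizing x' with
    | zero =>
      obtain rfl : x' = X := by omega
      exact .refl _ _
    | succ n ih =>
      exact (ih (x' + 1) (by omega) (by omega) (by omega)).trans
        (.of_adj (hrow _ (by omega) (by omega)) (hrow _ h1 h2) (adj_of SE))
  refine (h1 x ?_ ?_).trans (joined_column hP.1 fun y' h2 h3 => hB _ _ ?_)
  all_goals
    unfold InPar at *
    omega

/-- In the layer `Z`, a parallelogram is tiled, is closed under adjacency of tiles, and has no
tiles above. -/
structure Plat (T : Finset Node) (xe X b t₀ t Z : ℤ) : Prop where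
  conn : Conn (T : Set Node)
  xe_le : xe ≤ X
  b_le : b ≤ t₀
  t₀_le : t₀ ≤ t
  single : xe = X → t = t₀
  mem : ∀ x y, InPar xe X b t₀ t x y → (x, y, Z) ∈ T
  closed : ∀ x y x' y', InPar xe X b t₀ t x y → (x', y', Z) ∈ T →
    fcc.Adj (x, y, Z) (x', y', Z) → InPar xe X b t₀ t x' y'
  une : ∀ x y, InPar xe X b t₀ t x y → (x, y, Z + 1) ∉ T
  uw : ∀ x y, InPar xe X b t₀ t x y → (x + 1, y - 1, Z + 1) ∉ T
  use : ∀ x y, InPar xe X b t₀ t x y → (x, y - 1, Z + 1) ∉ T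

section

variable {T S T₀ : Finset Node} {Q : Config → Prop} {xe X b t₀ t Z x y : ℤ} {q q₁ q₂ q₃ : State}

/-- A tile is shifted along the run of tiles below it: the agent goes down, places the tile that it
carries, returns and picks up the top one. -/
theorem ends_shift_down
    (h₁ : ∀ o, transition q₁ o = if o.here then (move DSW, q₁) else (place, q₂))
    (h₂ : ∀ o, transition q₂ o = if UNE ∈ o.nbr then (move UNE, q₂) else (pick, q₃))
    (hq₁ : q₁ ≠ .search) (hq₂ : q₂ ≠ .search) {z k : ℤ} (hz : z < Z) (hk : Z - k ≤ z)
    (hrun : ∀ z', Z - k < z' → z' ≤ Z → (x, y, z') ∈ S) (hlow : (x, y, Z - k) ∉ S)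
    (hup : (x, y, Z + 1) ∉ S) (hc : Conn (insert (x, y, z) (S : Set Node)))
    (hend : Conn (insert (x, y, Z - k) (S : Set Node)) →
      Ends T₀ Q ⟨(insert (x, y, Z - k) S).erase (x, y, Z), (x, y, Z), true, q₃⟩) :
    Ends T₀ Q ⟨S, (x, y, z), true, q₁⟩ := by
  induction hn : (z - (Z - k)).toNat generalizing z with
  | zero =>
    obtain rfl : z = Z - k := by omega
    refine .place (q' := q₂) (by simp [h₁, hlow]) hlow hc ?_ (hq := fun h => absurd h hq₁)
    have hc' : Conn ((insert (x, y, Z - k) S : Finset Node) : Set Node) := by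
      rwa [Finset.coe_insert]
    have hrun' : ∀ z', Z - k ≤ z' → z' ≤ Z → (x, y, z') ∈ insert (x, y, Z - k) S := by
      intro z' h1 h2
      rcases h1.eq_or_lt with rfl | h1
      · simp
      · simp [hrun z' h1 h2]
    have hup' : (x, y, Z + 1) ∉ insert (x, y, Z - k) S := by
      simp only [Finset.mem_insert, Prod.mk.injEq, not_or]
      exact ⟨by omega, hup⟩
    replace hend := hend hc
    generalize insert (x, y, Z - k) S = S' at *
    have key : ∀ z', Z - k ≤ z' → z' ≤ Z → Ends T₀ Q ⟨S', (x, y, z'), false, q₂⟩ := by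
      intro z' h1 h2
      induction hm : (Z - z').toNat generalizing z' with
      | zero =>
        obtain rfl : z' = Z := by omega
        exact .pick (by simp [h₂, hup']) (hrun' _ h1 le_rfl) hc' hend
          (hq := fun h => absurd h hq₂)
      | succ m ih =>
        have := hrun' (z' + 1) (by omega) (by omega)
        exact .move (d := UNE) (q' := q₂) (by simp [h₂, this]) (isConnected_of_tiles hc')
          (p' := (x, y, z' + 1)) (ih _ (by omega) (by omega) (by omega))
          (hq := fun h => absurd h hq₂)
    exact key _ le_rfl hz.le
  | succ n ih =>
    have hm := hrun z (by omega) hz.le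
    have hc' : Conn (S : Set Node) := by
      rwa [Set.insert_eq_of_mem (Finset.mem_coe.2 hm)] at hc
    refine .move (d := DSW) (q' := q₁) (by simp [h₁, hm]) (isConnected_of_tiles hc')
      (p' := (x, y, z - 1)) (ih (by omega) (by omega) ?_ (by omega)) (hq := fun h => absurd h hq₁)
    exact hc'.insert (Finset.mem_coe.2 hm) (adj_of DSW)

/-- The nodes of a parallelogram. -/
def par (T : Finset Node) (xe X b t₀ t Z : ℤ) : Finset Node :=
  T.filter fun u => u.2.2 = Z ∧ InPar xe X b t₀ t u.1 u.2.1

/-- The nodes of a parallelogram that precede `(x, y)` in the order of the projection: from east to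
west, and in each column from north to south. -/
def done (T : Finset Node) (xe X b t₀ t Z x y : ℤ) : Finset Node :=
  (par T xe X b t₀ t Z).filter fun u => u.1 < x ∨ u.1 = x ∧ y < u.2.1

namespace Plat

theorem mem_par (h : Plat T xe X b t₀ t Z) {x y z : ℤ} :
    (x, y, z) ∈ par T xe X b t₀ t Z ↔ z = Z ∧ InPar xe X b t₀ t x y := by
  simp only [par, Finset.mem_filter]
  constructor
  · exact fun h => h.2
  · rintro ⟨rfl, h1⟩
    exact ⟨h.mem _ _ h1, rfl, h1⟩

theorem mem_done (h : Plat T xe X b t₀ t Z) {x y x' y' z' : ℤ} :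
    (x', y', z') ∈ done T xe X b t₀ t Z x y ↔
      z' = Z ∧ InPar xe X b t₀ t x' y' ∧ (x' < x ∨ x' = x ∧ y < y') := by
  rw [done, Finset.mem_filter, h.mem_par, and_assoc]

/-- What is tiled while the nodes of `D` have been projected. -/
theorem mem_projected_iff (h : Plat T xe X b t₀ t Z) {D : Finset Node}
    (hD : D ⊆ par T xe X b t₀ t Z) {x y z : ℤ} (hz : Z ≤ z) :
    (x, y, z) ∈ projected T D ↔ (x, y, z) ∈ T ∧ (x, y, z) ∉ D := by
  rw [mem_projected]
  constructor
  · rintro (h1 | ⟨⟨x', y', z'⟩, hp, hp'⟩)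
    · exact h1
    · have h1 := (h.mem_par.1 (hD hp)).1
      have h2 := depth_pos T (x', y', z')
      simp only [low, Prod.mk.injEq] at hp'
      omega
  · exact .inl

theorem mem_projected_below (h : Plat T xe X b t₀ t Z) {D : Finset Node}
    (hD : D ⊆ par T xe X b t₀ t Z) {x y z : ℤ} (hz : z < Z) (hm : (x, y, z) ∈ T) :
    (x, y, z) ∈ projected T D := by
  refine mem_projected.2 (.inl ⟨hm, fun h1 => ?_⟩)
  have := (h.mem_par.1 (hD h1)).1
  omega

/-- The run of tiles below a projected node, including the newly placed tile. -/
theorem mem_projected_run (h : Plat T xe X b t₀ t Z) {D : Finset Node}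
    (hD : D ⊆ par T xe X b t₀ t Z) {x y z : ℤ} (hp : (x, y, Z) ∈ D) (hz : z < Z)
    (hz' : Z - depth T (x, y, Z) ≤ z) : (x, y, z) ∈ projected T D := by
  rcases hz'.eq_or_lt with rfl | hz'
  · exact mem_projected.2 (.inr ⟨_, hp, rfl⟩)
  · refine h.mem_projected_below hD hz ?_
    have := mem_of_lt_depth T (p := (x, y, Z)) (i := Z - z) (by omega) (by omega)
    simpa using this

theorem mem_projected_dsw (h : Plat T xe X b t₀ t Z) {D : Finset Node}
    (hD : D ⊆ par T xe X b t₀ t Z) {x y : ℤ} (hp : (x, y, Z) ∈ D) :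
    (x, y, Z - 1) ∈ projected T D := by
  have := depth_pos T (x, y, Z)
  exact h.mem_projected_run hD hp (by omega) (by omega)

/-- During a projection, connectivity can only be lost between projected and other nodes of the
parallelogram. -/
theorem conn_of_projected (h : Plat T xe X b t₀ t Z) {D : Finset Node}
    (hD : D ⊆ par T xe X b t₀ t Z) {B : Set Node} (hB : ∀ u ∈ projected T D, u ∈ B)
    (hB' : ∀ u ∈ B, u ∈ projected T D ∨ ∃ v ∈ projected T D, fcc.Adj v u)
    (hj : ∀ x y x' y', (x, y, Z) ∈ D → InPar xe X b t₀ t x' y' → (x', y', Z) ∉ D →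
      fcc.Adj (x, y, Z) (x', y', Z) → Joined B (x, y, Z - 1) (x', y', Z)) : Conn B := by
  classical
  have hstay : ∀ u ∈ T, u ∉ D → u ∈ B := fun u h1 h2 => hB _ (mem_projected.2 (.inl ⟨h1, h2⟩))
  have hdown : ∀ x y z, (x, y, z) ∈ D → z = Z ∧ (x, y, z - 1) ∈ B := by
    intro x y z hp
    obtain ⟨rfl, -⟩ := h.mem_par.1 (hD hp)
    exact ⟨rfl, hB _ (h.mem_projected_dsw hD hp)⟩
  -- adjacency of a projected node to any other tile
  have hmix : ∀ u ∈ D, ∀ v ∈ T, v ∉ D → fcc.Adj u v →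
      Joined B ((u.1, u.2.1, u.2.2 - 1) : Node) v := by
    rintro ⟨x, y, z⟩ hu ⟨x', y', z'⟩ hv hvD hadj
    obtain ⟨hz, hu'⟩ := hdown _ _ _ hu
    subst hz
    have hP := (h.mem_par.1 (hD hu)).2
    have hv' := hstay _ hv hvD
    by_cases hz' : z' = z
    · subst hz'
      exact hj x y x' y' hu (h.closed _ _ _ _ hP hv hadj) hvD hadj
    · obtain ⟨d, hd⟩ := hadj
      have e1 := congrArg (fun u : Node => u.1) hd
      have e2 := congrArg (fun u : Node => u.2.1) hd
      have e3 := congrArg (fun u : Node => u.2.2) hd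
      simp only [Prod.fst_add, Prod.snd_add] at e1 e2 e3
      cases d <;> simp only [Dir.vec, add_zero, ← sub_eq_add_neg] at e1 e2 e3 <;>
        subst e1 e2 e3
      · exact absurd hv (h.une _ _ hP)
      · exact absurd hv (h.uw _ _ hP)
      · exact absurd hv (h.use _ _ hP)
      iterate 6 exact absurd rfl hz'
      · exact .refl _ _
      · exact .of_adj hu' hv' (adj_of NE)
      · exact .of_adj hu' hv' (adj_of N)
  refine h.conn.map (fun u => if u ∈ D then ((u.1, u.2.1, u.2.2 - 1) : Node) else u) ?_ ?_ ?_
  · intro u hu v hv hadj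
    by_cases h1 : u ∈ D <;> by_cases h2 : v ∈ D
    · simp only [h1, h2, if_true]
      obtain ⟨x, y, z⟩ := u
      obtain ⟨x', y', z'⟩ := v
      refine .of_adj (hdown _ _ _ h1).2 (hdown _ _ _ h2).2 ?_
      obtain ⟨d, hd⟩ := hadj
      refine ⟨d, ?_⟩
      simp only [Prod.ext_iff, Prod.fst_add, Prod.snd_add] at hd ⊢
      omega
    · simp only [h1, h2, if_true, if_false]
      exact hmix u h1 v hv h2 hadj
    · simp only [h1, h2, if_true, if_false]
      exact (hmix v h2 u hu h1 hadj.symm).symm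
    · simp only [h1, h2, if_false]
      exact .of_adj (hstay _ hu h1) (hstay _ hv h2) hadj
  · have key : ∀ u ∈ projected T D, ∃ a ∈ (T : Set Node),
        Joined B (if a ∈ D then ((a.1, a.2.1, a.2.2 - 1) : Node) else a) u := by
      intro u hu
      rcases mem_projected.1 hu with ⟨h1, h2⟩ | ⟨⟨x, y, z⟩, hp, rfl⟩
      · exact ⟨u, h1, by simp [h2, Joined.refl]⟩
      · obtain ⟨rfl, hP⟩ := h.mem_par.1 (hD hp)
        refine ⟨(x, y, z), h.mem _ _ hP, ?_⟩
        simp only [hp, if_true, low]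
        have hrun : ∀ n : ℕ, (n : ℤ) + 1 ≤ depth T (x, y, z) →
            Joined B (x, y, z - 1) (x, y, z - (n + 1)) := by
          intro n
          induction n with
          | zero =>
            intro _
            simpa using Joined.refl B _
          | succ n ih =>
            intro hn
            push_cast at hn
            refine (ih (by omega)).trans (.of_adj ?_ ?_ ?_)
            · exact hB _ (h.mem_projected_run hD hp (by omega) (by omega))
            · exact hB _ (h.mem_projected_run hD hp (by push_cast; omega) (by push_cast; omega))
            · exact adj_of DSW (by simp [Dir.vec]) (by simp [Dir.vec])
                (by simp only [Dir.vec]; push_cast; omega)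
        have h1 := depth_pos T (x, y, z)
        have := hrun (depth T (x, y, z) - 1).toNat (by omega)
        convert this using 3
        omega
    intro u hu
    rcases hB' u hu with h1 | ⟨v, hv, hvu⟩
    · exact key u h1
    · obtain ⟨a, ha, hav⟩ := key v hv
      exact ⟨a, ha, hav.trans (.of_adj (hB _ hv) hu hvu)⟩
  · obtain ⟨u, hu⟩ := h.conn.1
    by_cases h1 : u ∈ D
    · exact ⟨_, (hdown u.1 u.2.1 u.2.2 h1).2⟩
    · exact ⟨u, hstay u hu h1⟩

theorem done_subset : done T xe X b t₀ t Z x y ⊆ par T xe X b t₀ t Z := Finset.filter_subset _ _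

/-- The tiles stay connected while columns of at least two nodes are projected one by one. -/
theorem conn_projected_done (h : Plat T xe X b t₀ t Z) (hbt : b < t) :
    Conn (projected T (done T xe X b t₀ t Z x y) : Set Node) := by
  refine h.conn_of_projected done_subset (fun _ => id) (fun u hu => .inl hu) ?_
  intro x₁ y₁ x₂ y₂ h1 h2 h3 hadj
  have hd1 := h.mem_done.1 h1
  have h3' : ¬ (x₂ < x ∨ x₂ = x ∧ y < y₂) := fun h' => h3 (h.mem_done.2 ⟨rfl, h2, h'⟩)
  have hb1 := h.mem_projected_dsw done_subset h1
  have hstay : ∀ x' y', InPar xe X b t₀ t x' y' → ¬ (x' < x ∨ x' = x ∧ y < y') →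
      (x', y', Z) ∈ (projected T (done T xe X b t₀ t Z x y) : Set Node) := by
    intro x' y' h4 h5
    exact mem_projected.2 (.inl ⟨h.mem _ _ h4, fun h6 => h5 (h.mem_done.1 h6).2.2⟩)
  have hb2 := hstay _ _ h2 h3'
  obtain ⟨d, hd⟩ := hadj
  have e1 := congrArg (fun u : Node => u.1) hd
  have e2 := congrArg (fun u : Node => u.2.1) hd
  have e3 := congrArg (fun u : Node => u.2.2) hd
  simp only [Prod.fst_add, Prod.snd_add] at e1 e2 e3
  obtain ⟨-, hP1, hlt⟩ := hd1
  cases d <;> simp only [Dir.vec, add_zero, ← sub_eq_add_neg] at e1 e2 e3 <;>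
    first | omega | skip
  all_goals subst e1 e2
  · -- `NW`: via `N` if that has been projected, and otherwise via `SW`
    by_cases hN : InPar xe X b t₀ t x₁ (y₂ + 1)
    · have hN' : (x₁, y₂ + 1, Z) ∈ done T xe X b t₀ t Z x y :=
        h.mem_done.2 ⟨rfl, hN, by omega⟩
      have hb3 := h.mem_projected_dsw done_subset hN'
      exact (Joined.of_adj hb1 hb3 (adj_of N)).trans (.of_adj hb3 hb2 (adj_of UW))
    · have hSW : InPar xe X b t₀ t (x₁ + 1) (y₂ - 1) := by
        unfold InPar at *
        omega
      have hb3 := hstay _ _ hSW (by omega)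
      exact (Joined.of_adj hb1 hb3 (adj_of UW)).trans (.of_adj hb3 hb2 (adj_of N))
  · exact .of_adj hb1 hb2 (adj_of UW)
  · exact .of_adj hb1 hb2 (adj_of USE)

theorem joined_par (h : Plat T xe X b t₀ t Z) {x y : ℤ} (hP : InPar xe X b t₀ t x y) :
    Joined (par T xe X b t₀ t Z) (X, b, Z) (x, y, Z) :=
  hP.joined (fun _ _ h' => h.mem_par.2 ⟨rfl, h'⟩) h.xe_le h.b_le h.t₀_le

theorem isFrag (h : Plat T xe X b t₀ t Z) : IsFrag T (par T xe X b t₀ t Z) where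
  nonempty := ⟨(X, b, Z), h.mem_par.2 ⟨rfl, le_rfl, .inl ⟨rfl, h.b_le⟩⟩⟩
  subset := Finset.filter_subset _ _
  level := by
    rintro ⟨x, y, z⟩ h1 ⟨x', y', z'⟩ h2
    rw [h.mem_par] at h1 h2
    simp [h1.1, h2.1]
  closed := by
    rintro ⟨x, y, z⟩ h1 ⟨x', y', z'⟩ h2 hadj hz
    rw [h.mem_par] at h1 ⊢
    obtain ⟨rfl, h1⟩ := h1
    simp only at hz
    subst hz
    exact ⟨rfl, h.closed _ _ _ _ h1 h2 hadj⟩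
  joined := by
    rintro ⟨x, y, z⟩ h1 ⟨x', y', z'⟩ h2
    rw [h.mem_par] at h1 h2
    obtain ⟨rfl, h1⟩ := h1
    obtain ⟨rfl, h2⟩ := h2
    exact (h.joined_par h1).symm.trans (h.joined_par h2)

/-- All nodes have been projected. -/
theorem projects (h : Plat T xe X b t₀ t Z) {v : Node} (hv : v ∈ par T xe X b t₀ t Z) :
    Projects T v (projected T (done T xe X b t₀ t Z X (b - 1))) (X, b, Z - 1) := by
  have hdone : done T xe X b t₀ t Z X (b - 1) = par T xe X b t₀ t Z := by
    ext ⟨x, y, z⟩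
    rw [h.mem_done, h.mem_par]
    unfold InPar
    omega
  refine ⟨_, hv, h.isFrag, ?_, ?_, by rw [hdone], (X, b, Z), ?_, ?_⟩
  · rintro ⟨x, y, z⟩ h1
    obtain ⟨rfl, h2⟩ := h.mem_par.1 h1
    have a1 := h.uw _ _ h2
    have a2 := h.use _ _ h2
    have a3 := h.une _ _ h2
    simp [Dir.vec, ← sub_eq_add_neg, a1, a2, a3]
  · exact ⟨xe, X, b, t₀, t, Z, h.xe_le, h.b_le, h.t₀_le, h.single, fun x y z => h.mem_par⟩
  · exact h.mem_par.2 ⟨rfl, le_rfl, .inl ⟨rfl, h.b_le⟩⟩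
  · simp [Dir.vec, ← sub_eq_add_neg]

/-- Shifting one more tile of the parallelogram. -/
theorem erase_insert_projected (h : Plat T xe X b t₀ t Z) (hP : InPar xe X b t₀ t x y) :
    (insert (x, y, Z - depth T (x, y, Z)) (projected T (done T xe X b t₀ t Z x y))).erase
        (x, y, Z) =
      projected T (done T xe X b t₀ t Z x (y - 1)) := by
  have hlow : (x, y, Z - depth T (x, y, Z)) = low T (x, y, Z) := rfl
  have hpos := depth_pos T (x, y, Z)
  have hins : done T xe X b t₀ t Z x (y - 1) = insert (x, y, Z) (done T xe X b t₀ t Z x y) := by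
    ext ⟨x', y', z'⟩
    rw [Finset.mem_insert, h.mem_done, h.mem_done, Prod.mk.injEq, Prod.mk.injEq]
    constructor
    · rintro ⟨rfl, h1, h2⟩
      by_cases hy : x' = x ∧ y' = y
      · exact .inl ⟨hy.1, hy.2, rfl⟩
      · exact .inr ⟨rfl, h1, by omega⟩
    · rintro (⟨rfl, rfl, rfl⟩ | ⟨rfl, h1, h2⟩)
      · exact ⟨rfl, hP, by omega⟩
      · exact ⟨rfl, h1, by omega⟩
  rw [hins, hlow]
  ext u
  rw [Finset.mem_erase, Finset.mem_insert, mem_projected, mem_projected]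
  simp only [Finset.mem_insert, not_or, exists_eq_or_imp]
  constructor
  · rintro ⟨h1, rfl | h2 | h2⟩
    · exact .inr (.inl rfl)
    · exact .inl ⟨h2.1, h1, h2.2⟩
    · exact .inr (.inr h2)
  · rintro (h1 | rfl | ⟨⟨x', y', z'⟩, h1, rfl⟩)
    · exact ⟨h1.2.1, .inr (.inl ⟨h1.1, h1.2.2⟩)⟩
    · refine ⟨?_, .inl rfl⟩
      simp only [low, Prod.mk.injEq, ne_eq]
      omega
    · refine ⟨?_, .inr (.inr ⟨_, h1, rfl⟩)⟩
      have h2 := (h.mem_done.1 h1).1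
      have h3 := depth_pos T (x', y', z')
      simp only [low, Prod.mk.injEq, ne_eq]
      omega

/-- One tile of the parallelogram is shifted, starting just below it. -/
theorem ends_shift (h : Plat T xe X b t₀ t Z) (hP : InPar xe X b t₀ t x y)
    (h₁ : ∀ o, transition q₁ o = if o.here then (move DSW, q₁) else (place, q₂))
    (h₂ : ∀ o, transition q₂ o = if UNE ∈ o.nbr then (move UNE, q₂) else (pick, q₃))
    (hq₁ : q₁ ≠ .search) (hq₂ : q₂ ≠ .search)
    (hc : Conn (insert (x, y, Z - 1) (projected T (done T xe X b t₀ t Z x y) : Set Node)))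
    (hend : Conn (insert (x, y, Z) (projected T (done T xe X b t₀ t Z x (y - 1)) : Set Node)) →
      Ends T₀ Q ⟨projected T (done T xe X b t₀ t Z x (y - 1)), (x, y, Z), true, q₃⟩) :
    Ends T₀ Q ⟨projected T (done T xe X b t₀ t Z x y), (x, y, Z - 1), true, q₁⟩ := by
  have hpos := depth_pos T (x, y, Z)
  have hmem : (x, y, Z) ∈ projected T (done T xe X b t₀ t Z x y) := by
    rw [h.mem_projected_iff done_subset le_rfl, h.mem_done]
    exact ⟨h.mem _ _ hP, by omega⟩
  refine ends_shift_down h₁ h₂ hq₁ hq₂ (Z := Z) (k := depth T (x, y, Z)) (by omega) (by omega)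
    ?_ ?_ ?_ hc ?_
  · intro z' h1 h2
    rcases h2.eq_or_lt with rfl | h2
    · exact hmem
    · refine h.mem_projected_below done_subset h2 ?_
      have := mem_of_lt_depth T (p := (x, y, Z)) (i := Z - z') (by omega) (by omega)
      simpa using this
  · intro h1
    rcases mem_projected.1 h1 with h2 | ⟨⟨x', y', z'⟩, h2, h3⟩
    · exact low_notMem T (x, y, Z) h2.1
    · have h4 := h.mem_done.1 h2
      simp only [low, Prod.mk.injEq] at h3
      omega
  · rw [h.mem_projected_iff done_subset (by omega)]
    exact fun h1 => h.une _ _ hP h1.1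
  · intro hc'
    rw [h.erase_insert_projected hP]
    refine hend ?_
    rw [← h.erase_insert_projected hP, Finset.coe_erase, Set.insert_sdiff_singleton,
      Finset.coe_insert, Set.insert_eq_of_mem]
    · exact hc'
    · exact Set.mem_insert_of_mem _ hmem

/-- The projection of a column from `(x, y)` on. -/
theorem ends_projDown (h : Plat T xe X b t₀ t Z) (hbt : b < t) {v : Node}
    (hv : v ∈ par T xe X b t₀ t Z)
    (hnext : x < X → Ends T₀ (Outcome T v)
      ⟨projected T (done T xe X b t₀ t Z x (b - 1)), (x + 1, b, Z), true, .projTop⟩)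
    (hP : InPar xe X b t₀ t x y)
    (hq : transition q (lookAt (projected T (done T xe X b t₀ t Z x y)) (x, y, Z)) =
      projDownStep (lookAt (projected T (done T xe X b t₀ t Z x y)) (x, y, Z)))
    (hns : q ≠ .search) :
    Ends T₀ (Outcome T v)
      ⟨projected T (done T xe X b t₀ t Z x y), (x, y, Z), true, q⟩ := by
  induction hn : (y - b).toNat using Nat.strong_induction_on generalizing y q with
  | _ n ih =>
    have hc := h.conn_projected_done hbt (x := x) (y := y)
    have hmem : (x, y, Z) ∈ projected T (done T xe X b t₀ t Z x y) := by
      rw [h.mem_projected_iff done_subset le_rfl, h.mem_done]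
      exact ⟨h.mem _ _ hP, by omega⟩
    refine .move (d := DSW) (q' := .projDown) (by rw [hq]; simp [projDownStep, hmem])
      (isConnected_of_tiles hc) (p' := (x, y, Z - 1)) ?_ (hq := fun h => absurd h hns)
    refine h.ends_shift hP (q₁ := .projDown) (q₂ := .projUp) (q₃ := .projNext) (fun _ => rfl)
      (fun _ => rfl) (by nofun) (by nofun) (hc.insert hmem (adj_of DSW)) fun _ => ?_
    have hc' := h.conn_projected_done hbt (x := x) (y := y - 1)
    have hS : (x, y - 1, Z) ∈ projected T (done T xe X b t₀ t Z x (y - 1)) ↔ b < y := by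
      rw [h.mem_projected_iff done_subset le_rfl, h.mem_done]
      constructor
      · intro h1
        have := (h.closed _ _ _ _ hP h1.1 (adj_of S)).1
        omega
      · intro h1
        refine ⟨h.mem _ _ ?_, by omega⟩
        unfold InPar at *
        omega
    by_cases hy : b < y
    · refine .move (d := S) (q' := .projDown) (by simp [transition, hS, hy])
        (isConnected_of_tiles hc') (p' := (x, y - 1, Z)) (ih _ (by omega) ?_ rfl (by nofun) rfl)
      unfold InPar at *
      omega
    · obtain rfl : y = b := by
        have := hP.1
        omega
      have hNW : (x + 1, y, Z) ∈ projected T (done T xe X y t₀ t Z x (y - 1)) ↔ x < X := by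
        rw [h.mem_projected_iff done_subset le_rfl, h.mem_done]
        constructor
        · intro h1
          have := (h.closed _ _ _ _ hP h1.1 (adj_of NW)).2
          omega
        · intro h1
          have := h.b_le
          have := h.t₀_le
          refine ⟨h.mem _ _ ?_, by omega⟩
          unfold InPar at *
          omega
      by_cases hx : x < X
      · exact .move (d := NW) (q' := .projTop) (by simp [transition, hS, hNW, hx])
          (isConnected_of_tiles hc') (p' := (x + 1, y, Z)) (hnext hx)
      · obtain rfl : x = X := by
          unfold InPar at hP
          omega
        refine .move (d := DSW) (q' := .search) (by simp [transition, hS, hNW])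
          (isConnected_of_tiles hc') (p' := (x, y, Z - 1))
          (.done ⟨⟨?_, rfl, hc', rfl⟩, .inr (.inr ⟨rfl, h.projects hv⟩)⟩)
        exact h.mem_projected_dsw done_subset (h.mem_done.2 ⟨rfl, hP, by omega⟩)

/-- The projection from the column at `x` on. -/
theorem ends_projTop (h : Plat T xe X b t₀ t Z) (hbt : b < t) {v : Node}
    (hv : v ∈ par T xe X b t₀ t Z) (hP : InPar xe X b t₀ t x y)
    (hq : transition q (lookAt (projected T (done T xe X b t₀ t Z x t)) (x, y, Z)) =
      projTopStep (lookAt (projected T (done T xe X b t₀ t Z x t)) (x, y, Z)))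
    (hns : q ≠ .search) :
    Ends T₀ (Outcome T v) ⟨projected T (done T xe X b t₀ t Z x t), (x, y, Z), true, q⟩ := by
  induction hn : (X - x).toNat using Nat.strong_induction_on generalizing x y q with
  | _ n ihx =>
    have hnext : x < X → Ends T₀ (Outcome T v)
        ⟨projected T (done T xe X b t₀ t Z x (b - 1)), (x + 1, b, Z), true, .projTop⟩ := by
      intro hx
      have hdone : done T xe X b t₀ t Z x (b - 1) = done T xe X b t₀ t Z (x + 1) t := by
        ext ⟨x', y', z'⟩
        rw [h.mem_done, h.mem_done]
        have := h.t₀_le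
        unfold InPar
        omega
      rw [hdone]
      refine ihx _ (by omega) ?_ rfl (by nofun) rfl
      have := h.b_le
      have := h.t₀_le
      unfold InPar at *
      omega
    have hc := h.conn_projected_done hbt (x := x) (y := t)
    have hyt : y ≤ t := by
      have := h.t₀_le
      unfold InPar at hP
      omega
    clear ihx
    induction hm : (t - y).toNat using Nat.strong_induction_on generalizing y q with
    | _ m ihy =>
      by_cases hN : InPar xe X b t₀ t x (y + 1)
      · have hN' : (x, y + 1, Z) ∈ projected T (done T xe X b t₀ t Z x t) := by
          rw [h.mem_projected_iff done_subset le_rfl, h.mem_done]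
          have := h.t₀_le
          refine ⟨h.mem _ _ hN, ?_⟩
          unfold InPar at *
          omega
        refine .move (d := N) (q' := .projTop) (by rw [hq]; simp [projTopStep, hN'])
          (isConnected_of_tiles hc) (p' := (x, y + 1, Z)) ?_ (hq := fun h => absurd h hns)
        have hyt' : y + 1 ≤ t := by
          have := h.t₀_le
          unfold InPar at hN
          omega
        exact ihy _ (by omega) hN rfl (by nofun) hyt' rfl
      · have hN' : (x, y + 1, Z) ∉ projected T (done T xe X b t₀ t Z x t) := by
          rw [h.mem_projected_iff done_subset le_rfl]
          exact fun h1 => hN (h.closed _ _ _ _ hP h1.1 (adj_of N))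
        have hdone : done T xe X b t₀ t Z x t = done T xe X b t₀ t Z x y := by
          ext ⟨x', y', z'⟩
          rw [h.mem_done, h.mem_done]
          have := h.t₀_le
          unfold InPar at *
          omega
        have hq' : transition q (lookAt (projected T (done T xe X b t₀ t Z x t)) (x, y, Z)) =
            projDownStep (lookAt (projected T (done T xe X b t₀ t Z x t)) (x, y, Z)) := by
          rw [hq]
          simp [projTopStep, hN']
        rw [hdone] at hq' ⊢
        exact h.ends_projDown hbt hv hnext hP hq' hns

/-- A parallelogram of columns of at least two nodes is projected. -/
theorem ends_project_columns (h : Plat T xe X b t₀ t Z) (hbt : b < t) {v : Node}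
    (hv : v ∈ par T xe X b t₀ t Z)
    (hq : transition q (lookAt T (xe, b, Z)) = projTopStep (lookAt T (xe, b, Z)))
    (hns : q ≠ .search) :
    Ends T₀ (Outcome T v) ⟨T, (xe, b, Z), true, q⟩ := by
  have hdone : projected T (done T xe X b t₀ t Z xe t) = T := by
    have : done T xe X b t₀ t Z xe t = ∅ := by
      ext ⟨x', y', z'⟩
      rw [h.mem_done]
      have := h.xe_le
      have := h.t₀_le
      simp only [Finset.notMem_empty, iff_false]
      unfold InPar
      omega
    simp [projected, this]
  have hP : InPar xe X b t₀ t xe b := by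
    have := h.xe_le
    have := h.b_le
    have := h.t₀_le
    unfold InPar
    omega
  have := h.ends_projTop hbt hv (T₀ := T₀) (q := q) hP (by rw [hdone]; exact hq) hns
  rwa [hdone] at this

/-- A row is projected. After a tile has been shifted, the agent goes via `SW`, where it connects
the shifted part of the row to the other one. -/
theorem ends_lineDown (h : Plat T xe X b t₀ t Z) (hbt : b = t) {v : Node}
    (hv : v ∈ par T xe X b t₀ t Z) (hx : xe ≤ x) (hx' : x ≤ X)
    (hc : Conn (insert (x, b, Z - 1) (projected T (done T xe X b t₀ t Z x b) : Set Node))) :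
    Ends T₀ (Outcome T v)
      ⟨projected T (done T xe X b t₀ t Z x b), (x, b, Z - 1), true, .lineDown⟩ := by
  have hb0 := h.b_le
  have h0t := h.t₀_le
  induction hn : (X - x).toNat using Nat.strong_induction_on generalizing x with
  | _ n ih =>
    have hP : ∀ x', xe ≤ x' → x' ≤ X → InPar xe X b t₀ t x' b := by
      intro x' h1 h2
      unfold InPar
      omega
    refine h.ends_shift (hP x hx hx') (q₁ := .lineDown) (q₂ := .lineUp) (q₃ := .lineNext)
      (fun _ => rfl) (fun _ => rfl) (by nofun) (by nofun) hc fun hc1 => ?_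
    have hNW : (x + 1, b, Z) ∈ projected T (done T xe X b t₀ t Z x (b - 1)) ↔ x < X := by
      rw [h.mem_projected_iff done_subset le_rfl, h.mem_done]
      constructor
      · intro h1
        have := (h.closed _ _ _ _ (hP x hx hx') h1.1 (adj_of NW)).2
        omega
      · intro h1
        exact ⟨h.mem _ _ (hP _ (by omega) (by omega)), by omega⟩
    have hdown : (x, b, Z - 1) ∈ projected T (done T xe X b t₀ t Z x (b - 1)) :=
      h.mem_projected_dsw done_subset (h.mem_done.2 ⟨rfl, hP x hx hx', by omega⟩)
    have hagent : ∀ a : Node, fcc.Adj (x, b, Z - 1) a → (x < X → fcc.Adj a (x + 1, b, Z)) →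
        Conn (insert a (projected T (done T xe X b t₀ t Z x (b - 1)) : Set Node)) := by
      intro a ha1 ha2
      refine h.conn_of_projected done_subset (fun u hu => Set.mem_insert_of_mem _ hu) ?_ ?_
      · rintro u (rfl | hu)
        · exact .inr ⟨_, hdown, ha1⟩
        · exact .inl hu
      · intro x₁ y₁ x₂ y₂ h1 h2 h3 hadj
        rw [h.mem_done] at h1 h3
        have hxx : x₁ = x ∧ x₂ = x + 1 ∧ y₁ = b ∧ y₂ = b ∧ x < X := by
          obtain ⟨d, hd⟩ := hadj
          simp only [Prod.ext_iff, Prod.fst_add, Prod.snd_add] at hd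
          have h4 : ¬ (x₂ < x ∨ x₂ = x ∧ b - 1 < y₂) := fun h' => h3 ⟨rfl, h2, h'⟩
          obtain ⟨-, h1, h5⟩ := h1
          unfold InPar at h1 h2
          cases d <;> simp only [Dir.vec] at hd <;> omega
        obtain ⟨rfl, rfl, rfl, rfl, hlt⟩ := hxx
        refine Joined.trans (v := a) (.of_adj ?_ (Set.mem_insert _ _) ha1)
          (.of_adj (Set.mem_insert _ _) ?_ (ha2 hlt))
        · exact Set.mem_insert_of_mem _ hdown
        · exact Set.mem_insert_of_mem _ (hNW.2 hlt)
    by_cases hlt : x < X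
    · refine .move (d := SW) (q' := .lineDescend) (by simp [transition, hNW, hlt])
        (isConnected_of_insert hc1) (p' := (x + 1, b - 1, Z)) ?_
      refine .move (d := DNW) (q' := .lineDown) rfl
        (isConnected_of_insert (hagent (x + 1, b - 1, Z) (adj_of UW) fun _ => adj_of N))
        (p' := (x + 1, b, Z - 1)) ?_
      have hdone : done T xe X b t₀ t Z x (b - 1) = done T xe X b t₀ t Z (x + 1) b := by
        ext ⟨x', y', z'⟩
        rw [h.mem_done, h.mem_done]
        unfold InPar
        omega
      rw [hdone] at hagent ⊢
      exact ih _ (by omega) (by omega) (by omega) (hagent _ (adj_of NW) fun _ => adj_of UNE) rfl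
    · obtain rfl : x = X := by omega
      have hc' := hagent (x, b, Z - 1 - 1) (adj_of DSW) (by omega)
      have hfin : Conn (projected T (done T xe x b t₀ t Z x (b - 1)) : Set Node) := by
        refine h.conn_of_projected done_subset (fun _ => id) (fun u hu => .inl hu) ?_
        intro x₁ y₁ x₂ y₂ _ h2 h3 _
        refine absurd (h.mem_done.2 ⟨rfl, h2, ?_⟩) h3
        unfold InPar at h2
        omega
      exact .move (d := DSW) (q' := .search) (by simp [transition, hNW])
        (isConnected_of_insert hc1) (p' := (x, b, Z - 1))
        (.done ⟨⟨hdown, rfl, hfin, rfl⟩, .inr (.inr ⟨rfl, h.projects hv⟩)⟩)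

theorem ends_project (h : Plat T xe X b t₀ t Z) {v : Node} (hv : v ∈ par T xe X b t₀ t Z) :
    Ends T₀ (Outcome T v) ⟨T, (xe, b, Z), true, .project⟩ := by
  have hP : InPar xe X b t₀ t xe b := by
    have := h.xe_le
    have := h.b_le
    have := h.t₀_le
    unfold InPar
    omega
  have hS : (xe, b - 1, Z) ∉ T := by
    intro h1
    have := (h.closed _ _ _ _ hP h1 (adj_of S)).1
    omega
  have hN : (xe, b + 1, Z) ∈ T ↔ b < t := by
    have := h.xe_le
    have := h.single
    constructor
    · intro h1
      have := (h.closed _ _ _ _ hP h1 (adj_of N)).2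
      omega
    · intro h1
      refine h.mem _ _ ?_
      unfold InPar
      omega
  by_cases hbt : b < t
  · exact h.ends_project_columns hbt hv (by simp [transition, hN, hbt]) (by nofun)
  · have hbt' : b = t := by
      have := h.b_le
      have := h.t₀_le
      omega
    have hm := h.mem _ _ hP
    have hdone : projected T (done T xe X b t₀ t Z xe b) = T := by
      have : done T xe X b t₀ t Z xe b = ∅ := by
        ext ⟨x', y', z'⟩
        rw [h.mem_done]
        have := h.xe_le
        have := h.t₀_le
        simp only [Finset.notMem_empty, iff_false]
        unfold InPar
        omega
      simp [projected, this]
    have hc := h.conn.insert (Finset.mem_coe.2 hm) (w := (xe, b, Z - 1)) (adj_of DSW)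
    refine .move (d := DSW) (q' := .lineDown)
      (by simp [transition, hN, hbt, hS, lineDownStep, hm])
      (isConnected_of_tiles h.conn) (p' := (xe, b, Z - 1)) ?_
    have := h.ends_lineDown hbt' hv (T₀ := T₀) le_rfl h.xe_le (by rw [hdone]; exact hc)
    rwa [hdone] at this

end Plat

end

/-- A column that is a fragment of its own is projected. -/
theorem Walk.ends_project {T T₀ : Finset Node} {x y z t : ℤ} {q : State}
    (h : Walk T x y z t true) (hns : q ≠ .search) (hS : (x, y - 1, z) ∉ T)
    (huw : (x + 1, y - 1, z + 1) ∉ T) (huse : (x, y - 1, z + 1) ∉ T) (hsw : (x + 1, y - 1, z) ∉ T)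
    (hse : (x - 1, y, z) ∉ T)
    (hq : transition q (lookAt T (x, y, z)) = projTopStep (lookAt T (x, y, z))) :
    Ends T₀ (Outcome T (x, t, z)) ⟨T, (x, y, z), true, q⟩ := by
  have hlt := h.lt
  have hin : ∀ x' y', InPar x x y t t x' y' ↔ x' = x ∧ y ≤ y' ∧ y' ≤ t := by
    intro x' y'
    unfold InPar
    omega
  have hplat : Plat T x x y t t z := by
    refine ⟨h.top.conn, le_rfl, by omega, le_rfl, fun _ => rfl, ?_, ?_, ?_, ?_, ?_⟩
    · intro x' y' h1
      obtain ⟨rfl, h1, h2⟩ := (hin _ _).1 h1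
      exact h.col _ h1 h2
    · intro x₁ y₁ x₂ y₂ h1 h2 h3
      obtain ⟨rfl, h4, h5⟩ := (hin _ _).1 h1
      rw [hin]
      have hno : ∀ {u v : Node}, u ∈ T → u = v → v ∉ T → False := fun h1 h2 h3 => h3 (h2 ▸ h1)
      obtain ⟨d, hd⟩ := h3
      simp only [Prod.ext_iff, Prod.fst_add, Prod.snd_add] at hd
      rcases h4.eq_or_lt with rfl | h4
      · have a1 := h.nw le_rfl h5
        have a2 := h.se (y + 1) (by omega) (by omega)
        cases d <;> simp only [Dir.vec] at hd
        case N => omega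
        case S => exact (hno h2 (by ext <;> simp <;> omega) hS).elim
        case NW => exact (hno h2 (by ext <;> simp <;> omega) a1).elim
        case SW => exact (hno h2 (by ext <;> simp <;> omega) hsw).elim
        case SE => exact (hno h2 (by ext <;> simp <;> omega) hse).elim
        case NE => exact (hno h2 (by ext <;> simp <;> omega) a2).elim
        all_goals omega
      · have hd' : d = N ∨ d = S ∨ d = DSW ∨ d = DNW ∨ d = NE := by
          refine h.nbr h4 h5 ?_
          have : (x₁, y₁, z) + d.vec = (x₂, y₂, z) := by
            ext <;> simp <;> omega
          rwa [this]
        rcases hd' with rfl | rfl | rfl | rfl | rfl <;> simp only [Dir.vec] at hd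
        · by_contra hcon
          exact hno h2 (v := (x₁, t + 1, z)) (by ext <;> simp <;> omega) h.top.n
        · omega
        · omega
        · omega
        · by_cases hy : y₁ = t
          · subst hy
            have := (not_congr h.ne).2 (by simp)
            exact (hno h2 (by ext <;> simp <;> omega) this).elim
          · have := h.se (y₁ + 1) (by omega) (by omega)
            exact (hno h2 (by ext <;> simp <;> omega) this).elim
    · intro x' y' h1
      obtain ⟨rfl, h1, h2⟩ := (hin _ _).1 h1
      exact h.une h1 h2
    · intro x' y' h1
      obtain ⟨rfl, h1, h2⟩ := (hin _ _).1 h1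
      rcases h1.eq_or_lt with rfl | h1
      · exact huw
      · exact h.uw _ h1 h2
    · intro x' y' h1
      obtain ⟨rfl, h1, h2⟩ := (hin _ _).1 h1
      rcases h1.eq_or_lt with rfl | h1
      · exact huse
      · exact h.use _ h1 h2
  refine hplat.ends_project_columns hlt ?_ hq hns
  rw [hplat.mem_par, hin]
  exact ⟨rfl, rfl, by omega, le_rfl⟩

/-! ### Building a parallelogram -/

/-- The node `w` at which a tile is placed while the tile at the node `(X, t₀, Z)` is going to be
picked up. -/
structure Spot (T : Finset Node) (X t₀ Z : ℤ) (w : Node) : Prop where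
  notMem : w ∉ T
  adj : ∃ a ∈ T, a.1 < X ∧ a.1 ≤ w.1 ∧ fcc.Adj a w
  y_ge : ∃ a ∈ T, a.2.1 ≤ w.2.1
  y_le : ∃ a ∈ T, w.2.1 ≤ a.2.1
  lt : w.1 < X ∨ w.1 = X ∧ w.2.1 < t₀
  nbr : (X, t₀ - 1, Z) ∈ T ∨ (X - 1, t₀, Z) ∈ T ∨ (X - 1, t₀ + 1, Z) ∈ T

/-- The agent may leave the search phase at `(X, t₀, Z)`, and the tiles remain connected without
that node. -/
structure ParStart (T : Finset Node) (X t₀ Z : ℤ) : Prop extends Top T X t₀ Z where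
  cut : ∀ d e : Dir, (X, t₀, Z) + d.vec ∈ T → (X, t₀, Z) + e.vec ∈ T →
    Joined (T.erase (X, t₀, Z) : Finset Node) ((X, t₀, Z) + d.vec) ((X, t₀, Z) + e.vec)

/-- The columns at `xc ≤ x ≤ X` that the agent has traversed so far: all have the southernmost
node `(x, b, Z)`; the column at `X` ends at `t₀`, and all others are tiled up to `t`. -/
structure Region (T : Finset Node) (xc X b t₀ t Z : ℤ) : Prop where
  xc_le : xc ≤ X
  b_le : b ≤ t₀
  t₀_le : t₀ ≤ t
  mem : ∀ x y, InPar xc X b t₀ t x y → (x, y, Z) ∈ T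
  top : (X, t₀ + 1, Z) ∉ T
  west : ∀ y, b - 1 ≤ y → y ≤ t₀ → (X + 1, y, Z) ∉ T
  gap : ∀ y, t₀ < y → y ≤ t → (X, y, Z) ∉ T
  bot : ∀ x, xc ≤ x → x ≤ X → (x, b - 1, Z) ∉ T

/-- What has been observed at the nodes `y < y' ≤ tp` of a column that is being traversed from
north to south. -/
structure Seen (T : Finset Node) (first : Bool) (x Z y tp : ℤ) : Prop where
  mem : ∀ y', y < y' → y' ≤ tp → (x, y', Z) ∈ T
  une : ∀ y', y < y' → y' ≤ tp → (x, y', Z + 1) ∉ T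
  uw : ∀ y', y < y' → y' ≤ tp → (x + 1, y' - 1, Z + 1) ∉ T
  use : ∀ y', y < y' → y' ≤ tp → (x, y' - 1, Z + 1) ∉ T
  sw : first = true → ∀ y', y < y' → y' ≤ tp → (x + 1, y' - 1, Z) ∉ T
  ne_se : ∀ y', y < y' → y' ≤ tp → (x - 1, y' + 1, Z) ∈ T → (x - 1, y', Z) ∈ T
  se_ne : ∀ y', y < y' → y' < tp → (x - 1, y', Z) ∈ T → (x - 1, y' + 1, Z) ∈ T

section

variable {T T' T₀ : Finset Node} {Q : Config → Prop} {xc X b t₀ t Z x y tp : ℤ} {q : State}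
  {w : Node} {first : Bool}

/-- After a tile has been placed at `w`, the tile at `(X, t₀, Z)` is picked up. -/
theorem ParStart.ends_pick (h : ParStart T X t₀ Z) (hw : Spot T X t₀ Z w)
    (hq : transition q (lookAt (insert w T) (X, t₀, Z)) = (pick, .leave)) (hns : q ≠ .search) :
    Ends T₀ (Outcome T (X, t₀, Z)) ⟨insert w T, (X, t₀, Z), false, q⟩ := by
  obtain ⟨a, ha, haX, haw, hadj⟩ := hw.adj
  have hwv : w ≠ (X, t₀, Z) := fun h' => hw.notMem (h' ▸ h.mem)
  have hav : a ≠ (X, t₀, Z) := by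
    rintro rfl
    simp at haX
  have hins := conn_insert h.conn ha hadj
  -- some neighbour of the picked tile
  obtain ⟨d, hd⟩ : ∃ d : Dir, (X, t₀, Z) + d.vec ∈ T := by
    rcases hw.nbr with h1 | h1 | h1
    · exact ⟨S, by simpa [Dir.vec, ← sub_eq_add_neg] using h1⟩
    · exact ⟨SE, by simpa [Dir.vec, ← sub_eq_add_neg] using h1⟩
    · exact ⟨NE, by simpa [Dir.vec, ← sub_eq_add_neg] using h1⟩
  have hcut : Conn ((T.erase (X, t₀, Z) : Finset Node) : Set Node) := by
    refine h.conn.swap (v := (X, t₀, Z)) (w := (X, t₀, Z) + d.vec) (fun u => ?_)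
      (fun e he => h.cut d e hd he) h.mem
    simp only [Finset.mem_coe, Finset.mem_erase]
    constructor
    · exact fun h => .inr ⟨h.2, h.1⟩
    · rintro (rfl | h)
      · exact ⟨by simp [d.vec_ne_zero], hd⟩
      · exact ⟨h.2, h.1⟩
  have hc : Conn ((insert w (T.erase (X, t₀, Z)) : Finset Node) : Set Node) :=
    conn_insert hcut (Finset.mem_erase.2 ⟨hav, ha⟩) hadj
  have he : (insert w T).erase (X, t₀, Z) = insert w (T.erase (X, t₀, Z)) :=
    Finset.erase_insert_of_ne hwv
  have hdrop : Drop T (insert w (T.erase (X, t₀, Z))) :=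
    drop_shift h.mem hw.notMem hw.lt ⟨a, ha, haw⟩ hw.y_ge hw.y_le
  have hnbr : (X, t₀ - 1, Z) ∈ insert w (T.erase (X, t₀, Z)) ∨
      (X - 1, t₀, Z) ∈ insert w (T.erase (X, t₀, Z)) ∨
      (X - 1, t₀ + 1, Z) ∈ insert w (T.erase (X, t₀, Z)) := by
    rcases hw.nbr with h1 | h1 | h1 <;> simp [h1]
  refine .pick hq (Finset.mem_insert_of_mem h.mem) hins ?_ (hq := fun h => absurd h hns)
  rw [he]
  generalize insert w (T.erase (X, t₀, Z)) = T' at *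
  by_cases h1 : (X, t₀ - 1, Z) ∈ T'
  · exact .move (d := S) (q' := .search) (by simp [transition, leaveStep, h1])
      (isConnected_of_tiles hc) (p' := (X, t₀ - 1, Z)) (.of_drop hdrop h1 hc)
  by_cases h2 : (X - 1, t₀, Z) ∈ T'
  · exact .move (d := SE) (q' := .search) (by simp [transition, leaveStep, h1, h2])
      (isConnected_of_tiles hc) (p' := (X - 1, t₀, Z)) (.of_drop hdrop h2 hc)
  · have h3 : (X - 1, t₀ + 1, Z) ∈ T' := by tauto
    exact .move (d := NE) (q' := .search) (by simp [transition, leaveStep, h1, h2])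
      (isConnected_of_tiles hc) (p' := (X - 1, t₀ + 1, Z)) (.of_drop hdrop h3 hc)

/-- The way back within the first column. -/
theorem ends_back_true (hc : Conn (T : Set Node)) (hy : y ≤ t₀)
    (hmem : ∀ y', y ≤ y' → y' ≤ t₀ → (X, y', Z) ∈ T) (htop : (X, t₀ + 1, Z) ∉ T)
    (hend : ∀ q : State, transition q (lookAt T (X, t₀, Z)) = (pick, .leave) → q ≠ .search →
      Ends T₀ Q ⟨T, (X, t₀, Z), false, q⟩) :
    Ends T₀ Q ⟨T, (X, y, Z), false, .back true⟩ := by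
  induction hn : (t₀ - y).toNat generalizing y with
  | zero =>
    obtain rfl : y = t₀ := by omega
    exact hend _ (by simp [transition, htop]) (by nofun)
  | succ n ih =>
    have := hmem (y + 1) (by omega) (by omega)
    exact .move (d := N) (q' := .back true) (by simp [transition, this])
      (isConnected_of_tiles hc) (p' := (X, y + 1, Z))
      (ih (by omega) (fun y' h1 h2 => hmem y' (by omega) h2) (by omega))

/-- The way back along the southernmost row and then through the first column. -/
theorem ends_backRow (hc : Conn (T : Set Node))
    (hmem : ∀ x y, InPar xc X b t₀ t x y → (x, y, Z) ∈ T) (ht₀ : t₀ ≤ t)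
    (htop : (X, t₀ + 1, Z) ∉ T) (hwest : ∀ y, b - 1 ≤ y → y ≤ t₀ → (X + 1, y, Z) ∉ T)
    (hend : ∀ q : State, transition q (lookAt T (X, t₀, Z)) = (pick, .leave) → q ≠ .search →
      Ends T₀ Q ⟨T, (X, t₀, Z), false, q⟩)
    (hxy : y = b ∧ xc ≤ x ∧ x ≤ X ∨ x = X) (hby : b ≤ y) (hyt : y ≤ t₀)
    (hq : transition q (lookAt T (x, y, Z)) = backRowStep (lookAt T (x, y, Z)))
    (hns : q ≠ .search) : Ends T₀ Q ⟨T, (x, y, Z), false, q⟩ := by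
  induction hn : (X - x).toNat + (t₀ - y).toNat using Nat.strong_induction_on
    generalizing x y q with
  | _ n ih =>
    by_cases hx : x = X
    · subst hx
      have h1 := hwest y (by omega) hyt
      have h2 := hwest (y - 1) (by omega) (by omega)
      by_cases hy : y = t₀
      · subst hy
        exact hend q (by rw [hq]; simp [backRowStep, h1, h2, htop]) hns
      · have h3 := hmem x (y + 1) ⟨by omega, .inl ⟨rfl, by omega⟩⟩
        exact .move (d := N) (q' := .backRow) (by rw [hq]; simp [backRowStep, h1, h2, h3])
          (isConnected_of_tiles hc) (p' := (x, y + 1, Z))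
          (ih _ (by omega) (.inr rfl) (by omega) (by omega) rfl (by nofun) rfl)
          (hq := fun h => absurd h hns)
    · have h1 := hmem (x + 1) y (by unfold InPar; omega)
      exact .move (d := NW) (q' := .backRow) (by rw [hq]; simp [backRowStep, h1])
        (isConnected_of_tiles hc) (p' := (x + 1, y, Z))
        (ih _ (by omega) (by omega) (by omega) (by omega) rfl (by nofun) rfl)
        (hq := fun h => absurd h hns)

/-- The way back from a later column, or from the node north of it. -/
theorem Region.ends_back_false (h : Region T xc X b t₀ t Z) (hc : Conn (T : Set Node))
    (hend : ∀ q : State, transition q (lookAt T (X, t₀, Z)) = (pick, .leave) → q ≠ .search →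
      Ends T₀ Q ⟨T, (X, t₀, Z), false, q⟩)
    (hx : xc ≤ x) (hxX : x ≤ X) (hby : b ≤ y) (hyt : y ≤ t + 1) (hX : x = X → y ≤ t₀) :
    Ends T₀ Q ⟨T, (x, y, Z), false, .back false⟩ := by
  have hb := h.b_le
  have h0 := h.t₀_le
  induction hn : (y - b).toNat using Nat.strong_induction_on generalizing x y with
  | _ n ih =>
    by_cases hy : y = b
    · subst hy
      have hS := h.bot x hx hxX
      have hSW : (x + 1, y - 1, Z) ∉ T := by
        rcases hxX.eq_or_lt with rfl | hlt
        · exact h.west _ (by omega) (by omega)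
        · exact h.bot _ (by omega) (by omega)
      exact ends_backRow hc h.mem h0 h.top h.west hend (.inl ⟨rfl, hx, hxX⟩) le_rfl hb
        (by simp [transition, hS, hSW]) (by nofun)
    by_cases hgo : x + 1 < X ∨ x < X ∧ y - 1 ≤ t₀
    · have hSW := h.mem (x + 1) (y - 1) (by unfold InPar; omega)
      exact .move (d := SW) (q' := .back false) (by simp [transition, hSW])
        (isConnected_of_tiles hc) (p' := (x + 1, y - 1, Z))
        (ih _ (by omega) (by omega) (by omega) (by omega) (by omega) (by omega) rfl)
    · have hSW : (x + 1, y - 1, Z) ∉ T := by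
        rcases hxX.eq_or_lt with rfl | hlt
        · exact h.west _ (by omega) (by have := hX rfl; omega)
        · obtain rfl : X = x + 1 := by omega
          exact h.gap _ (by omega) (by omega)
      have hS := h.mem x (y - 1) (by unfold InPar; omega)
      exact .move (d := S) (q' := .back false) (by simp [transition, hS, hSW])
        (isConnected_of_tiles hc) (p' := (x, y - 1, Z))
        (ih _ (by omega) hx hxX (by omega) (by omega) (by omega) rfl)

/-- The traversal of a column from north to south. -/
theorem ends_par_column (hc : Conn (T : Set Node)) {v : Node} (htop : (x, tp, Z) ∈ T)
    (hnorth : (x, tp + 1, Z) ∉ T) (hy : y ≤ tp) (hseen : Seen T first x Z y tp)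
    (hclimb : ∀ y' p, y' ≤ tp → (∀ y'', y' ≤ y'' → y'' ≤ tp → (x, y'', Z) ∈ T) → p ∈ T →
      fcc.Adj (x, y', Z) p → (p.2.2 = Z + 1 ∨ first = true ∧ p = (x + 1, y' - 1, Z)) →
      Climbs T v p)
    (hplace : ∀ y' w, y' ≤ tp → (∀ y'', y' ≤ y'' → y'' ≤ tp → (x, y'', Z) ∈ T) → w ∉ T →
      (w = (x - 1, y', Z) ∧ (x - 1, y' + 1, Z) ∈ T ∨
        w = (x - 1, y' + 1, Z) ∧ (x - 1, y', Z) ∈ T ∧ y' < tp) →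
      Conn ((insert w T : Finset Node) : Set Node) →
      Ends T (Outcome T v) ⟨insert w T, (x, y', Z), false, .back first⟩)
    (hbot : ∀ b, b ≤ tp → Seen T first x Z (b - 1) tp → (x, b - 1, Z) ∉ T →
      Ends T (Outcome T v) ⟨T, (x, b - 1, Z), true, .par first⟩)
    (hq : transition q (lookAt T (x, y, Z)) = parStep first (lookAt T (x, y, Z)))
    (hq' : y = tp ∨ q = .par first) : Ends T (Outcome T v) ⟨T, (x, y, Z), true, q⟩ := by
  obtain ⟨M, hM⟩ := exists_bound T
  induction hn : (y + M + 1).toNat using Nat.strong_induction_on generalizing y q with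
  | _ n ih =>
    by_cases hm : (x, y, Z) ∈ T
    swap
    · have hlt : y < tp := by
        rcases hy.eq_or_lt with rfl | h
        · exact absurd htop hm
        · exact h
      obtain rfl : q = .par first := hq'.resolve_left hlt.ne
      have := hbot (y + 1) (by omega) (by rwa [add_sub_cancel_right])
        (by rwa [add_sub_cancel_right])
      rwa [add_sub_cancel_right] at this
    have hcol : ∀ y'', y ≤ y'' → y'' ≤ tp → (x, y'', Z) ∈ T := by
      intro y'' h1 h2
      rcases h1.eq_or_lt with rfl | h1
      · exact hm
      · exact hseen.mem _ h1 h2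
    have hclimb' := fun p => hclimb y p hy hcol
    by_cases h1 : (x + 1, y - 1, Z + 1) ∈ T
    · exact .move (d := UW) (q' := .search) (by rw [hq]; simp [parStep, hm, h1])
        (isConnected_of_tiles hc) (p' := (x + 1, y - 1, Z + 1))
        (.of_climbs (hclimb' _ h1 (adj_of UW) (.inl rfl)) h1 hc) (hq := fun _ => rfl)
    by_cases h2 : (x, y - 1, Z + 1) ∈ T
    · exact .move (d := USE) (q' := .search) (by rw [hq]; simp [parStep, hm, h1, h2])
        (isConnected_of_tiles hc) (p' := (x, y - 1, Z + 1))
        (.of_climbs (hclimb' _ h2 (adj_of USE) (.inl rfl)) h2 hc) (hq := fun _ => rfl)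
    by_cases h3 : (x, y, Z + 1) ∈ T
    · exact .move (d := UNE) (q' := .search) (by rw [hq]; simp [parStep, hm, h1, h2, h3])
        (isConnected_of_tiles hc) (p' := (x, y, Z + 1))
        (.of_climbs (hclimb' _ h3 (adj_of UNE) (.inl rfl)) h3 hc) (hq := fun _ => rfl)
    by_cases h4 : first = true ∧ (x + 1, y - 1, Z) ∈ T
    · exact .move (d := SW) (q' := .search) (by rw [hq]; simp [parStep, hm, h1, h2, h3, h4])
        (isConnected_of_tiles hc) (p' := (x + 1, y - 1, Z))
        (.of_climbs (hclimb' _ h4.2 (adj_of SW) (.inr ⟨h4.1, rfl⟩)) h4.2 hc)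
        (hq := fun _ => rfl)
    have ht : parStep first (lookAt T (x, y, Z)) =
        if (x - 1, y + 1, Z) ∈ T ∧ (x - 1, y, Z) ∉ T then (move SE, .parSEPlace first)
        else if (x, y + 1, Z) ∈ T ∧ (x - 1, y, Z) ∈ T ∧ (x - 1, y + 1, Z) ∉ T then
          (move NE, .parNEPlace first)
        else (move S, .par first) := by
      simp only [parStep, here_lookAt, hm, UW_mem, h1, USE_mem, h2, UNE_mem, h3, SW_mem, h4,
        NE_mem, SE_mem, N_mem, decide_true, if_true, if_false]
    rw [ht] at hq
    by_cases h5 : (x - 1, y + 1, Z) ∈ T ∧ (x - 1, y, Z) ∉ T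
    · rw [if_pos h5] at hq
      have hins := conn_insert (w := (x - 1, y, Z)) hc hm (adj_of SE)
      refine .move hq (isConnected_of_tiles hc) (p' := (x - 1, y, Z)) ?_ (hq := fun _ => rfl)
      refine .place (q' := .parSEReturn first) rfl h5.2 (by rwa [← Finset.coe_insert]) ?_
      refine .move (d := NW) (q' := .back first) rfl (isConnected_of_tiles hins)
        (p' := (x, y, Z)) ?_
      exact hplace y _ hy hcol h5.2 (.inl ⟨rfl, h5.1⟩) hins
    rw [if_neg h5] at hq
    by_cases h6 : (x, y + 1, Z) ∈ T ∧ (x - 1, y, Z) ∈ T ∧ (x - 1, y + 1, Z) ∉ T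
    · rw [if_pos h6] at hq
      have hins := conn_insert (w := (x - 1, y + 1, Z)) hc hm (adj_of NE)
      refine .move hq (isConnected_of_tiles hc) (p' := (x - 1, y + 1, Z)) ?_ (hq := fun _ => rfl)
      refine .place (q' := .parNEReturn first) rfl h6.2.2 (by rwa [← Finset.coe_insert]) ?_
      refine .move (d := SW) (q' := .back first) rfl (isConnected_of_tiles hins)
        (p' := (x, y, Z)) ?_
      refine hplace y _ hy hcol h6.2.2 (.inr ⟨rfl, h6.2.1, hy.lt_of_ne ?_⟩) hins
      rintro rfl
      exact hnorth h6.1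
    rw [if_neg h6] at hq
    have hb := hM _ _ _ hm
    refine .move hq (isConnected_of_tiles hc) (p' := (x, y - 1, Z))
      (ih _ (by omega) (by omega) ?_ rfl (.inr rfl) rfl) (hq := fun _ => rfl)
    refine ⟨?_, ?_, ?_, ?_, ?_, ?_, ?_⟩
    case refine_5 =>
      intro hf y' a1 a2
      obtain rfl | a1 : y' = y ∨ y < y' := by omega
      · tauto
      · exact hseen.sw hf y' a1 a2
    all_goals
      intro y' a1 a2
      obtain rfl | a1 : y' = y ∨ y < y' := by omega
    · exact hm
    · exact hseen.mem y' a1 a2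
    · exact h3
    · exact hseen.une y' a1 a2
    · exact h1
    · exact hseen.uw y' a1 a2
    · exact h2
    · exact hseen.use y' a1 a2
    · tauto
    · exact hseen.ne_se y' a1 a2
    · have := hcol (y' + 1) (by omega) (by omega)
      tauto
    · exact hseen.se_ne y' a1 a2

/-- Without a tile at the foot of the next column, there is none beside the seen nodes. -/
theorem Seen.not_east (h : Seen T first x Z (b - 1) tp) (hb : (x - 1, b, Z) ∉ T) {y : ℤ}
    (h1 : b ≤ y) (h2 : y ≤ tp + 1) : (x - 1, y, Z) ∉ T := by
  induction hn : (y - b).toNat generalizing y with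
  | zero =>
    obtain rfl : y = b := by omega
    exact hb
  | succ n ih =>
    intro h3
    refine ih (y := y - 1) (by omega) (by omega) (by omega) (h.ne_se _ (by omega) (by omega) ?_)
    rwa [sub_add_cancel]

/-- With a tile at the foot of the next column, all nodes beside the seen ones are tiled. -/
theorem Seen.east (h : Seen T first x Z (b - 1) tp) (hb : (x - 1, b, Z) ∈ T) {y : ℤ}
    (h1 : b ≤ y) (h2 : y ≤ tp) : (x - 1, y, Z) ∈ T := by
  induction hn : (y - b).toNat generalizing y with
  | zero =>
    obtain rfl : y = b := by omega
    exact hb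
  | succ n ih =>
    have := h.se_ne (y - 1) (by omega) (by omega) (ih (by omega) (by omega) (by omega))
    rwa [sub_add_cancel] at this

theorem Region.joined (h : Region T xc X b t₀ t Z) (hP : InPar xc X b t₀ t x y) :
    Joined (layer T Z) (X, t₀, Z) (x, y, Z) := by
  have hB : ∀ x y, InPar xc X b t₀ t x y → (x, y, Z) ∈ layer T Z :=
    fun x y h' => ⟨h.mem x y h', rfl⟩
  exact (InPar.joined ⟨h.b_le, .inl ⟨rfl, le_rfl⟩⟩ hB h.xc_le h.b_le h.t₀_le).symm.trans
    (hP.joined hB h.xc_le h.b_le h.t₀_le)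

/-- The region remains valid when a tile is placed outside of it. -/
theorem Region.insert (h : Region T xc X b t₀ t Z) {x y : ℤ}
    (hw : x < xc ∨ x = xc ∧ xc < X ∧ t < y) : Region (insert (x, y, Z) T) xc X b t₀ t Z := by
  have := h.b_le
  have := h.t₀_le
  have := h.xc_le
  refine ⟨h.xc_le, h.b_le, h.t₀_le, fun x' y' h1 => by simp [h.mem x' y' h1], ?_, ?_, ?_, ?_⟩
  · have := h.top
    simp only [Finset.mem_insert, Prod.mk.injEq, this, or_false]
    omega
  · intro y' h1 h2
    have := h.west y' h1 h2
    simp only [Finset.mem_insert, Prod.mk.injEq, this, or_false]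
    omega
  · intro y' h1 h2
    have := h.gap y' h1 h2
    simp only [Finset.mem_insert, Prod.mk.injEq, this, or_false]
    omega
  · intro x' h1 h2
    have := h.bot x' h1 h2
    simp only [Finset.mem_insert, Prod.mk.injEq, this, or_false]
    omega

/-- The neighbours in the plane of a node of the region that are outside of it. -/
theorem InPar.border {x₁ y₁ x₂ y₂ : ℤ} (hx : x ≤ X) (hb : b ≤ t₀) (ht : t₀ ≤ t)
    (h1 : InPar x X b t₀ t x₁ y₁) (h2 : ¬ InPar x X b t₀ t x₂ y₂)
    (hadj : fcc.Adj (x₁, y₁, Z) (x₂, y₂, Z)) :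
    (x₂ = X ∧ y₂ = t₀ + 1) ∨ (x₂ = X + 1 ∧ b - 1 ≤ y₂ ∧ y₂ ≤ t₀) ∨
      (x₂ = X ∧ t₀ < y₂ ∧ y₂ ≤ t) ∨ (x ≤ x₂ ∧ x₂ ≤ X ∧ y₂ = b - 1) ∨
      (x ≤ x₂ ∧ x₂ < X ∧ y₂ = t + 1) ∨
      (x₂ = x - 1 ∧ b ≤ y₂ ∧ (x = X ∧ y₂ ≤ t₀ + 1 ∨ x < X ∧ y₂ ≤ t + 1)) := by
  obtain ⟨d, hd⟩ := hadj
  unfold InPar at h1 h2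
  cases d <;> simp only [Dir.vec, Prod.mk_add_mk, Prod.mk.injEq] at hd <;>
    obtain ⟨rfl, rfl, hz⟩ := hd
  case UNE | UW | USE | DSW | DE | DNW => omega
  all_goals
    clear hz
    rcases eq_or_ne x₁ X with rfl | hX
    · have h3 : b ≤ y₁ ∧ y₁ ≤ t₀ := by omega
      clear h1
      rcases hx.eq_or_lt with rfl | hx <;> omega
    · have h3 : x ≤ x₁ ∧ x₁ < X ∧ b ≤ y₁ ∧ y₁ ≤ t := by omega
      clear h1
      rcases eq_or_ne (x₁ + 1) X with rfl | hX' <;> omega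

/-- At the node south of a column that has been traversed. -/
theorem ParStart.ends_bottom (h : ParStart T X t₀ Z) (hr : Region T x X b t₀ t Z)
    (htp : tp = if x = X then t₀ else t) (hseen : Seen T first x Z (b - 1) tp)
    (hx0 : x = X → t = t₀)
    (hnorth : ∀ x', x ≤ x' → x' < X → (x', t + 1, Z) ∉ T)
    (hplat : ∀ x' y', InPar x X b t₀ t x' y' → x < x' →
      (x', y', Z + 1) ∉ T ∧ (x' + 1, y' - 1, Z + 1) ∉ T ∧ (x', y' - 1, Z + 1) ∉ T)
    (hnext : (x - 1, b, Z) ∈ T → (x - 1, b - 1, Z) ∉ T →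
      Ends T (Outcome T (X, t₀, Z)) ⟨T, (x - 1, b, Z), true, .parEnter⟩) :
    Ends T (Outcome T (X, t₀, Z)) ⟨T, (x, b - 1, Z), true, .par first⟩ := by
  have hc := h.conn
  have hb := hr.b_le
  have h0 := hr.t₀_le
  have hx := hr.xc_le
  have htp' : x = X ∧ tp = t₀ ∨ x < X ∧ tp = t := by
    split_ifs at htp with hxX
    · exact .inl ⟨hxX, htp⟩
    · exact .inr ⟨by omega, htp⟩
  have hq := hr.bot x le_rfl hx
  have hN := hr.mem x b (by unfold InPar; omega)
  by_cases h1 : (x - 1, b, Z) ∈ T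
  · by_cases h2 : (x - 1, b - 1, Z) ∈ T
    · have hins := conn_insert (w := (x, b - 1, Z)) hc hN (adj_of S)
      refine .place (q' := .parBelowReturn) ?_ hq (by rwa [← Finset.coe_insert]) ?_
      · simp [transition, parStep, hq, hN, h1, h2]
      refine .move (d := N) (q' := .backRow) rfl (isConnected_of_tiles hins) (p' := (x, b, Z)) ?_
      refine ends_backRow (xc := x) (X := X) (b := b) (t₀ := t₀) (t := t) hins ?_ h0 ?_ ?_ ?_
        (.inl ⟨rfl, le_rfl, hx⟩) le_rfl hb rfl (by nofun)
      · intro x' y' h3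
        simp [hr.mem x' y' h3]
      · have := hr.top
        simp only [Finset.mem_insert, Prod.mk.injEq, this, or_false]
        omega
      · intro y' h3 h4
        have := hr.west y' h3 h4
        simp only [Finset.mem_insert, Prod.mk.injEq, this, or_false]
        omega
      · intro q' hq' hns
        refine h.ends_pick ⟨hq, ⟨_, h2, by simp only; omega, by simp, adj_of NW⟩, ⟨_, h2, le_rfl⟩,
          ⟨_, h2, le_rfl⟩, ?_, ?_⟩ hq' hns
        · simp only
          omega
        · rcases htp' with ⟨rfl, -⟩ | ⟨hlt, -⟩
          · rcases hb.eq_or_lt with rfl | hb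
            · exact .inr (.inl h1)
            · exact .inl (hr.mem _ _ (by unfold InPar; omega))
          · exact .inr (.inl (hr.mem _ _ (by unfold InPar; omega)))
    · refine .move (d := NE) (q' := .parEnter) ?_ (isConnected_of_tiles hc) (p' := (x - 1, b, Z))
        (hnext h1 h2)
      simp [transition, parStep, hq, h1, h2]
  · refine .move (d := N) (q' := .project) ?_ (isConnected_of_tiles hc) (p' := (x, b, Z)) ?_
    · simp [transition, parStep, hq, h1]
    have hP : ∀ x' y', InPar x X b t₀ t x' y' → x' = x → b - 1 < y' ∧ y' ≤ tp := by
      intro x' y' h2 h3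
      unfold InPar at h2
      omega
    have hpl : ∀ x' y', InPar x X b t₀ t x' y' →
        (x', y', Z + 1) ∉ T ∧ (x' + 1, y' - 1, Z + 1) ∉ T ∧ (x', y' - 1, Z + 1) ∉ T := by
      intro x' y' h2
      by_cases h3 : x' = x
      · obtain ⟨h4, h5⟩ := hP _ _ h2 h3
        subst h3
        exact ⟨hseen.une _ h4 h5, hseen.uw _ h4 h5, hseen.use _ h4 h5⟩
      · exact hplat _ _ h2 (by unfold InPar at h2; omega)
    have hpt : Plat T x X b t₀ t Z := by
      refine ⟨hc, hx, hb, h0, hx0, hr.mem, ?_, fun x' y' h2 => (hpl x' y' h2).1,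
        fun x' y' h2 => (hpl x' y' h2).2.1, fun x' y' h2 => (hpl x' y' h2).2.2⟩
      -- every node next to the region and outside of it has been seen to be empty
      intro x₁ y₁ x₂ y₂ h2 h3 hadj
      by_contra hout
      have hno : ∀ x' y', (x', y', Z) ∉ T → ¬ (x₂ = x' ∧ y₂ = y') := by
        rintro x' y' h4 ⟨rfl, rfl⟩
        exact h4 h3
      have c1 : ¬ (x₂ = X ∧ y₂ = t₀ + 1) := hno _ _ hr.top
      have c2 : ¬ (x₂ = X + 1 ∧ b - 1 ≤ y₂ ∧ y₂ ≤ t₀) := by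
        rintro ⟨rfl, h4, h5⟩
        exact hr.west _ h4 h5 h3
      have c3 : ¬ (x₂ = X ∧ t₀ < y₂ ∧ y₂ ≤ t) := by
        rintro ⟨rfl, h4, h5⟩
        exact hr.gap _ h4 h5 h3
      have c4 : ¬ (x ≤ x₂ ∧ x₂ ≤ X ∧ y₂ = b - 1) := by
        rintro ⟨h4, h5, rfl⟩
        exact hr.bot _ h4 h5 h3
      have c5 : ¬ (x ≤ x₂ ∧ x₂ < X ∧ y₂ = t + 1) := by
        rintro ⟨h4, h5, rfl⟩
        exact hnorth _ h4 h5 h3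
      have c6 : ¬ (x₂ = x - 1 ∧ b ≤ y₂ ∧ y₂ ≤ tp + 1) := by
        rintro ⟨rfl, h4, h5⟩
        exact hseen.not_east h1 h4 h5 h3
      rcases InPar.border hx hb h0 h2 hout hadj with h4 | h4 | h4 | h4 | h4 | h4
      · exact c1 h4
      · exact c2 h4
      · exact c3 h4
      · exact c4 h4
      · exact c5 h4
      · exact c6 (by omega)
    refine hpt.ends_project ?_
    rw [hpt.mem_par]
    exact ⟨rfl, hb, .inl ⟨rfl, le_rfl⟩⟩

/-- A tile is placed next to, or on top of, a column that is not the first one. -/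
theorem ParStart.ends_back_false (h : ParStart T X t₀ Z) (hr : Region T xc X b t₀ t Z)
    (hx : xc < X) (hby : b ≤ y) (hyt : y ≤ t + 1) {x' y' : ℤ}
    (hw : x' < xc ∨ x' = xc ∧ xc < X ∧ t < y') (hspot : (x', y', Z) ∉ T)
    (ha : ∃ a ∈ T, a.1 < X ∧ a.1 ≤ x' ∧ fcc.Adj a (x', y', Z))
    (hge : ∃ a ∈ T, a.2.1 ≤ y') (hle : ∃ a ∈ T, y' ≤ a.2.1)
    (hc : Conn ((insert (x', y', Z) T : Finset Node) : Set Node)) :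
    Ends T (Outcome T (X, t₀, Z)) ⟨insert (x', y', Z) T, (xc, y, Z), false, .back false⟩ := by
  refine (hr.insert hw).ends_back_false hc (fun q hq hns => h.ends_pick
    ⟨hspot, ha, hge, hle, ?_, .inr (.inl (hr.mem _ _ ?_))⟩ hq hns) le_rfl hx.le hby hyt (by omega)
  · simp only
    omega
  · have := hr.b_le
    have := hr.t₀_le
    unfold InPar
    omega

/-- The traversal from the column at `x < X` on. -/
theorem ParStart.ends_rest (h : ParStart T X t₀ Z) (hr : Region T x X b t₀ t Z) (hx : x < X)
    (hnorth : ∀ x', x ≤ x' → x' < X → (x', t + 1, Z) ∉ T) (hne : (x - 1, t + 1, Z) ∉ T)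
    (hplat : ∀ x' y', InPar x X b t₀ t x' y' → x < x' →
      (x', y', Z + 1) ∉ T ∧ (x' + 1, y' - 1, Z + 1) ∉ T ∧ (x', y' - 1, Z + 1) ∉ T) :
    Ends T (Outcome T (X, t₀, Z)) ⟨T, (x, t, Z), true, .par false⟩ := by
  obtain ⟨M, hM⟩ := exists_bound T
  have hc := h.conn
  have hb := hr.b_le
  have h0 := hr.t₀_le
  induction hn : (x + M).toNat using Nat.strong_induction_on generalizing x with
  | _ n ih =>
    have hbt : b ≤ t := by omega
    have htop := hr.mem x t (by unfold InPar; omega)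
    have hbot := hr.bot x le_rfl hx.le
    have hlow : ∀ y', (∀ y'', y' ≤ y'' → y'' ≤ t → (x, y'', Z) ∈ T) → b ≤ y' := by
      intro y' h1
      by_contra! h2
      exact hbot (h1 _ (by omega) (by omega))
    refine ends_par_column (tp := t) hc htop (hnorth x le_rfl hx) le_rfl ?_ ?_ ?_ ?_ rfl
      (.inl rfl)
    · constructor <;> intros <;> omega
    · intro y' p h1 h2 _ hadj hp
      have hb' := hlow y' h2
      refine ⟨.inl ?_, _, hr.joined (x := x) (y := y') (by unfold InPar; omega), hadj⟩
      simp only [Bool.false_eq_true, false_and, or_false] at hp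
      rw [hp]
      simp
    · rintro y' w h1 h2 hw (⟨rfl, h3⟩ | ⟨rfl, h3, h4⟩) hc'
      · have hb' := hlow y' h2
        exact h.ends_back_false hr hx hb' (by omega) (by omega) hw
          ⟨_, h3, by simp only; omega, le_rfl, adj_of S⟩ ⟨_, h2 y' le_rfl h1, le_rfl⟩
          ⟨_, h3, by simp⟩ hc'
      · have hb' := hlow y' h2
        exact h.ends_back_false hr hx hb' (by omega) (by omega) hw
          ⟨_, h3, by simp only; omega, le_rfl, adj_of N⟩ ⟨_, h3, by simp⟩
          ⟨_, h2 (y' + 1) (by omega) (by omega), le_rfl⟩ hc'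
    · intro b' hb't hseen hb'
      obtain rfl : b' = b := by
        by_contra hne'
        rcases lt_or_gt_of_ne hne' with h1 | h1
        · exact hbot (hseen.mem _ (by omega) (by omega))
        · exact hb' (hr.mem _ _ (by unfold InPar; omega))
      refine h.ends_bottom hr (by rw [if_neg hx.ne]) hseen (by omega) hnorth hplat fun h1 h2 => ?_
      have heast : ∀ y', b' ≤ y' → y' ≤ t → (x - 1, y', Z) ∈ T := fun y' h3 h4 =>
        hseen.east h1 h3 h4
      have hr' : Region T (x - 1) X b' t₀ t Z := by
        refine ⟨by omega, hb, h0, ?_, hr.top, hr.west, hr.gap, ?_⟩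
        · intro x' y' h3
          by_cases h4 : x' = x - 1
          · subst h4
            exact heast y' h3.1 (by unfold InPar at h3; omega)
          · exact hr.mem _ _ (by unfold InPar at *; omega)
        · intro x' h3 h4
          by_cases h5 : x' = x - 1
          · subst h5
            exact h2
          · exact hr.bot _ (by omega) h4
      refine .move (d := N) (q' := .parNorth) rfl (isConnected_of_tiles hc)
        (p' := (x - 1, b' + 1, Z)) ?_
      -- the agent goes `N` to the node above the column
      have hup : ∀ y', b' + 1 ≤ y' → y' ≤ t + 1 →
          Ends T (Outcome T (X, t₀, Z)) ⟨T, (x - 1, y', Z), true, .parNorth⟩ := by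
        intro y' h3 h4
        induction hm : (t + 1 - y').toNat generalizing y' with
        | zero =>
          obtain rfl : y' = t + 1 := by omega
          have hS := heast t hbt le_rfl
          by_cases h5 : (x - 1 - 1, t + 1, Z) ∈ T
          · have hins := conn_insert (w := (x - 1, t + 1, Z)) hc hS (adj_of N)
            refine .place (q' := .back false) (by simp [transition, hne, hS, h5]) hne
              (by rwa [← Finset.coe_insert]) ?_
            exact h.ends_back_false hr' (by omega) (by omega) le_rfl (by omega) hne
              ⟨_, h5, by simp only; omega, by simp, adj_of NW⟩ ⟨_, h5, le_rfl⟩ ⟨_, h5, le_rfl⟩ hins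
          · refine .move (d := S) (q' := .par false) (by simp [transition, hne, h5])
              (isConnected_of_tiles hc) (p' := (x - 1, t, Z)) ?_
            have hx1 := hM _ _ _ hS
            refine ih _ (by omega) hr' (by omega) ?_ h5 ?_ rfl
            · intro x' h6 h7
              by_cases h8 : x' = x - 1
              · subst h8
                exact hne
              · exact hnorth _ (by omega) h7
            · intro x' y' h6 h7
              by_cases h8 : x' = x
              · subst h8
                have h9 : b' - 1 < y' ∧ y' ≤ t := by unfold InPar at h6; omega
                exact ⟨hseen.une _ h9.1 h9.2, hseen.uw _ h9.1 h9.2, hseen.use _ h9.1 h9.2⟩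
              · exact hplat _ _ (by unfold InPar at *; omega) (by omega)
        | succ m ihm =>
          have h5 := heast y' (by omega) (by omega)
          have h6 := hr.mem x (y' - 1) (by unfold InPar; omega)
          refine .move (d := N) (q' := .parNorth) ?_ (isConnected_of_tiles hc)
            (p' := (x - 1, y' + 1, Z)) (ihm _ (by omega) (by omega) (by omega))
          simp [transition, h5, h6]
      exact hup _ le_rfl (by omega)

/-- A second column whose western side has a tile above the end of the first column: the agent moves
on to that tile, or to a higher one. -/
theorem ends_found (hc : Conn (T : Set Node)) {yf : ℤ} (hf : t₀ + 1 < yf)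
    (hNW : (X, yf, Z) ∈ T) (hb : b ≤ t₀)
    (hmem : ∀ y', b ≤ y' → y' ≤ yf → (X - 1, y', Z) ∈ T) (hv : (X, t₀, Z) ∈ T)
    (hq : transition q (lookAt T (X - 1, yf, Z)) = foundUpStep (lookAt T (X - 1, yf, Z)))
    (hns : q ≠ .search) :
    Ends T₀ (Outcome T (X, t₀, Z)) ⟨T, (X - 1, yf, Z), true, q⟩ := by
  obtain ⟨M, hM⟩ := exists_bound T
  have hj : ∀ y', t₀ ≤ y' → (∀ y'', b ≤ y'' → y'' ≤ y' → (X - 1, y'', Z) ∈ T) →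
      Joined (layer T Z) (X, t₀, Z) (X - 1, y', Z) := by
    intro y' h1 h2
    refine Joined.trans (v := (X - 1, t₀, Z)) (.of_adj ⟨hv, rfl⟩ ⟨h2 _ hb h1, rfl⟩ (adj_of SE))
      (joined_column h1 fun y'' h3 h4 => ⟨h2 _ (by omega) h4, rfl⟩)
  have hdown : ∀ y' q, yf ≤ y' → (∀ y'', b ≤ y'' → y'' ≤ y' → (X - 1, y'', Z) ∈ T) →
      transition q (lookAt T (X - 1, y', Z)) = foundDownStep (lookAt T (X - 1, y', Z)) →
      q ≠ .search → Ends T₀ (Outcome T (X, t₀, Z)) ⟨T, (X - 1, y', Z), true, q⟩ := by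
    intro y' q h1 h2 hq hns
    induction hn : (y' - yf).toNat using Nat.strong_induction_on generalizing y' q with
    | _ n ih =>
      by_cases h3 : (X, y', Z) ∈ T
      · refine Ends.searchStep (fun h => absurd h hns) hc ?_ ?_ ?_
        · rw [hq]
          simp [foundDownStep, h3]
        · simp [SearchDone, h3]
        · intro p _ hp hadj
          refine ⟨?_, _, hj y' (by omega) h2, hadj⟩
          rcases hp with rfl | rfl | rfl | rfl | rfl | hp
          · exact .inl (by simp)
          · exact .inl (by simp)
          · exact .inl (by simp)
          · exact .inr ⟨rfl, .inr ⟨by simp, by simp only; omega⟩⟩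
          · exact .inr ⟨rfl, .inr ⟨by simp, by simp only; omega⟩⟩
          · exact absurd h3 (by simpa using hp.2.2.2.1)
      · have hlt : yf < y' := by
          rcases h1.eq_or_lt with rfl | h1
          · exact absurd hNW h3
          · exact h1
        exact .move (d := S) (q' := .parFoundDown) (by rw [hq]; simp [foundDownStep, h3])
          (isConnected_of_tiles hc) (p' := (X - 1, y' - 1, Z))
          (ih _ (by omega) (y' - 1) .parFoundDown (by omega) (fun y'' h4 h5 => h2 _ h4 (by omega))
            rfl (by nofun) rfl) (hq := fun h => absurd h hns)
  have hup : ∀ y' q, yf ≤ y' → (∀ y'', b ≤ y'' → y'' ≤ y' → (X - 1, y'', Z) ∈ T) →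
      transition q (lookAt T (X - 1, y', Z)) = foundUpStep (lookAt T (X - 1, y', Z)) →
      q ≠ .search → Ends T₀ (Outcome T (X, t₀, Z)) ⟨T, (X - 1, y', Z), true, q⟩ := by
    intro y' q h1 h2 hq hns
    induction hn : (M - y').toNat using Nat.strong_induction_on generalizing y' q with
    | _ n ih =>
      by_cases h3 : (X - 1, y' + 1, Z) ∈ T
      · have h4 := hM _ _ _ h3
        refine .move (d := N) (q' := .parFoundUp) (by rw [hq]; simp [foundUpStep, h3])
          (isConnected_of_tiles hc) (p' := (X - 1, y' + 1, Z))
          (ih _ (by omega) (y' + 1) .parFoundUp (by omega) (fun y'' h5 h6 => ?_)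
            rfl (by nofun) rfl) (hq := fun h => absurd h hns)
        obtain rfl | h6 : y'' = y' + 1 ∨ y'' ≤ y' := by omega
        · exact h3
        · exact h2 _ h5 h6
      · refine hdown y' q h1 h2 ?_ hns
        rw [hq]
        simp [foundUpStep, h3]
  exact hup yf q le_rfl hmem hq hns

/-- `BuildPar`. -/
theorem ParStart.ends_par (h : ParStart T X t₀ Z)
    (hq : transition q (lookAt T (X, t₀, Z)) = parStep true (lookAt T (X, t₀, Z))) :
    Ends T (Outcome T (X, t₀, Z)) ⟨T, (X, t₀, Z), true, q⟩ := by
  have hc := h.conn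
  obtain ⟨M, hM⟩ := exists_bound T
  refine ends_par_column (tp := t₀) hc h.mem h.n le_rfl ?_ ?_ ?_ ?_ hq (.inl rfl)
  · constructor <;> intros <;> omega
  · intro y' p h1 h2 _ hadj hp
    have hj : Joined (layer T Z) (X, y', Z) (X, t₀, Z) :=
      joined_column h1 fun y'' h3 h4 => ⟨h2 _ h3 h4, rfl⟩
    refine ⟨?_, _, hj.symm, hadj⟩
    rcases hp with hp | ⟨-, rfl⟩
    · refine .inl ?_
      rw [hp]
      simp
    · exact .inr ⟨rfl, .inl (by simp)⟩
  · intro y' w h1 h2 hw hw' hc'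
    have hv : ∀ hlt : y' < t₀, (X, t₀ - 1, Z) ∈ T := fun hlt => h2 _ (by omega) (by omega)
    refine ends_back_true hc' h1 ?_ ?_ fun q hq hns => h.ends_pick ?_ hq hns
    · intro y'' h3 h4
      simp [h2 _ h3 h4]
    · have := h.n
      rcases hw' with ⟨rfl, -⟩ | ⟨rfl, -⟩ <;>
        simp only [Finset.mem_insert, Prod.mk.injEq, this, or_false] <;> omega
    · rcases hw' with ⟨rfl, h3⟩ | ⟨rfl, h3, h4⟩
      · refine ⟨hw, ⟨_, h3, by simp, le_rfl, adj_of S⟩, ⟨_, h2 y' le_rfl h1, le_rfl⟩,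
          ⟨_, h3, by simp⟩, .inl (by simp), ?_⟩
        rcases h1.eq_or_lt with rfl | h1
        · exact .inr (.inr h3)
        · exact .inl (hv h1)
      · exact ⟨hw, ⟨_, h3, by simp, le_rfl, adj_of N⟩, ⟨_, h3, by simp⟩,
          ⟨_, h2 (y' + 1) (by omega) (by omega), le_rfl⟩, .inl (by simp), .inl (hv h4)⟩
  · intro b hb hseen hbot
    have hin : ∀ x' y', InPar X X b t₀ t₀ x' y' → x' = X ∧ b - 1 < y' ∧ y' ≤ t₀ := by
      intro x' y' h1
      unfold InPar at h1
      omega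
    have hwest : ∀ y', b - 1 ≤ y' → y' ≤ t₀ → (X + 1, y', Z) ∉ T := by
      intro y' h1 h2
      rcases h2.eq_or_lt with rfl | h2
      · exact h.nw
      · have := hseen.sw rfl (y' + 1) (by omega) (by omega)
        rwa [add_sub_cancel_right] at this
    have hr : Region T X X b t₀ t₀ Z := by
      refine ⟨le_rfl, hb, le_rfl, ?_, h.n, hwest, by intros; omega, ?_⟩
      · intro x' y' h1
        obtain ⟨rfl, h1, h2⟩ := hin _ _ h1
        exact hseen.mem _ h1 h2
      · intro x' h1 h2
        obtain rfl : x' = X := by omega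
        exact hbot
    refine h.ends_bottom hr (by rw [if_pos rfl]) hseen (fun _ => rfl) (by intros; omega) ?_
      fun h1 h2 => ?_
    · intro x' y' h1 h2
      have := hin _ _ h1
      omega
    have heast : ∀ y', b ≤ y' → y' ≤ t₀ → (X - 1, y', Z) ∈ T := fun y' h3 h4 =>
      hseen.east h1 h3 h4
    refine .move (d := N) (q' := .parNorth) rfl (isConnected_of_tiles hc)
      (p' := (X - 1, b + 1, Z)) ?_
    have hup : ∀ y', b + 1 ≤ y' → (∀ y'', b ≤ y'' → y'' < y' → (X - 1, y'', Z) ∈ T) →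
        (∀ y'', t₀ < y'' → y'' < y' → (X, y'', Z) ∉ T) →
        Ends T (Outcome T (X, t₀, Z)) ⟨T, (X - 1, y', Z), true, .parNorth⟩ := by
      intro y' h3 h4 h5
      induction hm : (M + 1 - y').toNat using Nat.strong_induction_on generalizing y' with
      | _ m ih =>
        by_cases h6 : (X - 1, y', Z) ∈ T
        · have h7 := hM _ _ _ (h4 (y' - 1) (by omega) (by omega))
          have h8 := hM _ _ _ h6
          have h4' : ∀ y'', b ≤ y'' → y'' < y' + 1 → (X - 1, y'', Z) ∈ T := by
            intro y'' h9 h10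
            obtain rfl | h10 : y'' = y' ∨ y'' < y' := by omega
            · exact h6
            · exact h4 _ h9 h10
          by_cases h9 : (X, y' - 1, Z) ∉ T ∧ (X, y', Z) ∈ T
          · have hlt : t₀ + 1 < y' := by
              by_contra! hle
              exact h9.1 (hseen.mem _ (by omega) (by omega))
            refine ends_found hc hlt h9.2 hb (fun y'' h10 h11 => h4' _ h10 (by omega)) h.mem ?_
              (by nofun)
            simp [transition, h6, h9]
          · refine .move (d := N) (q' := .parNorth) ?_ (isConnected_of_tiles hc)
              (p' := (X - 1, y' + 1, Z)) (ih _ (by omega) _ (by omega) h4' ?_ rfl)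
            · simp only [transition, here_lookAt, h6, SW_mem, NW_mem, sub_add_cancel, h9,
                decide_true, if_true, if_false]
            · intro y'' h10 h11
              obtain rfl | h11 : y'' = y' ∨ y'' < y' := by omega
              · obtain rfl | h12 : y'' = t₀ + 1 ∨ t₀ + 1 < y'' := by omega
                · exact h.n
                · have := h5 (y'' - 1) (by omega) (by omega)
                  tauto
              · exact h5 _ h10 h11
        · have hlt : t₀ < y' := by
            by_contra! hle
            exact h6 (heast _ (by omega) hle)
          have hr' : Region T (X - 1) X b t₀ (y' - 1) Z := by
            refine ⟨by omega, hb, by omega, ?_, hr.top, hr.west,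
              fun y'' h7 h8 => h5 _ h7 (by omega), ?_⟩
            · intro x' y'' h7
              by_cases h8 : x' = X
              · subst h8
                exact hseen.mem _ (by unfold InPar at h7; omega) (by unfold InPar at h7; omega)
              · obtain rfl : x' = X - 1 := by unfold InPar at h7; omega
                exact h4 _ h7.1 (by unfold InPar at h7; omega)
            · intro x' h7 h8
              obtain rfl | rfl : x' = X ∨ x' = X - 1 := by omega
              · exact hbot
              · exact h2
          have hS := h4 (y' - 1) (by omega) (by omega)
          by_cases h7 : (X - 1 - 1, y', Z) ∈ T
          · have hins := conn_insert (w := (X - 1, y', Z)) hc hS (adj_of N)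
            refine .place (q' := .back false) (by simp [transition, h6, hS, h7]) h6
              (by rwa [← Finset.coe_insert]) ?_
            exact h.ends_back_false hr' (by omega) (by omega) (by omega) (by omega) h6
              ⟨_, h7, by simp only; omega, by simp, adj_of NW⟩ ⟨_, h7, le_rfl⟩ ⟨_, h7, le_rfl⟩ hins
          · refine .move (d := S) (q' := .par false) (by simp [transition, h6, h7])
              (isConnected_of_tiles hc) (p' := (X - 1, y' - 1, Z)) ?_
            refine h.ends_rest hr' (by omega) ?_ (by rwa [sub_add_cancel]) ?_
            · intro x' h8 h9
              obtain rfl : x' = X - 1 := by omega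
              rwa [sub_add_cancel]
            · intro x' y'' h8 h9
              have h10 : x' = X ∧ b - 1 < y'' ∧ y'' ≤ t₀ := by unfold InPar at h8; omega
              obtain ⟨rfl, h10, h11⟩ := h10
              exact ⟨hseen.une _ h10 h11, hseen.uw _ h10 h11, hseen.use _ h10 h11⟩
    exact hup _ le_rfl (fun y'' h3 h4 => heast _ h3 (by omega)) (by intros; omega)

end

/-! ### The phases of an execution -/

section

variable {T : Finset Node}

theorem inBox_extremes (h : T.Nonempty) : InBox (xMin T) (yMin T) (yMax T) T := by
  have h1 : ((fun v : Node => v.1) '' (T : Set Node)).Finite := T.finite_toSet.image _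
  have h2 : ((fun v : Node => v.2.1) '' (T : Set Node)).Finite := T.finite_toSet.image _
  have h3 : ((fun v : Node => v.1) '' (T : Set Node)).Nonempty := h.to_set.image _
  refine ⟨fun v hv => ⟨csInf_le h1.bddBelow ⟨v, hv, rfl⟩, csInf_le h2.bddBelow ⟨v, hv, rfl⟩,
    le_csSup h2.bddAbove ⟨v, hv, rfl⟩⟩, ?_⟩
  obtain ⟨v, hv, h4⟩ := Int.csInf_mem h3 h1.bddBelow
  exact ⟨v, hv, h4⟩

theorem lexLt_irrefl (v : Node) : ¬ LexLt v v := by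
  rintro (h | ⟨-, h | ⟨-, h⟩⟩) <;> exact lt_irrefl _ h

theorem LexLt.trans {u v w : Node} (h : LexLt u v) (h' : LexLt v w) : LexLt u w := by
  unfold LexLt at *
  omega

/-- The configuration in which a phase starts is not a possible result of the phase. -/
theorem not_outcome_self {C : Config} : ¬ Outcome C.tiles C.pos C := by
  rintro ⟨hC, ⟨-, -, h, -⟩ | h | ⟨-, P, hv, hP, -, -, -, u, hu, hpu⟩⟩
  · exact lexLt_irrefl _ h
  · exact lt_irrefl _ (h _ _ _ (inBox_extremes ⟨_, hC.pos_mem⟩)).2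
  · have h1 := hP.level _ hv _ hu
    rw [hpu] at h1
    simp [Dir.vec] at h1

/-- A phase, by cases according to what the agent observes at its beginning. -/
theorem AtSearch.ends {C : Config} (hC : AtSearch C) :
    Ends C.tiles (Outcome C.tiles C.pos) C := by
  obtain ⟨T, ⟨x, y, z⟩, b, q⟩ := C
  obtain ⟨hp, hb, hc, hq⟩ := hC
  change b = true at hb
  subst hb
  change transition q (lookAt T (x, y, z)) = searchStep (lookAt T (x, y, z)) at hq
  change (x, y, z) ∈ T at hp
  change Conn (T : Set Node) at hc
  change Ends T (Outcome T (x, y, z)) _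
  by_cases hs : SearchDone (lookAt T (x, y, z))
  swap
  · refine .searchStep (fun _ => rfl) hc hq hs fun p _ hp hadj => ⟨?_, _, .refl _ _, hadj⟩
    rcases hp with rfl | rfl | rfl | rfl | rfl | ⟨rfl, -⟩ <;> simp [LexLt]
  obtain ⟨h1, h2, h3, h4, h5, h6⟩ := hs
  have hd : transition q (lookAt T (x, y, z)) = decideStep (lookAt T (x, y, z)) := by
    rw [hq, searchStep, if_neg h1, if_neg h2, if_neg h3, if_neg h4, if_neg h5, if_neg h6]
  simp only [UW_mem, USE_mem, UNE_mem, NW_mem, SW_mem, N_mem] at h1 h2 h3 h4 h5 h6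
  have ht : Top T x y z := ⟨hc, hp, h1, h2, h3, h4, h5, h6⟩
  have hne : ∀ d ∈ (lookAt T (x, y, z)).nbr, (x, y, z) + d.vec ∈ (T.erase (x, y, z) : Set Node) :=
    fun d hd => by simp [mem_nbr.1 hd, d.vec_ne_zero]
  rw [decideStep] at hd
  by_cases hr : Removable (lookAt T (x, y, z)).nbr
  · rw [if_pos hr] at hd
    refine ParStart.ends_par ⟨ht, fun d e hd he => ?_⟩ hd
    exact LocallyConnected.joined hr (by simpa using hne) (mem_nbr.2 hd) (mem_nbr.2 he)
  rw [if_neg hr] at hd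
  by_cases hse : IsBridge (lookAt T (x, y, z)).nbr SE
  · rw [if_pos hse] at hd
    exact ends_shift_SE ht hd hse
  rw [if_neg hse] at hd
  by_cases hde : IsBridge (lookAt T (x, y, z)).nbr DE ∧ ¬ (lookAt T (x, y, z)).nbr ⊆ {DSW, SE}
  · rw [if_pos hde] at hd
    exact ends_shift_DE ht hd hde.1 hde.2
  rw [if_neg hde] at hd
  have hcases := eq_of_not_bridge ht.nbr_subset hr hse hde
  by_cases hlow : (lookAt T (x, y, z)).nbr = {DSW, SE}
  · rw [if_pos hlow] at hd
    refine ends_shift_low ht hd hlow fun hw => ParStart.ends_par ⟨ht, fun d e hd he => ?_⟩ rfl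
    -- the tile at `SE + DSW` joins the two neighbours
    have hj : ∀ d : Dir, (x, y, z) + d.vec ∈ T →
        Joined (T.erase (x, y, z) : Finset Node) ((x, y, z) + d.vec) (x - 1, y, z - 1) := by
      intro d hd
      rw [← mem_nbr] at hd
      have hd' := hne d hd
      rw [hlow] at hd
      have hw' : (x - 1, y, z - 1) ∈ ((T.erase (x, y, z) : Finset Node) : Set Node) := by simp [hw]
      refine .of_adj (by simpa using hd') hw' ?_
      rcases (by simpa using hd : d = DSW ∨ d = SE) with rfl | rfl
      · exact ⟨SE, by simp [Dir.vec]; omega⟩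
      · exact ⟨DSW, by simp [Dir.vec]; omega⟩
    exact (hj d hd).trans (hj e he).symm
  rw [if_neg hlow] at hd
  by_cases hne : (lookAt T (x, y, z)).nbr = {DNW, S, NE}
  · rw [if_pos hne] at hd
    exact ht.ends_column (last := false) hne hd
      fun y' q hw hns hS huw huse hsw hse hq => hw.ends_project hns hS huw huse hsw hse hq
  rw [if_neg hne] at hd
  have hlast := (hcases.resolve_left hlow).resolve_left hne
  rw [if_pos hlast] at hd
  exact ht.ends_column (last := true) (by rw [hlast]; rfl) hd
    fun y' q hw hns hS huw huse hsw hse hq => hw.ends_project hns hS huw huse hsw hse hq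

/-- Every phase takes at least one step, and ends with one of the three results. -/
theorem AtSearch.exists_iterate {C : Config} (hC : AtSearch C) :
    ∃ n : ℕ, 0 < n ∧ Outcome C.tiles C.pos (Config.step^[n] C) ∧
      ∀ i < n, Good C.tiles (Config.step^[i] C) := by
  obtain ⟨n, hn, hi⟩ := hC.ends.exists_iterate
  refine ⟨n, Nat.pos_of_ne_zero ?_, hn, hi⟩
  rintro rfl
  exact not_outcome_self hn

open Classical in
theorem card_lexLt_lt {u v : Node} (hv : v ∈ T) (h : LexLt u v) :
    (T.filter fun w => LexLt v w).card < (T.filter fun w => LexLt u w).card := by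
  refine Finset.card_lt_card ((Finset.ssubset_iff_of_subset fun w hw => ?_).2
    ⟨v, Finset.mem_filter.2 ⟨hv, h⟩, fun h' => lexLt_irrefl _ (Finset.mem_filter.1 h').2⟩)
  rw [Finset.mem_filter] at hw ⊢
  exact ⟨hw.1, h.trans hw.2⟩

/-- The search phase ends. -/
theorem exists_leavesSearch (C : Config) (h : C.state = .search) :
    ∃ n : ℕ, (Config.step^[n] C).LeavesSearch := by
  classical
  induction hn : (C.tiles.filter fun u => LexLt C.pos u).card using Nat.strong_induction_on
    generalizing C with
  | _ n ih =>
    by_cases hs : SearchDone C.look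
    · exact ⟨0, h, hs⟩
    have hstep : ∃ d : Dir, transition C.state C.look = (move d, .search) ∧ d ∈ C.look.nbr ∧
        LexLt C.pos (C.pos + d.vec) := by
      rw [h]
      change ∃ d : Dir, searchStep C.look = _ ∧ _
      unfold searchStep SearchDone at *
      split_ifs with h1 h2 h3 h4 h5 h6
      · exact ⟨_, rfl, h1, by simp [LexLt, Dir.vec]⟩
      · exact ⟨_, rfl, h2, by simp [LexLt, Dir.vec]⟩
      · exact ⟨_, rfl, h3, by simp [LexLt, Dir.vec]⟩
      · exact ⟨_, rfl, h4, by simp [LexLt, Dir.vec]⟩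
      · exact ⟨_, rfl, h5, by simp [LexLt, Dir.vec]⟩
      · exact ⟨_, rfl, h6, by simp [LexLt, Dir.vec]⟩
      · exact absurd ⟨h1, h2, h3, h4, h5, h6⟩ hs
    obtain ⟨d, ht, hd, hlt⟩ := hstep
    have hC : C.step = ⟨C.tiles, C.pos + d.vec, C.carries, .search⟩ := by
      simp [Config.step, Config.action, ht, Config.perform]
    have hmem : C.pos + d.vec ∈ C.tiles := by simpa [Config.look] using hd
    have hcard : (C.step.tiles.filter fun u => LexLt C.step.pos u).card < n := by
      rw [← hn, hC]
      exact card_lexLt_lt hmem hlt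
    obtain ⟨m, hm⟩ := ih _ hcard C.step (by rw [hC]) rfl
    exact ⟨m + 1, hm⟩

end

/-! ### Fragments and peaks under projection -/

section

variable {T P F R : Finset Node} {u v w : Node}

theorem IsFrag.mem_of_joined (h : IsFrag T P) (hv : v ∈ P) (hj : Joined (layer T v.2.2) v u) :
    u ∈ P := by
  refine (hj.mem_of_closed (P := P) (fun a ha b hb hab => ?_) hv :)
  exact h.closed a ha b hb.1 hab (hb.2.trans (h.level _ hv _ ha))

theorem IsFrag.joined_layer (h : IsFrag T P) (hv : v ∈ P) (hu : u ∈ P) :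
    Joined (layer T v.2.2) v u :=
  (h.joined v hv u hu).mono fun _ ha => ⟨h.subset ha, h.level _ ha _ hv⟩

theorem IsFrag.eq_of_mem (h : IsFrag T P) (h' : IsFrag T R) (hv : v ∈ P) (hv' : v ∈ R) : P = R := by
  ext u
  exact ⟨fun hu => h'.mem_of_joined hv' (h.joined_layer hv hu),
    fun hu => h.mem_of_joined hv (h'.joined_layer hv' hu)⟩

theorem exists_isFrag (hv : v ∈ T) : ∃ F, v ∈ F ∧ IsFrag T F := by
  classical
  have hmem : ∀ u, u ∈ T.filter (fun u => Joined (layer T v.2.2) v u) ↔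
      Joined (layer T v.2.2) v u := by
    intro u
    rw [Finset.mem_filter, and_iff_right_iff_imp]
    exact fun h => (h.mem ⟨hv, rfl⟩).1
  have hlev : ∀ u, Joined (layer T v.2.2) v u → u.2.2 = v.2.2 := fun u h => (h.mem ⟨hv, rfl⟩).2
  have hj : ∀ u, Joined (layer T v.2.2) v u →
      Joined (T.filter fun u => Joined (layer T v.2.2) v u : Finset Node) v u := by
    intro u h
    induction h with
    | refl => exact .refl _ _
    | tail h1 h2 ih =>
      exact ih.trans (.of_adj ((hmem _).2 h1) ((hmem _).2 (h1.tail h2)) h2.2.2)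
  refine ⟨T.filter fun u => Joined (layer T v.2.2) v u, (hmem _).2 (.refl _ _),
    ⟨v, (hmem _).2 (.refl _ _)⟩, Finset.filter_subset _ _, ?_, ?_, ?_⟩
  · intro a ha b hb
    rw [hlev a ((hmem _).1 ha), hlev b ((hmem _).1 hb)]
  · intro a ha b hb hab hz
    rw [hmem] at ha ⊢
    exact ha.trans (.of_adj (ha.mem ⟨hv, rfl⟩) ⟨hb, hz.trans (hlev _ ha)⟩ hab)
  · intro a ha b hb
    exact (hj _ ((hmem _).1 ha)).symm.trans (hj _ ((hmem _).1 hb))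

theorem IsFrag.isFragment (h : IsFrag T F) : IsFragment T (F : Set Node) := by
  obtain ⟨v, hv⟩ := h.nonempty
  refine ⟨v.2.2, (fcc.induce {u : Node | u ∈ T ∧ u.2.2 = v.2.2}).connectedComponentMk
    ⟨v, h.subset hv, rfl⟩, ?_⟩
  ext u
  simp only [Finset.mem_coe, Set.mem_image, SimpleGraph.ConnectedComponent.mem_supp_iff,
    SimpleGraph.ConnectedComponent.eq]
  constructor
  · intro hu
    exact ⟨⟨u, h.subset hu, h.level _ hu _ hv⟩,
      (reachable_induce_iff _ _).2 (h.joined_layer hv hu).symm, rfl⟩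
  · rintro ⟨u, hu, rfl⟩
    exact h.mem_of_joined hv ((reachable_induce_iff _ _).1 hu).symm

theorem low_injOn (h : IsFrag T P) : Set.InjOn (low T) P := by
  intro a ha b hb hab
  have h1 := h.level _ ha _ hb
  simp only [low, Prod.mk.injEq] at hab
  exact Prod.ext hab.1 (Prod.ext hab.2.1 h1)

theorem disjoint_image_low : Disjoint (T \ P) (P.image (low T)) := by
  rw [Finset.disjoint_left]
  intro a ha ha'
  obtain ⟨p, -, rfl⟩ := Finset.mem_image.1 ha'
  exact low_notMem T p (Finset.mem_sdiff.1 ha).1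

theorem sum_projected (h : IsFrag T P) (f : Node → ℤ) (hf : ∀ p, f (low T p) = f p) :
    ∑ v ∈ projected T P, f v = ∑ v ∈ T, f v := by
  rw [projected, Finset.sum_union disjoint_image_low, Finset.sum_image (low_injOn h),
    Finset.sum_congr rfl fun p _ => hf p, Finset.sum_sdiff h.subset]

theorem card_projected (h : IsFrag T P) : (projected T P).card = T.card := by
  have := sum_projected h (fun _ => 1) fun _ => rfl
  simpa using this

theorem inBox_projected {x₀ y₀ y₁ : ℤ} (hb : InBox x₀ y₀ y₁ T) (h : P ⊆ T) :
    InBox x₀ y₀ y₁ (projected T P) := by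
  refine ⟨fun w hw => ?_, ?_⟩
  · rcases mem_projected.1 hw with ⟨hw, -⟩ | ⟨p, hp, rfl⟩
    · exact hb.1 w hw
    · exact hb.1 p (h hp)
  · obtain ⟨v, hv, hvx⟩ := hb.2
    by_cases hP : v ∈ P
    · exact ⟨low T v, mem_projected.2 (.inr ⟨v, hP, rfl⟩), hvx⟩
    · exact ⟨v, mem_projected.2 (.inl ⟨hv, hP⟩), hvx⟩

theorem potential_projected {x₀ y₀ y₁ : ℤ} (h : IsFrag T P) :
    potential x₀ y₀ y₁ (projected T P) = potential x₀ y₀ y₁ T :=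
  sum_projected h _ fun _ => rfl

/-- A node `DSW` of the projected fragment is tiled after the projection. -/
theorem down_mem_projected (h : IsFrag T P) (hu : u ∈ P) : u + DSW.vec ∈ projected T P := by
  obtain ⟨x, y, z⟩ := u
  have hd : ((x, y, z) : Node) + DSW.vec = (x, y, z - 1) := by
    simp [Dir.vec, ← sub_eq_add_neg]
  rw [hd, mem_projected]
  rcases (depth_pos T (x, y, z)).eq_or_lt with h1 | h1
  · refine .inr ⟨_, hu, ?_⟩
    rw [low, ← h1]
  · refine .inl ⟨mem_of_lt_depth T le_rfl h1, fun hP => ?_⟩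
    have := h.level _ hu _ hP
    simp only at this
    omega

theorem down_adj_down (h : fcc.Adj u v) : fcc.Adj (u + DSW.vec) (v + DSW.vec) := by
  obtain ⟨d, rfl⟩ := h
  exact ⟨d, add_right_comm _ _ _⟩

/-- The fragment that contains one node `DSW` of the projected fragment contains all of them. -/
theorem down_mem_frag (h : IsFrag T P) (hF : IsFrag (projected T P) F) (hu : u ∈ P)
    (huF : u + DSW.vec ∈ F) (hv : v ∈ P) : v + DSW.vec ∈ F := by
  refine hF.mem_of_joined huF
    (Joined.map (f := (· + DSW.vec)) (fun a ha b hb hab => ?_) (h.joined u hu v hv))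
  have hlev : ∀ a ∈ P, a + DSW.vec ∈ layer (projected T P) (u + DSW.vec).2.2 := fun a ha =>
    ⟨down_mem_projected h ha, by simp [h.level _ ha _ hu]⟩
  exact .of_adj (hlev _ ha) (hlev _ hb) (down_adj_down hab)

open Classical in
/-- The fragments that are platforms. -/
noncomputable def peaks (T : Finset Node) : Finset (Finset Node) :=
  T.powerset.filter fun P => IsFrag T P ∧ IsPlatform T (P : Set Node)

theorem mem_peaks : P ∈ peaks T ↔ IsFrag T P ∧ IsPlatform T (P : Set Node) := by
  classical
  rw [peaks, Finset.mem_filter, Finset.mem_powerset, and_iff_right_iff_imp]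
  exact fun h => h.1.subset

/-- A projection creates no peak, except possibly for the fragment that it extends: a tile moved by
more than one layer has a tile at `UNE`. -/
theorem peaks_projected_subset (h : IsFrag T P) (hF : IsFrag (projected T P) F)
    (hu : u ∈ P) (huF : u + DSW.vec ∈ F) :
    (peaks (projected T P)).erase F ⊆ (peaks T).erase P := by
  intro R hR
  rw [Finset.mem_erase, mem_peaks] at hR ⊢
  obtain ⟨hne, hR, hpl⟩ := hR
  have hF' : ∀ a ∈ R, a ∉ F := fun a ha haF => hne (hR.eq_of_mem hF ha haF)
  -- the tiles of `R` have not been moved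
  have hold : ∀ a ∈ R, a ∈ T ∧ a ∉ P := by
    intro a ha
    rcases mem_projected.1 (hR.subset ha) with h1 | ⟨p, hp, rfl⟩
    · exact h1
    exfalso
    rcases (depth_pos T p).eq_or_lt with h1 | h1
    · refine hF' _ ha ?_
      have := down_mem_frag h hF hu huF hp
      rw [low, ← h1]
      convert this using 1
      simp [Prod.ext_iff, Dir.vec, ← sub_eq_add_neg]
    · refine (hpl _ ha).2.2 (mem_projected.2 (.inl ?_))
      have h2 : low T p + UNE.vec = (p.1, p.2.1, p.2.2 - (depth T p - 1)) := by
        simp [low, Prod.ext_iff, Dir.vec]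
        omega
      rw [h2]
      refine ⟨mem_of_lt_depth T (by omega) (by omega), fun hP => ?_⟩
      have := h.level _ hp _ hP
      simp only at this
      omega
  -- a tile of `P` above `R` would be projected to `F`, next to `R`
  have hup : ∀ a ∈ R, ∀ d : Dir, a + d.vec + DSW.vec = a ∨ fcc.Adj (a + d.vec + DSW.vec) a →
      (d.vec).2.2 = 1 → a + d.vec ∈ T → a + d.vec ∈ projected T P := by
    intro a ha d hd hz hT
    refine mem_projected.2 (.inl ⟨hT, fun hP => hF' a ha ?_⟩)
    have h1 := down_mem_frag h hF hu huF hP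
    rcases hd with hd | hd
    · rwa [hd] at h1
    · refine hF.closed _ h1 _ (hR.subset ha) hd ?_
      have h2 : DSW.vec.2.2 = -1 := rfl
      simp [hz, h2]
  refine ⟨?_, ⟨hR.nonempty, fun a ha => (hold a ha).1, hR.level, ?_, hR.joined⟩, ?_⟩
  · rintro rfl
    obtain ⟨a, ha⟩ := hR.nonempty
    exact (hold a ha).2 ha
  · intro a ha b hb hab hz
    refine hR.closed a ha b (mem_projected.2 (.inl ⟨hb, fun hP => (hold a ha).2 ?_⟩)) hab hz
    exact h.closed b hP a (hold a ha).1 hab.symm hz.symm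
  · intro a ha
    obtain ⟨h1, h2, h3⟩ := hpl a ha
    refine ⟨fun h4 => h1 (hup a ha UW (.inr ⟨NE, ?_⟩) rfl h4),
      fun h4 => h2 (hup a ha USE (.inr ⟨N, ?_⟩) rfl h4),
      fun h4 => h3 (hup a ha UNE (.inl ?_) rfl h4)⟩ <;> simp [Dir.vec, Prod.ext_iff]

/-- If the fragment extended by a projection is not a platform, then a peak is lost. -/
theorem card_peaks_projected_le (h : IsFrag T P) (hpl : IsPlatform T (P : Set Node))
    (hF : IsFrag (projected T P) F) (hu : u ∈ P) (huF : u + DSW.vec ∈ F) :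
    (peaks (projected T P)).card ≤ (peaks T).card ∧
      ((peaks (projected T P)).card = (peaks T).card →
        IsPlatform (projected T P) (F : Set Node)) := by
  have h1 := Finset.card_le_card (peaks_projected_subset h hF hu huF)
  have hP : P ∈ peaks T := mem_peaks.2 ⟨h, hpl⟩
  have h2 := Finset.card_erase_add_one hP
  by_cases hFp : F ∈ peaks (projected T P)
  · have h3 := Finset.card_erase_add_one hFp
    exact ⟨by omega, fun _ => (mem_peaks.1 hFp).2⟩
  · rw [Finset.erase_eq_of_notMem hFp] at h1
    exact ⟨by omega, fun h => by omega⟩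

end

/-! ### Executions in which tiles are only moved by projections -/

theorem exists_stable (f : ℕ → ℕ) (h : ∀ k, f (k + 1) ≤ f k) :
    ∃ K, ∀ k, K ≤ k → f (k + 1) = f k := by
  have ha : Antitone f := antitone_nat_of_succ_le h
  obtain ⟨K, hK⟩ := exists_minimalFor_of_wellFoundedLT (fun _ => True) f ⟨0, trivial⟩
  have hmin : ∀ k, f K ≤ f k := fun k => by
    rcases le_total (f k) (f K) with h1 | h1
    · exact hK.2 trivial h1
    · exact h1
  exact ⟨K, fun k hk => le_antisymm (h k) ((ha hk).trans (hmin _))⟩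

/-- The tiles `T k` and the agent's positions `p k` at the beginnings of the phases, if no phase
moves tiles in any other way than by a projection. -/
structure Run (T : ℕ → Finset Node) (p : ℕ → Node) : Prop where
  mem : ∀ k, p k ∈ T k
  conn : ∀ k, Conn (T k : Set Node)
  next : ∀ k, T (k + 1) = T k ∧ Climbs (T k) (p k) (p (k + 1)) ∨
    Projects (T k) (p k) (T (k + 1)) (p (k + 1))

/-- There are tiles from `w` in direction `UNE` up to a node of `F`. -/
def Hangs (T F : Finset Node) (w : Node) : Prop :=
  ∃ n : ℕ, (w.1, w.2.1, w.2.2 + n) ∈ F ∧ ∀ i ≤ n, (w.1, w.2.1, w.2.2 + (i : ℤ)) ∈ T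

/-- A projection lengthens the columns that hang from the projected fragment `P` by their new tiles,
so that they hang from the fragment `F` below. -/
theorem Hangs.of_projected {T P F : Finset Node} (h : IsFrag T P)
    (hF : ∀ u ∈ P, u + DSW.vec ∈ F) {w : Node} (hw : w ∈ projected T P)
    (hw' : w ∈ T → w ∉ P → Hangs T P w) : Hangs (projected T P) F w := by
  have hdown : ∀ {x y z : ℤ}, (x, y, z) ∈ P → (x, y, z - 1) ∈ F := fun hu => by
    simpa [Dir.vec, ← sub_eq_add_neg] using hF _ hu
  have hkeep : ∀ {x y z x' y' z' : ℤ}, (x, y, z) ∈ P → (x', y', z') ∈ T → z' < z →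
      (x', y', z') ∈ projected T P := by
    intro x y z x' y' z' h1 h2 h3
    refine mem_projected.2 (.inl ⟨h2, fun h4 => ?_⟩)
    have := h.level _ h1 _ h4
    simp only at this
    omega
  rcases mem_projected.1 hw with ⟨hT, hP⟩ | ⟨⟨x, y, z⟩, hp, rfl⟩
  · obtain ⟨x, y, z⟩ := w
    obtain ⟨n, hn, hi⟩ := hw' hT hP
    simp only at hn hi
    have hn0 : n ≠ 0 := by
      rintro rfl
      exact hP (by simpa using hn)
    refine ⟨n - 1, ?_, fun i hin => hkeep hn (hi i (by omega)) (by simp only; omega)⟩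
    have := hdown hn
    simp only
    convert this using 3
    omega
  · have hd := depth_pos T (x, y, z)
    refine ⟨(depth T (x, y, z) - 1).toNat, ?_, fun i hin => ?_⟩
    · have := hdown hp
      simp only [low]
      convert this using 3
      omega
    · by_cases hi0 : i = 0
      · subst hi0
        simpa using hw
      · have h1 := mem_of_lt_depth T (p := (x, y, z)) (i := depth T (x, y, z) - i) (by omega)
          (by omega)
        simp only [low]
        refine hkeep hp ?_ (by omega)
        convert h1 using 3
        simp only
        omega

namespace Run

variable {T : ℕ → Finset Node} {p : ℕ → Node}

/-- As the search ascends, the next projection comes. -/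
theorem exists_projects (h : Run T p) (k : ℕ) : ∃ j, k ≤ j ∧ T j = T k ∧
    (∀ i, k ≤ i → i < j → T (i + 1) = T i ∧ Climbs (T i) (p i) (p (i + 1))) ∧
    Projects (T j) (p j) (T (j + 1)) (p (j + 1)) := by
  classical
  induction hn : ((T k).filter fun u => LexLt (p k) u).card using Nat.strong_induction_on
    generalizing k with
  | _ n ih =>
    rcases h.next k with h1 | h1
    · have hcard : ((T (k + 1)).filter fun u => LexLt (p (k + 1)) u).card < n := by
        rw [← hn, h1.1]
        exact card_lexLt_lt (h1.1 ▸ h.mem (k + 1)) h1.2.1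
      obtain ⟨j, hj, hT, hi, hp⟩ := ih _ hcard (k + 1) rfl
      refine ⟨j, by omega, hT.trans h1.1, fun i hik hij => ?_, hp⟩
      rcases hik.eq_or_lt with rfl | hik
      · exact h1
      · exact hi i hik hij
    · exact ⟨k, le_rfl, rfl, fun i _ _ => by omega, h1⟩

theorem card_eq (h : Run T p) (k : ℕ) : (T k).card = (T 0).card := by
  induction k with
  | zero => rfl
  | succ k ih =>
    rcases h.next k with ⟨h1, -⟩ | ⟨P, -, hP, -, -, h1, -⟩
    · rw [h1, ih]
    · rw [h1, card_projected hP, ih]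

/-- At the beginning of phase `k`, the agent is in the peak `F`. -/
def AtPeak (T : ℕ → Finset Node) (p : ℕ → Node) (k : ℕ) (F : Finset Node) : Prop :=
  p k ∈ F ∧ IsFrag (T k) F ∧ IsPlatform (T k) (F : Set Node)

theorem card_peaks_succ_le (h : Run T p) (k : ℕ) :
    (peaks (T (k + 1))).card ≤ (peaks (T k)).card := by
  rcases h.next k with ⟨h1, -⟩ | ⟨P, -, hP, hpl, -, h1, u, hu, hpu⟩
  · rw [h1]
  · obtain ⟨F, hpF, hF⟩ := exists_isFrag (h.mem (k + 1))
    rw [h1] at hF ⊢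
    exact (card_peaks_projected_le hP hpl hF hu (hpu ▸ hpF)).1

/-- The search does not leave a peak. -/
theorem AtPeak.climbs {k : ℕ} {F : Finset Node} (h : Run T p) (hF : AtPeak T p k F)
    (hT : T (k + 1) = T k) (hc : Climbs (T k) (p k) (p (k + 1))) :
    AtPeak T p (k + 1) F ∧ (p (k + 1)).2.2 = (p k).2.2 := by
  obtain ⟨hp, hF, hpl⟩ := hF
  obtain ⟨hlt, r, hr, d, hd⟩ := hc
  have hrF := hF.mem_of_joined hp hr
  have hrz := hF.level _ hrF _ hp
  have hmem : r + d.vec ∈ T k := by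
    rw [← hd, ← hT]
    exact h.mem _
  have hz : (p (k + 1)).2.2 = (p k).2.2 := by
    have h1 : (p (k + 1)).2.2 = r.2.2 + d.vec.2.2 := by rw [hd]; rfl
    have h2 : (p k).2.2 ≤ (p (k + 1)).2.2 := by
      unfold LexLt at hlt
      omega
    have h3 : d.vec.2.2 = 0 := by
      obtain ⟨h4, h5, h6⟩ := hpl r hrF
      cases d
      case UNE => exact absurd hmem h6
      case UW => exact absurd hmem h4
      case USE => exact absurd hmem h5
      all_goals simp only [Dir.vec] at h1 ⊢
      all_goals omega
    omega
  refine ⟨⟨hF.closed r hrF _ (hT ▸ h.mem _) ⟨d, hd⟩ (hz.trans hrz.symm), ?_, ?_⟩, hz⟩ <;>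
    rwa [hT]

/-- When a peak is projected and the number of peaks does not change, then the agent gets into a
peak again, which extends the projected one. -/
theorem AtPeak.projects {k : ℕ} {P : Finset Node} (h : Run T p) (hP : IsFrag (T k) P)
    (hpl : IsPlatform (T k) (P : Set Node)) (hT : T (k + 1) = projected (T k) P) {u : Node}
    (hu : u ∈ P) (hpu : p (k + 1) = u + DSW.vec)
    (hcard : (peaks (T (k + 1))).card = (peaks (T k)).card) :
    ∃ F, AtPeak T p (k + 1) F ∧ ∀ v ∈ P, v + DSW.vec ∈ F := by
  obtain ⟨F, hpF, hF⟩ := exists_isFrag (h.mem (k + 1))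
  have hF' := hF
  rw [hT] at hF' hcard
  refine ⟨F, ⟨hpF, hF, ?_⟩, fun v hv => down_mem_frag hP hF' hu (hpu ▸ hpF) hv⟩
  rw [hT]
  exact (card_peaks_projected_le hP hpl hF' hu (hpu ▸ hpF)).2 hcard

/-- One phase that starts in a peak. -/
theorem AtPeak.next {k : ℕ} {F : Finset Node} (h : Run T p) (hF : AtPeak T p k F)
    (hcard : (peaks (T (k + 1))).card = (peaks (T k)).card) :
    ∃ F', AtPeak T p (k + 1) F' ∧ (p (k + 1)).2.2 ≤ (p k).2.2 ∧
      (∀ w ∈ T (k + 1), (w ∈ T k → Hangs (T k) F w) → Hangs (T (k + 1)) F' w) := by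
  rcases h.next k with ⟨h1, hc⟩ | ⟨P, hpP, hP, hpl, -, h1, u, hu, hpu⟩
  · obtain ⟨h2, h3⟩ := hF.climbs h h1 hc
    refine ⟨F, h2, h3.le, fun w hw hw' => ?_⟩
    rw [h1] at hw ⊢
    exact hw' hw
  · obtain rfl := hP.eq_of_mem hF.2.1 hpP hF.1
    obtain ⟨F', h2, h3⟩ := AtPeak.projects h hP hpl h1 hu hpu hcard
    refine ⟨F', h2, ?_, fun w hw hw' => ?_⟩
    · have h4 := hP.level _ hu _ hpP
      have h5 : (u + DSW.vec).2.2 = u.2.2 + -1 := rfl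
      rw [hpu]
      omega
    · rw [h1] at hw ⊢
      exact .of_projected hP h3 hw fun h4 _ => hw' h4

/-- In the end, the agent is always in a peak that is a parallelogram and from which all tiles
hang. -/
theorem exists_hangs (h : Run T p) : ∃ K, ∀ k, K ≤ k → ∃ F, IsFrag (T k) F ∧
    IsPlatform (T k) (F : Set Node) ∧ IsParallelogram F ∧ ∀ w ∈ T k, Hangs (T k) F w := by
  classical
  obtain ⟨K₀, hK₀⟩ := exists_stable (fun k => (peaks (T k)).card) h.card_peaks_succ_le
  obtain ⟨K₁, hK₁, -, -, P, -, hP, hpl, -, h1, u, hu, hpu⟩ := h.exists_projects K₀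
  obtain ⟨F₀, hF₀, -⟩ := AtPeak.projects h hP hpl h1 hu hpu (hK₀ _ hK₁)
  -- the tiles that do not hang from the agent's peak are never moved
  obtain ⟨M, hM⟩ := exists_bound (T (K₁ + 1))
  have hpeak : ∀ k, K₁ + 1 ≤ k → ∃ F, AtPeak T p k F ∧
      ∀ w ∈ T k, ¬ Hangs (T k) F w → w ∈ T (K₁ + 1) := by
    intro k hk
    induction k, hk using Nat.le_induction with
    | base => exact ⟨F₀, hF₀, fun w hw _ => hw⟩
    | succ k hk ih =>
      obtain ⟨F, hF, hU⟩ := ih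
      obtain ⟨F', hF', -, hH⟩ := hF.next h (hK₀ k (by omega))
      refine ⟨F', hF', fun w hw hw' => ?_⟩
      by_contra hw''
      exact hw' (hH w hw fun h2 => by_contra fun h3 => hw'' (hU w h2 h3))
  have hle : ∀ k j, K₁ + 1 ≤ k → k ≤ j → (p j).2.2 ≤ (p k).2.2 := by
    intro k j hk hkj
    induction j, hkj using Nat.le_induction with
    | base => exact le_rfl
    | succ j hj ih =>
      obtain ⟨F, hF, -⟩ := hpeak j (by omega)
      obtain ⟨-, -, h2, -⟩ := hF.next h (hK₀ j (by omega))
      exact h2.trans ih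
  -- the level of the agent tends to minus infinity
  have hlow : ∀ n : ℕ, ∃ k, K₁ + 1 ≤ k ∧ (p k).2.2 ≤ (p (K₁ + 1)).2.2 - n := by
    intro n
    induction n with
    | zero => exact ⟨_, le_rfl, by simp⟩
    | succ n ih =>
      obtain ⟨k, hk, hkn⟩ := ih
      obtain ⟨j, hj, -, -, P, hpP, hP, -, -, -, u, hu, hpu⟩ := h.exists_projects k
      refine ⟨j + 1, by omega, ?_⟩
      have h2 := hle k j hk hj
      have h3 := hP.level _ hu _ hpP
      have h4 : (u + DSW.vec).2.2 = u.2.2 + -1 := rfl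
      rw [hpu]
      push_cast
      omega
  obtain ⟨K, hK, hKn⟩ := hlow ((p (K₁ + 1)).2.2 + M + (T 0).card + 1).toNat
  refine ⟨K, fun k hk => ?_⟩
  obtain ⟨F, hF, hU⟩ := hpeak k (by omega)
  refine ⟨F, hF.2.1, hF.2.2, ?_, fun w hw => ?_⟩
  · -- the same fragment is going to be projected
    obtain ⟨j, hj, hTj, hi, P, hpP, hP, -, hpar, -⟩ := h.exists_projects k
    have hFj : ∀ i, k ≤ i → i ≤ j → AtPeak T p i F := by
      intro i hki hij
      induction i, hki using Nat.le_induction with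
      | base => exact hF
      | succ i hki ih =>
        obtain ⟨h2, h3⟩ := hi i hki (by omega)
        exact ((ih (by omega)).climbs h h2 h3).1
    obtain ⟨h2, h3, -⟩ := hFj j hj le_rfl
    rwa [← hP.eq_of_mem h3 hpP h2]
  · by_contra hw'
    obtain ⟨x, y, z⟩ := w
    have h2 := hM _ _ _ (hU _ hw hw')
    have h3 := (h.conn k).z_span hw (h.mem k)
    have h4 := hle K k hK hk
    rw [h.card_eq] at h3
    simp only at h3
    omega

end Run

/-! ### Icicles -/

/-- A platform from which all tiles hang, and which is a parallelogram, makes an icicle. -/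
theorem isIcicle_of_hangs {T F : Finset Node} {x₀ y₀ y₁ : ℤ} (hbox : InBox x₀ y₀ y₁ T)
    (hF : IsFrag T F) (hpl : IsPlatform T (F : Set Node)) (hpar : IsParallelogram F)
    (hH : ∀ w ∈ T, Hangs T F w) : IsIcicle x₀ T := by
  have hne : T.Nonempty := hF.nonempty.mono hF.subset
  have hcov : ∀ v ∈ T, ∃ w ∈ F, w.1 = v.1 ∧ w.2.1 = v.2.1 := by
    intro v hv
    obtain ⟨n, hn, -⟩ := hH v hv
    exact ⟨_, hn, rfl, rfl⟩
  obtain ⟨xe, X, b, t₀, t, Z, hxX, hb, ht, heq, hmem⟩ := hpar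
  -- the extreme coordinates are attained in the parallelogram
  have hcorner : (xe, b, Z) ∈ F := by
    rw [hmem]
    omega
  have hcorner' : (xe, t, Z) ∈ F := by
    rw [hmem]
    omega
  have hrange : ∀ v ∈ T, xe ≤ v.1 ∧ b ≤ v.2.1 ∧ v.2.1 ≤ t := by
    intro v hv
    obtain ⟨⟨x, y, z⟩, hw, h1, h2⟩ := hcov v hv
    rw [hmem] at hw
    rw [← h1, ← h2]
    simp only
    omega
  have hx₀ : xe = x₀ := by
    obtain ⟨v, hv, hvx⟩ := hbox.2
    have h1 := (hrange v hv).1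
    have h2 := (hbox.1 _ (hF.subset hcorner)).1
    simp only at h2
    omega
  subst hx₀
  have hy : yMin T = b := by
    refine IsLeast.csInf_eq ⟨⟨_, hF.subset hcorner, rfl⟩, ?_⟩
    rintro _ ⟨v, hv, rfl⟩
    exact (hrange v hv).2.1
  have hy' : yMax T = t := by
    refine IsGreatest.csSup_eq ⟨⟨_, hF.subset hcorner', rfl⟩, ?_⟩
    rintro _ ⟨v, hv, rfl⟩
    exact (hrange v hv).2.2
  have hxy : ∀ v, xy xe T v = (v.1 - xe) * (t - b + 1) + (v.2.1 - b) := by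
    intro v
    rw [xy, height, hy, hy']
  refine ⟨F, hF.isFragment, hpl, fun v hv => ?_, ?_, fun v hv hvF => ?_⟩
  · obtain ⟨w, hw, h1, h2⟩ := hcov v hv
    exact ⟨w, hw, by rw [hxy, hxy, h1, h2]⟩
  · rintro ⟨x, y, z⟩ hv i hi0 hi
    rw [Finset.mem_coe, hmem] at hv
    rw [hxy] at hi
    simp only at hi
    have hpos : 0 < t - b + 1 := by omega
    have h1 := Int.emod_add_mul_ediv i (t - b + 1)
    have h2 := Int.emod_nonneg i hpos.ne'
    have h3 := Int.emod_lt_of_pos i hpos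
    have h4 := Int.ediv_nonneg hi0 hpos.le
    generalize i % (t - b + 1) = r at *
    generalize i / (t - b + 1) = k at *
    -- the quotient and the remainder are the coordinates of the node that is looked for
    have h5 : k ≤ x - xe := by
      by_contra! h6
      have := mul_le_mul_of_nonneg_right (show x - xe + 1 ≤ k by omega) hpos.le
      have h7 : (x - xe + 1) * (t - b + 1) = (x - xe) * (t - b + 1) + (t - b + 1) := by ring
      have h8 : (t - b + 1) * k = k * (t - b + 1) := mul_comm _ _
      omega
    have h6 : k = x - xe → r ≤ y - b := by
      rintro rfl
      have h8 : (t - b + 1) * (x - xe) = (x - xe) * (t - b + 1) := mul_comm _ _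
      omega
    refine ⟨(xe + k, b + r, Z), ?_, ?_⟩
    · rw [Finset.mem_coe, hmem]
      omega
    · rw [hxy, ← h1]
      simp only
      ring
  · obtain ⟨n, hn, hi⟩ := hH v hv
    have hn0 : n ≠ 0 := by
      rintro rfl
      exact hvF (by simpa using hn)
    have := hi 1 (by omega)
    convert this using 1
    simp [Prod.ext_iff, Dir.vec]

/-! ### The whole execution -/

/-- The times at which the phases of an execution begin. -/
theorem exists_phases {C : Config} (hC : AtSearch C) :
    ∃ c : ℕ → ℕ, c 0 = 0 ∧ (∀ k, c k < c (k + 1)) ∧ (∀ k, AtSearch (Config.step^[c k] C)) ∧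
      (∀ k, Outcome (Config.step^[c k] C).tiles (Config.step^[c k] C).pos
        (Config.step^[c (k + 1)] C)) ∧
      ∀ k i, c k ≤ i → i < c (k + 1) → Good (Config.step^[c k] C).tiles (Config.step^[i] C) := by
  have hnext : ∀ n : {n : ℕ // AtSearch (Config.step^[n] C)},
      ∃ m : {n : ℕ // AtSearch (Config.step^[n] C)}, n.1 < m.1 ∧
        Outcome (Config.step^[n.1] C).tiles (Config.step^[n.1] C).pos (Config.step^[m.1] C) ∧
        ∀ i, n.1 ≤ i → i < m.1 → Good (Config.step^[n.1] C).tiles (Config.step^[i] C) := by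
    rintro ⟨n, hn⟩
    obtain ⟨m, hm, ho, hg⟩ := hn.exists_iterate
    rw [← Function.iterate_add_apply] at ho
    refine ⟨⟨m + n, ho.1⟩, by simp only; omega, ho, fun i h1 h2 => ?_⟩
    have := hg (i - n) (by simp only at h1 h2; omega)
    rwa [← Function.iterate_add_apply, Nat.sub_add_cancel h1] at this
  choose f hf using hnext
  have hs : ∀ k, f (f^[k] ⟨0, hC⟩) = f^[k + 1] ⟨0, hC⟩ := fun k =>
    (Function.iterate_succ_apply' f k _).symm
  refine ⟨fun k => (f^[k] ⟨0, hC⟩).1, rfl, fun k => ?_, fun k => (f^[k] ⟨0, hC⟩).2, fun k => ?_,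
    fun k => ?_⟩ <;> simp only [← hs]
  · exact (hf _).1
  · exact (hf _).2.1
  · exact (hf _).2.2

/-- Finally, the tiles are only moved by projections. -/
theorem exists_run {C : ℕ → Config} (hC : ∀ k, AtSearch (C k))
    (ho : ∀ k, Outcome (C k).tiles (C k).pos (C (k + 1))) {x₀ y₀ y₁ : ℤ}
    (hbox : InBox x₀ y₀ y₁ (C 0).tiles) :
    (∀ k, InBox x₀ y₀ y₁ (C k).tiles) ∧
      ∃ K, Run (fun k => (C (K + k)).tiles) (fun k => (C (K + k)).pos) ∧
        ∀ k, K < k → (C k).state = .search := by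
  have hbox' : ∀ k, InBox x₀ y₀ y₁ (C k).tiles := by
    intro k
    induction k with
    | zero => exact hbox
    | succ k ih =>
      rcases (ho k).2 with ⟨h1, -⟩ | h1 | ⟨-, P, -, hP, -, -, h1, -⟩
      · rwa [h1]
      · exact (h1 _ _ _ ih).1
      · rw [h1]
        exact inBox_projected ih hP.subset
  refine ⟨hbox', ?_⟩
  have hpot : ∀ k, potential x₀ y₀ y₁ (C (k + 1)).tiles ≤ potential x₀ y₀ y₁ (C k).tiles := by
    intro k
    rcases (ho k).2 with ⟨h1, -⟩ | h1 | ⟨-, P, -, hP, -, -, h1, -⟩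
    · rw [h1]
    · exact (h1 _ _ _ (hbox' k)).2.le
    · rw [h1, potential_projected hP]
  obtain ⟨K, hK⟩ := exists_stable (fun k => (potential x₀ y₀ y₁ (C k).tiles).toNat)
    fun k => Int.toNat_le_toNat (hpot k)
  have hno : ∀ k, K ≤ k → (C (k + 1)).tiles = (C k).tiles ∧ (C (k + 1)).state = .search ∧
      Climbs (C k).tiles (C k).pos (C (k + 1)).pos ∨ (C (k + 1)).state = .search ∧
      Projects (C k).tiles (C k).pos (C (k + 1)).tiles (C (k + 1)).pos := by
    intro k hk
    rcases (ho k).2 with h1 | h1 | h1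
    · exact .inl h1
    · exfalso
      have h2 := (h1 _ _ _ (hbox' k)).2
      have h3 := potential_nonneg (hbox' (k + 1))
      have h4 := hK k hk
      omega
    · exact .inr h1
  refine ⟨K, ⟨fun k => (hC _).pos_mem, fun k => (hC _).conn, fun k => ?_⟩, fun k hk => ?_⟩
  · rcases hno (K + k) (by omega) with h1 | h1
    · exact .inl ⟨h1.1, h1.2.2⟩
    · exact .inr h1.2
  · obtain ⟨k, rfl⟩ := Nat.exists_eq_add_of_lt hk
    rcases hno (K + k) (by omega) with h1 | h1
    · exact h1.2.1
    · exact h1.1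

end Hybrid3D

open Hybrid3D

theorem mainTheorem1 (T₀ : Finset Hybrid3D.Node) (p₀ : Hybrid3D.Node) (hp : p₀ ∈ T₀)
    (hconn : (Hybrid3D.initial T₀ p₀).IsConnected) :
    (∀ t : ℕ, (Hybrid3D.execution T₀ p₀ t).IsConnected ∧
      (Hybrid3D.execution T₀ p₀ t).Admits (Hybrid3D.execution T₀ p₀ t).action) ∧
    (∀ t₀ : ℕ, ∃ t : ℕ, t₀ ≤ t ∧ (Hybrid3D.execution T₀ p₀ t).LeavesSearch) ∧
    (∃ t₀ : ℕ, ∀ t : ℕ, t₀ ≤ t → (Hybrid3D.execution T₀ p₀ t).LeavesSearch →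
      Hybrid3D.IsIcicle (Hybrid3D.xMin T₀) (Hybrid3D.execution T₀ p₀ t).tiles) := by
  have hC : AtSearch (initial T₀ p₀) := by
    refine ⟨hp, rfl, ?_, rfl⟩
    rcases hconn with h | ⟨h, -⟩
    · exact connected_induce_iff.1 h
    · have h1 := connected_induce_iff.1 h
      have h2 : ((initial T₀ p₀).tiles : Set Node) ∪ {(initial T₀ p₀).pos} = T₀ := by
        simpa [initial] using hp
      rwa [h2] at h1
  obtain ⟨c, hc0, hlt, hS, ho, hg⟩ := exists_phases hC
  have hmono : StrictMono c := strictMono_nat_of_lt_succ hlt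
  -- every time lies within some phase
  have hphase : ∀ t, ∃ k, c k ≤ t ∧ t < c (k + 1) := by
    intro t
    obtain ⟨k, hk⟩ : ∃ k, t < c k := ⟨t + 1, (hmono.le_apply (x := t + 1))⟩
    induction k with
    | zero => omega
    | succ k ih =>
      rcases le_or_gt (c k) t with h | h
      · exact ⟨k, h, hk⟩
      · exact ih h
  have hbox : InBox (xMin T₀) (yMin T₀) (yMax T₀) (Config.step^[c 0] (initial T₀ p₀)).tiles := by
    rw [hc0]
    exact inBox_extremes ⟨p₀, hp⟩
  obtain ⟨hbox', K, hrun, hsearch⟩ := exists_run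
    (C := fun k => Config.step^[c k] (initial T₀ p₀)) hS ho hbox
  refine ⟨fun t => ?_, fun t₀ => ?_, ?_⟩
  · obtain ⟨k, h1, h2⟩ := hphase t
    exact ⟨(hg k t h1 h2).1, (hg k t h1 h2).2.1⟩
  · have h1 := hsearch (K + t₀ + 1) (by omega)
    obtain ⟨n, hn⟩ := exists_leavesSearch _ h1
    refine ⟨n + c (K + t₀ + 1), ?_, ?_⟩
    · have := hmono.le_apply (x := K + t₀ + 1)
      omega
    · rwa [execution, Function.iterate_add_apply]
  · obtain ⟨L, hL⟩ := hrun.exists_hangs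
    refine ⟨c (K + L), fun t ht hleave => ?_⟩
    obtain ⟨k, h1, h2⟩ := hphase t
    have hk : K + L ≤ k := by
      have := hmono.lt_iff_lt.1 (ht.trans_lt h2)
      omega
    obtain ⟨i, rfl⟩ : ∃ i, k = K + i := ⟨k - K, by omega⟩
    obtain ⟨F, hF, hpl, hpar, hH⟩ := hL i (by omega)
    have htiles : (execution T₀ p₀ t).tiles = (Config.step^[c (K + i)] (initial T₀ p₀)).tiles :=
      (hg _ t h1 h2).2.2 hleave.1
    rw [htiles]
    exact isIcicle_of_hangs (hbox' (K + i)) hF hpl hpar hH
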